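/- **Setting.** Fix a set of function symbols with arities and a set $E$ of equations between terms. Messages $M,N$ are terms over countably many variables (names are variables bound by restriction), and $=_E$ is the congruence generated by the substitution instances of $E$. Assume that $E$ is *finitary*: for all messages $M,N$ there is a finite set of substitutions $\{\sigma_i\}_{i\in I}$ with $M\sigma_i=_E N\sigma_i$ such that every $\theta$ with $M\theta=_E N\theta$ is, up to $=_E$ on the variables of $M$ and $N$, of the form $\sigma_j\cdot\varsigma$ for some $j\in I$ and some $\varsigma$. Substitutions have finite domain. A substitution $\sigma$ is *fresh* for a set $D$ of variables if $\mathrm{dom}(\sigma)\cap D=\emptyset$ and $\mathrm{fv}(y\sigma)\cap D=\emptyset$ for all $y\notin D$. Processes of the applied $\pi$-calculus are $$P ::= 0 \mid \overline{M}\langle N\rangle.P \mid M(y).P \mid [M=N]P \mid [M\neq N]P \mid \nu x.P \mid P\,|\,P \mid P+P \mid\ !P ,$$ and extended processes in normal form are $\nu\vec x.(\theta\,|\,P)$, where the variables of $\mathrm{dom}(\theta)$ are not among $\vec x$, $\mathrm{fv}(P)$ and $\mathrm{fv}(y\theta)$ for any $y$. All of these are taken up to $\alpha$-conversion, and substitution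 avoids capture. A process $P$ is identified with $\mathrm{id}\,|\,P$. Actions are $\pi ::= \tau \mid \overline{M}(x) \mid M\,N$ (progress, bound output, free input), with $\mathrm{bn}(\overline M(x))=\{x\}$ and $\mathrm{bn}(\pi)=\emptyset$ otherwise. Open early transitions $\Gamma: A\xrightarrow{\pi}B$, for a set $\Gamma$ of private names, are given by these rules and the symmetric ones for $|$ and $+$; the channels in the rules for input, output and communication, and the two sides of a match, are compared up to $=_E$: - $\Gamma: M(y).P\xrightarrow{M\,N}P\{N/y\}$; and $\Gamma:\overline M\langle N\rangle.P\xrightarrow{\overline M(x)}\{N/x\}\,|\,P$ if $x\notin\mathrm{fv}(M)\cup\mathrm{fv}(N)\cup\mathrm{fv}(P)\cup\Gamma$. - If $\Gamma:P\xrightarrow{\pi}A$, then: $\Gamma:P+Q\xrightarrow{\pi}A$; $\Gamma:[M=M]P\xrightarrow{\pi}A$; $\Gamma:[M\neq N]P\xrightarrow{\pi}A$ provided that no substitution fresh for $\Gamma$ makes $M$ and $N$ equal modulo $=_E$; $\Gamma:P\,|\,Q\xrightarrow{\pi}A\,|\,Q$ if $\mathrm{bn}(\pi)\cap\mathrm{fv}(Q)=\emptyset$;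 and $\Gamma:\,!P\xrightarrow{\pi}A\,|\,!P$ if $\mathrm{bn}(\pi)\cap\mathrm{fv}(P)=\emptyset$. - If $\Gamma,x:A\xrightarrow{\pi}B$, with $x$ not in $\pi$ and $\Gamma$, then $\Gamma:\nu x.A\xrightarrow{\pi}\nu x.B$. If $\Gamma:P\xrightarrow{\pi\theta}A$ and $\theta$ is fresh for $\mathrm{bn}(\pi)$, then $\Gamma:\theta\,|\,P\xrightarrow{\pi}\theta\,|\,A$. - If $\Gamma:P\xrightarrow{\overline M(x)}\nu\vec z.(\{N/x\}\,|\,P')$ and $\Gamma:Q\xrightarrow{M\,N}Q'$ with $x,\vec z\notin\mathrm{fv}(Q)$, then $\Gamma:P\,|\,Q\xrightarrow{\tau}\nu\vec z.(P'\,|\,Q')$. If $\Gamma:P\xrightarrow{\overline M(x)}\nu\vec z.(\{N/x\}\,|\,P')$ and $\Gamma:P\xrightarrow{M\,N}R$ with $\vec z\notin\mathrm{fv}(P)$, then $\Gamma:\,!P\xrightarrow{\tau}\nu\vec z.(P'\,|\,R\,|\,!P)$. Write $A\xrightarrow{\pi}B$ for $\emptyset:A\xrightarrow{\pi}B$. For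 $A=\nu\vec x.(\theta\,|\,P)$, write $A\le_{\sigma,\nu\vec z.\rho}A'$ if $\sigma$ and $\rho$ are idempotent and fresh for $\mathrm{dom}(\theta)$, and $A'=\nu\vec z.(\rho\,|\,A\sigma\rho)$, where $\vec z$ are fresh names that may occur in the range of $\rho$ but not in $A$, $\sigma$ and the domains of $\rho$ and $\theta$. Extended processes $\nu\vec x.(\sigma\,|\,P)$ and $\nu\vec y.(\theta\,|\,Q)$ are *statically equivalent* if, for all messages $M,N$ not containing $\vec x,\vec y$, $M\sigma=_E N\sigma$ iff $M\theta=_E N\theta$. *Quasi-open bisimilarity* $\sim$ is the greatest symmetric relation $\mathcal R$ on extended processes such that, whenever $A\mathrel{\mathcal R}B$: $A$ and $B$ are statically equivalent; if $A\le_{\sigma,\nu\vec z.\rho}A'$ and $B\le_{\sigma,\nu\vec z.\rho}B'$, then $A'\mathrel{\mathcal R}B'$; and if $A\xrightarrow{\pi}A'$, with $\mathrm{bn}(\pi)$ fresh for $A$ and $B$, then $B\xrightarrow{\pi}B'$ and $A'\mathrel{\mathcal R}B'$ for some $B'$. Formulae of intuitionistic $\mathcal{FM}$ are $$\phi ::=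 \mathtt{tt}\mid\mathtt{ff}\mid M=N\mid\phi\wedge\phi\mid\phi\vee\phi\mid\phi\supset\phi\mid\langle\pi\rangle\phi\mid[\pi]\phi,$$ up to $\alpha$-conversion, where the modalities for $\overline M(x)$ bind $x$ in $\phi$, and $x$ is taken fresh when the formula is interpreted. Satisfaction is standard for $\mathtt{tt},\mathtt{ff},\wedge,\vee$, and - $\nu\vec x.(\theta\,|\,P)\vDash M=N$ iff $M\theta=_E N\theta$ (with $\vec x$ not in $M,N$); - $A\vDash\phi_1\supset\phi_2$ iff, whenever $A\le_{\sigma,\nu\vec z.\rho}A'$, $A'\vDash\phi_1\sigma$ implies $A'\vDash\phi_2\sigma$; - $A\vDash\langle\pi\rangle\phi$ iff $A\xrightarrow{\pi}B$ and $B\vDash\phi$ for some $B$; - $A\vDash[\pi]\phi$ iff, whenever $A\le_{\sigma,\nu\vec z.\rho}A'$ and $A'\xrightarrow{\pi\sigma}B$, $B\vDash\phi\sigma$. **Theorem.** For all processes $P,Q$ (in particular, for those of any fragment of the calculus on which $\sim$ is decidable): if $P\not\sim Q$, then there is a formula $\phi_L$ with $P\vDash\phi_L$ and $Q\not\vDash\phi_L$,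 and there is a formula $\phi_R$ with $Q\vDash\phi_R$ and $P\not\vDash\phi_R$. -/

import Mathlib

open FirstOrder.Language (Term)

universe u v

namespace AppliedPi

noncomputable section

/-! ## Messages and equational theories -/

/-- Messages over the function symbols of `L`, in a scope with `n` bound (restricted or input-bound)
names. `Sum.inl x` is the free variable `x`, and `Sum.inr i` is the bound name `i`. Bound names are
well-scoped, so that equality of processes is equality up to α-conversion and substitution is
capture avoiding; free variables are plain (named) variables. The newest bound name of scope `n + 1`
is `Fin.last n`. -/
abbrev Msg (L : FirstOrder.Language.{u, v}) (n : ℕ) : Type u := L.Term (ℕ ⊕ Fin n)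

/-- The equational theory `=_E` generated by a set `E` of equations: the least congruence that
contains all substitution instances of the equations. -/
inductive EqE {L : FirstOrder.Language.{u, v}} (E : Set (L.Term ℕ × L.Term ℕ)) {α : Type} :
    L.Term α → L.Term α → Prop
  | ax (l r : L.Term ℕ) (h : (l, r) ∈ E) (s : ℕ → L.Term α) : EqE E (l.subst s) (r.subst s)
  | refl (t : L.Term α) : EqE E t t
  | symm {t t' : L.Term α} : EqE E t t' → EqE E t' t
  | trans {t t' t'' : L.Term α} : EqE E t t' → EqE E t' t'' → EqE E t t''
  | congr {k : ℕ} (f : L.Functions k) (ts us : Fin k → L.Term α) :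
      (∀ i, EqE E (ts i) (us i)) → EqE E (.func f ts) (.func f us)

/-- The free variables of a message (bound names of the scope are not included). -/
def Msg.fv {L : FirstOrder.Language.{u, v}} {n : ℕ} (M : Msg L n) : Finset ℕ := M.varFinsetLeft

/-- Weakening of a message by `k` new bound names. -/
def Msg.wk {L : FirstOrder.Language.{u, v}} {n : ℕ} (k : ℕ) (M : Msg L n) : Msg L (n + k) :=
  M.relabel (Sum.map id (Fin.castAdd k))

/-- A message without bound names, seen in any scope. -/
def Msg.emb {L : FirstOrder.Language.{u, v}} (n : ℕ) (M : Msg L 0) : Msg L n :=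
  M.relabel (Sum.map id Fin.elim0)

/-- A substitution of messages in scope `n` for the free variables. It fixes the bound names. -/
abbrev Subst (L : FirstOrder.Language.{u, v}) (n : ℕ) : Type u := ℕ → Msg L n

/-- The identity substitution. -/
def Subst.ident {L : FirstOrder.Language.{u, v}} {n : ℕ} : Subst L n := fun x => Term.var (.inl x)

/-- The substitution that maps `x` to `N` and fixes all other variables. -/
def Subst.single {L : FirstOrder.Language.{u, v}} {n : ℕ} (x : ℕ) (N : Msg L n) : Subst L n :=
  Function.update Subst.ident x N

/-- `M.app σ` is `Mσ`. -/
def Msg.app {L : FirstOrder.Language.{u, v}} {n : ℕ} (M : Msg L n) (σ : Subst L n) : Msg L n :=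
  Term.subst M (Sum.elim σ (fun i => Term.var (.inr i)))

/-- The domain of a substitution: the variables that it moves. -/
def Subst.dom {L : FirstOrder.Language.{u, v}} {n : ℕ} (σ : Subst L n) : Set ℕ :=
  {x | σ x ≠ Term.var (Sum.inl x)}

/-- The composition `σ·θ`: first `σ`, then `θ`. -/
def Subst.comp {L : FirstOrder.Language.{u, v}} {n : ℕ} (σ θ : Subst L n) : Subst L n :=
  fun x => (σ x).app θ

/-- Weakening of a substitution by `k` new bound names. -/
def Subst.wk {L : FirstOrder.Language.{u, v}} {n : ℕ} (k : ℕ) (σ : Subst L n) : Subst L (n + k) :=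
  fun x => (σ x).wk k

/-- `σ` is idempotent: `σ·σ = σ`. -/
def Subst.Idempotent {L : FirstOrder.Language.{u, v}} {n : ℕ} (σ : Subst L n) : Prop :=
  σ.comp σ = σ

/-- `σ` is fresh for the set of variables `D`: `dom σ ∩ D = ∅`, and `fv(yσ) ∩ D = ∅` for all
`y ∉ D`. -/
def Subst.FreshFor {L : FirstOrder.Language.{u, v}} {n : ℕ} (σ : Subst L n) (D : Set ℕ) : Prop :=
  Disjoint σ.dom D ∧ ∀ y, y ∉ D → Disjoint ((σ y).fv : Set ℕ) D

/-- The entailment `Γ ⊨ M ≠ N`, where `Γ` is the set of all bound names of the scope: no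
substitution that is fresh for `Γ` (neither moves a name of `Γ` nor introduces one) unifies `M` and
`N`. Substitutions of messages in the empty scope are exactly those that are fresh for `Γ`. -/
def Distinct {L : FirstOrder.Language.{u, v}} (E : Set (L.Term ℕ × L.Term ℕ)) {n : ℕ} (M N : Msg L n) : Prop :=
  ¬ ∃ σ : Subst L 0, σ.dom.Finite ∧
    EqE E (M.app (fun x => (σ x).emb n)) (N.app (fun x => (σ x).emb n))

/-- The equational theory generated by `E` is finitary: any two messages have a finite complete set
`S` of unifiers. Every unifier `θ` is an instance `σ·ς` of some `σ ∈ S`, up to `=_E`, on the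
variables of the two messages. -/
def Finitary {L : FirstOrder.Language.{u, v}} (E : Set (L.Term ℕ × L.Term ℕ)) : Prop :=
  ∀ M N : Msg L 0, ∃ S : Set (Subst L 0), S.Finite ∧
    (∀ σ ∈ S, σ.dom.Finite ∧ EqE E (M.app σ) (N.app σ)) ∧
    ∀ θ : Subst L 0, θ.dom.Finite → EqE E (M.app θ) (N.app θ) →
      ∃ σ ∈ S, ∃ ς : Subst L 0, ς.dom.Finite ∧
        ∀ x ∈ M.fv ∪ N.fv, EqE E ((σ x).app ς) (θ x)

/-! ## Processes -/

/-- Processes in a scope with `n` bound names. `inp` and `new` bind the newest name of the scope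
`n + 1`. -/
inductive Proc (L : FirstOrder.Language.{u, v}) : ℕ → Type u
  | nil {n : ℕ} : Proc L n
  | out {n : ℕ} (M N : Msg L n) (P : Proc L n) : Proc L n
  | inp {n : ℕ} (M : Msg L n) (P : Proc L (n + 1)) : Proc L n
  | mat {n : ℕ} (M N : Msg L n) (P : Proc L n) : Proc L n
  | mismat {n : ℕ} (M N : Msg L n) (P : Proc L n) : Proc L n
  | new {n : ℕ} (P : Proc L (n + 1)) : Proc L n
  | par {n : ℕ} (P Q : Proc L n) : Proc L n
  | choice {n : ℕ} (P Q : Proc L n) : Proc L n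
  | bang {n : ℕ} (P : Proc L n) : Proc L n

/-- Simultaneous replacement of free variables and bound names. -/
abbrev Repl (L : FirstOrder.Language.{u, v}) (m n : ℕ) : Type u := ℕ ⊕ Fin m → Msg L n

/-- A replacement passes under a binder; the new bound name is fixed. -/
def Repl.lift {L : FirstOrder.Language.{u, v}} {m n : ℕ} (s : Repl L m n) : Repl L (m + 1) (n + 1) :=
  Sum.elim (fun x => (s (.inl x)).wk 1)
    (Fin.lastCases (Term.var (.inr (Fin.last n))) (fun i => (s (.inr i)).wk 1))

/-- Capture-avoiding replacement in a process. -/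
def Proc.repl {L : FirstOrder.Language.{u, v}} : {m n : ℕ} → Repl L m n → Proc L m → Proc L n
  | _, _, _, .nil => .nil
  | _, _, s, .out M N P => .out (Term.subst M s) (Term.subst N s) (P.repl s)
  | _, _, s, .inp M P => .inp (Term.subst M s) (P.repl s.lift)
  | _, _, s, .mat M N P => .mat (Term.subst M s) (Term.subst N s) (P.repl s)
  | _, _, s, .mismat M N P => .mismat (Term.subst M s) (Term.subst N s) (P.repl s)
  | _, _, s, .new P => .new (P.repl s.lift)
  | _, _, s, .par P Q => .par (P.repl s) (Q.repl s)
  | _, _, s, .choice P Q => .choice (P.repl s) (Q.repl s)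
  | _, _, s, .bang P => .bang (P.repl s)

/-- Weakening of a process by `k` new bound names. -/
def Proc.wk {L : FirstOrder.Language.{u, v}} {n : ℕ} (k : ℕ) (P : Proc L n) : Proc L (n + k) :=
  P.repl (Sum.elim (fun x => Term.var (.inl x)) (fun i => Term.var (.inr (Fin.castAdd k i))))

/-- `P.inst N` replaces the newest bound name of `P` by `N`. -/
def Proc.inst {L : FirstOrder.Language.{u, v}} {n : ℕ} (P : Proc L (n + 1)) (N : Msg L n) : Proc L n :=
  P.repl (Sum.elim (fun x => Term.var (.inl x)) (Fin.lastCases N (fun i => Term.var (.inr i))))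

/-- The free variables of a process. -/
def Proc.fv {L : FirstOrder.Language.{u, v}} : {n : ℕ} → Proc L n → Finset ℕ
  | _, .nil => ∅
  | _, .out M N P => M.fv ∪ N.fv ∪ P.fv
  | _, .inp M P => M.fv ∪ P.fv
  | _, .mat M N P => M.fv ∪ N.fv ∪ P.fv
  | _, .mismat M N P => M.fv ∪ N.fv ∪ P.fv
  | _, .new P => P.fv
  | _, .par P Q => P.fv ∪ Q.fv
  | _, .choice P Q => P.fv ∪ Q.fv
  | _, .bang P => P.fv

/-! ## Extended processes -/

/-- Extended processes `νx₁.….νxₖ.(θ | P)` in a scope with `n` bound names: a process under an active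
substitution `θ`, and restriction. They are in normal form if they satisfy `Ext.NF` below. -/
inductive Ext (L : FirstOrder.Language.{u, v}) : ℕ → Type u
  | act {n : ℕ} (θ : Subst L n) (P : Proc L n) : Ext L n
  | new {n : ℕ} (A : Ext L (n + 1)) : Ext L n

/-- A process as an extended process, with the identity as its active substitution. -/
def Proc.toExt {L : FirstOrder.Language.{u, v}} {n : ℕ} (P : Proc L n) : Ext L n := .act Subst.ident P

/-- The normal form condition: active substitutions have a finite domain, and the variables in it
occur neither in the process nor in any `yθ` (so `θ` is idempotent and fully applied). -/
def Ext.NF {L : FirstOrder.Language.{u, v}} : {n : ℕ} → Ext L n → Prop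
  | _, .act θ P => θ.dom.Finite ∧ ∀ x ∈ θ.dom, x ∉ P.fv ∧ ∀ y, x ∉ (θ y).fv
  | _, .new A => A.NF

/-- The domain of the active substitution. -/
def Ext.dom {L : FirstOrder.Language.{u, v}} : {n : ℕ} → Ext L n → Set ℕ
  | _, .act θ _ => θ.dom
  | _, .new A => A.dom

/-- The variables that occur free in an extended process, including the domain of its active
substitution. -/
def Ext.fv {L : FirstOrder.Language.{u, v}} : {n : ℕ} → Ext L n → Set ℕ
  | _, .act θ P => (P.fv : Set ℕ) ∪ θ.dom ∪ {y | ∃ x ∈ θ.dom, y ∈ (θ x).fv}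
  | _, .new A => A.fv

/-- Restriction of the `k` newest names. -/
def Ext.news {L : FirstOrder.Language.{u, v}} {n : ℕ} : (k : ℕ) → Ext L (n + k) → Ext L n
  | 0, A => A
  | k + 1, A => Ext.news k (Ext.new A)

/-- `A | Q`. -/
def Ext.parR {L : FirstOrder.Language.{u, v}} : {n : ℕ} → Ext L n → Proc L n → Ext L n
  | _, .act θ P, Q => .act θ (.par P Q)
  | _, .new A, Q => .new (A.parR (Q.wk 1))

/-- `Q | A`. -/
def Ext.parL {L : FirstOrder.Language.{u, v}} : {n : ℕ} → Proc L n → Ext L n → Ext L n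
  | _, Q, .act θ P => .act θ (.par Q P)
  | _, Q, .new A => .new (Ext.parL (Q.wk 1) A)

/-- `ρ | A`: the active substitution `ρ` is added to `A`. -/
def Ext.addSubst {L : FirstOrder.Language.{u, v}} : {n : ℕ} → Subst L n → Ext L n → Ext L n
  | _, ρ, .act θ P => .act (ρ.comp θ) P
  | _, ρ, .new A => .new (Ext.addSubst (ρ.wk 1) A)

open Classical in
/-- Capture-avoiding replacement in an extended process. It is applied to the process and to the
range of the active substitution; the domain stays as it is. -/
def Ext.repl {L : FirstOrder.Language.{u, v}} : {m n : ℕ} → Repl L m n → Ext L m → Ext L n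
  | _, _, s, .act θ P =>
      .act (fun x => if x ∈ θ.dom then Term.subst (θ x) s else Term.var (.inl x)) (P.repl s)
  | _, _, s, .new A => .new (A.repl s.lift)

/-! ## Labelled transitions -/

/-- Actions: progress `τ`, bound output (on channel `M`, of a message bound to the variable `x`), and
free input (on channel `M`, of the message `N`). -/
inductive Label (L : FirstOrder.Language.{u, v}) (n : ℕ) : Type u
  | tau : Label L n
  | out (M : Msg L n) (x : ℕ) : Label L n
  | inp (M N : Msg L n) : Label L n

/-- The bound names of an action. -/
def Label.bn {L : FirstOrder.Language.{u, v}} {n : ℕ} : Label L n → Set ℕ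
  | .out _ x => {x}
  | _ => ∅

/-- Substitution in an action; the bound variable of an output is left alone. -/
def Label.app {L : FirstOrder.Language.{u, v}} {n : ℕ} (π : Label L n) (σ : Subst L n) : Label L n :=
  match π with
  | .tau => .tau
  | .out M x => .out (M.app σ) x
  | .inp M N => .inp (M.app σ) (N.app σ)

/-- Weakening of an action. A weakened action does not mention the new bound names. -/
def Label.wk {L : FirstOrder.Language.{u, v}} {n : ℕ} (k : ℕ) : Label L n → Label L (n + k)
  | .tau => .tau
  | .out M x => .out (M.wk k) x
  | .inp M N => .inp (M.wk k) (N.wk k)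

/-- The open early transitions `Γ : P --π--> A` of processes, where the set `Γ` of private names
consists of all bound names of the scope: these are the names that the rule for restriction has
opened. In the rules that synchronise, `k` is the number of names extruded by the output. -/
inductive Step {L : FirstOrder.Language.{u, v}} (E : Set (L.Term ℕ × L.Term ℕ)) :
    {n : ℕ} → Proc L n → Label L n → Ext L n → Prop
  | inp {n : ℕ} (M M' N : Msg L n) (P : Proc L (n + 1)) :
      EqE E M M' →
      Step E (.inp M P) (.inp M' N) (P.inst N).toExt
  | out {n : ℕ} (M M' N : Msg L n) (P : Proc L n) (x : ℕ) :
      EqE E M M' → x ∉ M.fv → x ∉ M'.fv → x ∉ N.fv → x ∉ P.fv →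
      Step E (.out M N P) (.out M' x) (.act (Subst.single x N) P)
  | sum_l {n : ℕ} (P Q : Proc L n) (π : Label L n) (A : Ext L n) :
      Step E P π A → Step E (.choice P Q) π A
  | sum_r {n : ℕ} (P Q : Proc L n) (π : Label L n) (A : Ext L n) :
      Step E Q π A → Step E (.choice P Q) π A
  | mat {n : ℕ} (M N : Msg L n) (P : Proc L n) (π : Label L n) (A : Ext L n) :
      EqE E M N → Step E P π A → Step E (.mat M N P) π A
  | mismat {n : ℕ} (M N : Msg L n) (P : Proc L n) (π : Label L n) (A : Ext L n) :
      Distinct E M N → Step E P π A → Step E (.mismat M N P) π A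
  | res {n : ℕ} (P : Proc L (n + 1)) (π : Label L n) (A : Ext L (n + 1)) :
      Step E P (π.wk 1) A → Step E (.new P) π (.new A)
  | par_l {n : ℕ} (P Q : Proc L n) (π : Label L n) (A : Ext L n) :
      Step E P π A → Disjoint π.bn (Q.fv : Set ℕ) → Step E (.par P Q) π (A.parR Q)
  | par_r {n : ℕ} (P Q : Proc L n) (π : Label L n) (A : Ext L n) :
      Step E Q π A → Disjoint π.bn (P.fv : Set ℕ) → Step E (.par P Q) π (.parL P A)
  | rep_act {n : ℕ} (P : Proc L n) (π : Label L n) (A : Ext L n) :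
      Step E P π A → Disjoint π.bn (P.fv : Set ℕ) →
      Step E (.bang P) π (A.parR (.bang P))
  | close_l {n k : ℕ} (P Q : Proc L n) (M M' : Msg L n) (x : ℕ) (N : Msg L (n + k))
      (P' : Proc L (n + k)) (B : Ext L (n + k)) :
      Step E P (.out M x) (Ext.news k (.act (Subst.single x N) P')) →
      Step E (Q.wk k) (.inp (M'.wk k) N) B →
      EqE E M M' → x ∉ Q.fv →
      Step E (.par P Q) .tau (Ext.news k (.parL P' B))
  | close_r {n k : ℕ} (P Q : Proc L n) (M M' : Msg L n) (x : ℕ) (N : Msg L (n + k))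
      (Q' : Proc L (n + k)) (B : Ext L (n + k)) :
      Step E Q (.out M x) (Ext.news k (.act (Subst.single x N) Q')) →
      Step E (P.wk k) (.inp (M'.wk k) N) B →
      EqE E M M' → x ∉ P.fv →
      Step E (.par P Q) .tau (Ext.news k (B.parR Q'))
  | rep_close {n k : ℕ} (P : Proc L n) (M M' : Msg L n) (x : ℕ) (N : Msg L (n + k))
      (Q : Proc L (n + k)) (R : Ext L (n + k)) :
      Step E P (.out M x) (Ext.news k (.act (Subst.single x N) Q)) →
      Step E (P.wk k) (.inp (M'.wk k) N) R →
      EqE E M M' →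
      Step E (.bang P) .tau (Ext.news k ((Ext.parL Q R).parR (.bang (P.wk k))))

/-- The open early transitions of extended processes. -/
inductive ExtStep {L : FirstOrder.Language.{u, v}} (E : Set (L.Term ℕ × L.Term ℕ)) :
    {n : ℕ} → Ext L n → Label L n → Ext L n → Prop
  | aliasing {n : ℕ} (θ : Subst L n) (P : Proc L n) (π : Label L n) (A : Ext L n) :
      Step E P (π.app θ) A → θ.FreshFor π.bn → ExtStep E (.act θ P) π (.addSubst θ A)
  | res {n : ℕ} (A : Ext L (n + 1)) (π : Label L n) (B : Ext L (n + 1)) :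
      ExtStep E A (π.wk 1) B → ExtStep E (.new A) π (.new B)

/-! ## Static equivalence, reachability and quasi-open bisimilarity -/

/-- `A` equates `M` and `N`: for `A = νx₁.….νxₖ.(θ | P)` with the `xᵢ` not in `M` and `N`, this is
`Mθ =_E Nθ`. -/
def Ext.Equates {L : FirstOrder.Language.{u, v}} (E : Set (L.Term ℕ × L.Term ℕ)) :
    {n : ℕ} → Ext L n → Msg L n → Msg L n → Prop
  | _, .act θ _, M, N => EqE E (M.app θ) (N.app θ)
  | _, .new A, M, N => A.Equates E (M.wk 1) (N.wk 1)

/-- Static equivalence. -/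
def StaticEquiv {L : FirstOrder.Language.{u, v}} (E : Set (L.Term ℕ × L.Term ℕ)) (A B : Ext L 0) : Prop :=
  ∀ M N : Msg L 0, A.Equates E M N ↔ B.Equates E M N

/-- `A` can reach `B` by the substitution `σ` and the extension `νz₁.….νzₖ.ρ` of the environment:
`σ` and `ρ` are idempotent and fresh for the domain of `A`, and `B = νz₁.….νzₖ.(ρ | Aσρ)`. The `zᵢ`
are bound in `B` and occur only in the range of `ρ`. -/
def Reach {L : FirstOrder.Language.{u, v}} (A : Ext L 0) (σ : Subst L 0) (k : ℕ) (ρ : Subst L (0 + k))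
    (B : Ext L 0) : Prop :=
  σ.dom.Finite ∧ σ.Idempotent ∧ σ.FreshFor A.dom ∧
  ρ.dom.Finite ∧ ρ.Idempotent ∧ ρ.FreshFor A.dom ∧
  B = Ext.news k (Ext.addSubst ρ (A.repl (Sum.elim (fun x => ((σ x).wk k).app ρ) Fin.elim0)))

/-- A relation over extended processes is open if it is preserved by reachability. -/
def IsOpenRel {L : FirstOrder.Language.{u, v}} (R : Ext L 0 → Ext L 0 → Prop) : Prop :=
  ∀ A B, R A B → ∀ (σ : Subst L 0) (k : ℕ) (ρ : Subst L (0 + k)) (A' B' : Ext L 0),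
    Reach A σ k ρ A' → Reach B σ k ρ B' → R A' B'

/-- Quasi-open bisimulations: open symmetric relations between extended processes in normal form
that imply static equivalence and are preserved by matching transitions. As usual, the variable bound
by an output is fresh for both extended processes. -/
structure IsQuasiOpenBisimulation {L : FirstOrder.Language.{u, v}} (E : Set (L.Term ℕ × L.Term ℕ))
    (R : Ext L 0 → Ext L 0 → Prop) : Prop where
  nf : ∀ A B, R A B → A.NF ∧ B.NF
  isOpen : IsOpenRel R
  symm : ∀ A B, R A B → R B A
  static : ∀ A B, R A B → StaticEquiv E A B
  step : ∀ A B, R A B → ∀ (π : Label L 0) (A' : Ext L 0),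
    Disjoint π.bn (A.fv ∪ B.fv) → ExtStep E A π A' → ∃ B', ExtStep E B π B' ∧ R A' B'

/-- Quasi-open bisimilarity, the greatest quasi-open bisimulation. -/
def QuasiOpenBisimilar {L : FirstOrder.Language.{u, v}} (E : Set (L.Term ℕ × L.Term ℕ)) (A B : Ext L 0) :
    Prop :=
  ∃ R : Ext L 0 → Ext L 0 → Prop, IsQuasiOpenBisimulation E R ∧ R A B

/-! ## The intuitionistic modal logic FM -/

/-- Formulae of FM. The modalities for an output `Label.out M x` bind `x` in the formula after
them. -/
inductive Formula (L : FirstOrder.Language.{u, v}) : Type u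
  | tt : Formula L
  | ff : Formula L
  | eq (M N : Msg L 0) : Formula L
  | and (φ ψ : Formula L) : Formula L
  | or (φ ψ : Formula L) : Formula L
  | imp (φ ψ : Formula L) : Formula L
  | dia (π : Label L 0) (φ : Formula L) : Formula L
  | box (π : Label L 0) (φ : Formula L) : Formula L

/-- The free variables of a formula. -/
def Formula.fv {L : FirstOrder.Language.{u, v}} : Formula L → Finset ℕ
  | .tt => ∅
  | .ff => ∅
  | .eq M N => M.fv ∪ N.fv
  | .and φ ψ => φ.fv ∪ ψ.fv
  | .or φ ψ => φ.fv ∪ ψ.fv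
  | .imp φ ψ => φ.fv ∪ ψ.fv
  | .dia .tau φ => φ.fv
  | .dia (.out M x) φ => M.fv ∪ φ.fv.erase x
  | .dia (.inp M N) φ => M.fv ∪ N.fv ∪ φ.fv
  | .box .tau φ => φ.fv
  | .box (.out M x) φ => M.fv ∪ φ.fv.erase x
  | .box (.inp M N) φ => M.fv ∪ N.fv ∪ φ.fv

/-- `y` is a possible name, after α-conversion, for the variable `x` that an output modality binds in
`φ`, in an instance `φδ` that is interpreted at `A`: `y` is fresh for `A` and not free in `wδ`, for
the other free variables `w` of `φ`. -/
def FreshName {L : FirstOrder.Language.{u, v}} (A : Ext L 0) (φ : Formula L) (x : ℕ) (δ : Subst L 0) (y : ℕ) :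
    Prop :=
  y ∉ A.fv ∧ ∀ w ∈ φ.fv.erase x, y ∉ (δ w).fv

/-- `SatInst E φ δ A` is satisfaction `A ⊨ φδ` of the instance of `φ` by the (capture-avoiding)
substitution `δ`; then `φδσ` is the instance of `φ` by `δ·σ`. -/
def SatInst {L : FirstOrder.Language.{u, v}} (E : Set (L.Term ℕ × L.Term ℕ)) :
    Formula L → Subst L 0 → Ext L 0 → Prop
  | .tt, _, _ => True
  | .ff, _, _ => False
  | .eq M N, δ, A => A.Equates E (M.app δ) (N.app δ)
  | .and φ ψ, δ, A => SatInst E φ δ A ∧ SatInst E ψ δ A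
  | .or φ ψ, δ, A => SatInst E φ δ A ∨ SatInst E ψ δ A
  | .imp φ ψ, δ, A => ∀ (σ : Subst L 0) (k : ℕ) (ρ : Subst L (0 + k)) (A' : Ext L 0),
      Reach A σ k ρ A' → SatInst E φ (δ.comp σ) A' → SatInst E ψ (δ.comp σ) A'
  | .dia .tau φ, δ, A => ∃ B, ExtStep E A .tau B ∧ SatInst E φ δ B
  | .dia (.out M x) φ, δ, A => ∃ y B, FreshName A φ x δ y ∧
      ExtStep E A (.out (M.app δ) y) B ∧ SatInst E φ (Function.update δ x (Term.var (.inl y))) B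
  | .dia (.inp M N) φ, δ, A => ∃ B, ExtStep E A (.inp (M.app δ) (N.app δ)) B ∧ SatInst E φ δ B
  | .box .tau φ, δ, A => ∀ (σ : Subst L 0) (k : ℕ) (ρ : Subst L (0 + k)) (A' B : Ext L 0),
      Reach A σ k ρ A' → ExtStep E A' .tau B → SatInst E φ (δ.comp σ) B
  | .box (.out M x) φ, δ, A => ∀ (σ : Subst L 0) (k : ℕ) (ρ : Subst L (0 + k)) (A' B : Ext L 0)
      (y : ℕ), Reach A σ k ρ A' → FreshName A' φ x (δ.comp σ) y →
      ExtStep E A' (.out (M.app (δ.comp σ)) y) B →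
      SatInst E φ (Function.update (δ.comp σ) x (Term.var (.inl y))) B
  | .box (.inp M N) φ, δ, A => ∀ (σ : Subst L 0) (k : ℕ) (ρ : Subst L (0 + k)) (A' B : Ext L 0),
      Reach A σ k ρ A' →
      ExtStep E A' (.inp (M.app (δ.comp σ)) (N.app (δ.comp σ))) B → SatInst E φ (δ.comp σ) B

/-- Satisfaction `A ⊨ φ`. -/
def Sat {L : FirstOrder.Language.{u, v}} (E : Set (L.Term ℕ × L.Term ℕ)) (A : Ext L 0) (φ : Formula L) :
    Prop :=
  SatInst E φ Subst.ident A

end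

end AppliedPi

namespace AppliedPi

noncomputable section

section

variable {L : FirstOrder.Language.{u, v}}

/-! ## Terms -/

/-! The theorem is a Hennessy–Milner argument for an intuitionistic logic, carried out in a Kripke
semantics. A state is a process together with an assignment of messages to the variables of its
observer. A world is a set `W` of private variables, which play the role of names. Later worlds are
reached by admissible substitutions (`Adm`), which rename private variables injectively and do not
produce the renamed ones elsewhere. `Forces` interprets formulae at states and worlds; it is
persistent (`Forces.adm`) and invariant under the equational theory (`Forces.congr`).

Finiteness comes from symbolic transitions (`symAt`). For each kind of action, finitely many triples
of a channel, a list of conditions (equations and apartnesses) and a residual describe the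
transitions of all substitution instances of a process at once. Hence states are image finite, the
intersection of the approximants `Apx j` is itself preserved by transitions (`Bis.matched`), and
processes that are not bisimilar are separated by some `Apx j`.

`exists_distinguishing` turns a failure of `Apx j` into a formula that is forced at the left state
in the world `∅` and not forced at the right state in an infinite world `W`. The two worlds differ
on purpose. Every substitution is admissible from `∅`, so truth there persists to every world, while
the refutation in `W` may use private variables as distinct stand-ins for bound names. The
substitution with which a round of the game begins is described by a guard `γ`, and `γ ⊃ Θ` carries
a formula `Θ` of the later world back to the present one (`forces_guard_imp`,
`not_forces_guard_imp`). An unmatched move of the left state gives `κ ⊃ ⟨π⟩⋀φ`, where `κ` secures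
the conditions of that move (`exists_dia`). An unmatched move of the right state gives `[π]⋁ψ` with
one disjunct for each symbolic move of the left state (`exists_box`). A symbolic move that is
disabled now but may become enabled later contributes a formula that its violated condition would
imply and that fails on the right (`exists_cond_blocker`). A failure of static equivalence gives an
equation or an implication between equations.

The rest relates this semantics to the calculus. Restrictions are flattened into one scope, and
bound names may be opened into private variables. An extension `νz.ρ` of the environment then
becomes an admissible substitution, and conversely up to renaming. This gives `satInst_iff`, which
identifies satisfaction with forcing, and `isQuasiOpenBisimulation_extBis`, by which bisimilar
openings yield quasi-open bisimilarity. As `Apx` is symmetric, exchanging the processes gives the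
second formula. -/

theorem subst_subst {α β γ : Type*} (M : L.Term α) (s : α → L.Term β) (t : β → L.Term γ) :
    (M.subst s).subst t = M.subst (fun a => (s a).subst t) := by
  induction M with
  | var a => rfl
  | func f ts ih => simp only [Term.subst]; congr 1; funext i; exact ih i

theorem subst_var {α : Type*} (M : L.Term α) : M.subst (fun a => Term.var a) = M := by
  induction M with
  | var a => rfl
  | func f ts ih => simp only [Term.subst]; congr 1; funext i; exact ih i

theorem relabel_eq_subst {α β : Type*} (M : L.Term α) (g : α → β) :
    M.relabel g = M.subst (fun a => Term.var (g a)) := by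
  induction M with
  | var a => rfl
  | func f ts ih => simp only [Term.subst, Term.relabel]; congr 1; funext i; exact ih i

@[simp] theorem fv_var_inl {n : ℕ} (x : ℕ) : Msg.fv (Term.var (.inl x) : Msg L n) = {x} := rfl

@[simp] theorem fv_var_inr {n : ℕ} (i : Fin n) : Msg.fv (Term.var (.inr i) : Msg L n) = ∅ := rfl

theorem mem_fv_func {n k : ℕ} (f : L.Functions k) (ts : Fin k → Msg L n) (x : ℕ) :
    x ∈ Msg.fv (Term.func f ts : Msg L n) ↔ ∃ i, x ∈ (ts i).fv := by
  simp only [Msg.fv, Term.varFinsetLeft, Finset.mem_biUnion, Finset.mem_univ, true_and]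

theorem subst_congr {n : ℕ} {β : Type*} (M : Msg L n) {s t : ℕ ⊕ Fin n → L.Term β}
    (h : ∀ x ∈ M.fv, s (.inl x) = t (.inl x)) (h' : ∀ i, s (.inr i) = t (.inr i)) :
    M.subst s = M.subst t := by
  induction M with
  | var a =>
    rcases a with x | i
    · exact h x (by simp)
    · exact h' i
  | func f ts ih =>
    simp only [Term.subst]; congr 1; funext i
    exact ih i fun x hx => h x ((mem_fv_func f ts x).2 ⟨i, hx⟩)

theorem mem_fv_subst {m n : ℕ} (M : Msg L m) (s : Repl L m n) (y : ℕ) :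
    y ∈ Msg.fv (M.subst s) → (∃ x ∈ M.fv, y ∈ (s (.inl x)).fv) ∨ ∃ i, y ∈ (s (.inr i)).fv := by
  induction M with
  | var a =>
    rcases a with x | i
    · intro h; exact .inl ⟨x, by simp, h⟩
    · intro h; exact .inr ⟨i, h⟩
  | func f ts ih =>
    simp only [Term.subst, mem_fv_func]
    rintro ⟨i, hi⟩
    rcases ih i hi with ⟨x, hx, hy⟩ | h
    · exact .inl ⟨x, ⟨i, hx⟩, hy⟩
    · exact .inr h

theorem mem_fv_subst_of_mem {m n : ℕ} (M : Msg L m) (s : Repl L m n) (x y : ℕ)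
    (hx : x ∈ M.fv) (hy : y ∈ (s (.inl x)).fv) : y ∈ Msg.fv (M.subst s) := by
  induction M with
  | var a =>
    rcases a with z | i
    · obtain rfl : x = z := by simpa using hx
      exact hy
    · simp at hx
  | func f ts ih =>
    simp only [Term.subst, mem_fv_func] at hx ⊢
    obtain ⟨i, hi⟩ := hx
    exact ⟨i, ih i hi⟩

/-! ## Replacements -/

/-- Renaming of the bound names. -/
def rn {m n : ℕ} (w : Fin m → Fin n) : Repl L m n :=
  Sum.elim (fun x => Term.var (.inl x)) (fun i => Term.var (.inr (w i)))

/-- The replacement of the free variables by a substitution of messages without bound names. -/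
def fs (s : Subst L 0) (n : ℕ) : Repl L n n :=
  Sum.elim (fun x => (s x).emb n) (fun i => Term.var (.inr i))

/-- Composition of replacements. -/
def Repl.thn {k m n : ℕ} (s : Repl L k m) (t : Repl L m n) : Repl L k n := fun a => (s a).subst t

/-- Evaluation of a message without bound names at an assignment. -/
def ev {m : ℕ} (M : Msg L 0) (Δ : ℕ → Msg L m) : Msg L m := M.subst (Sum.elim Δ Fin.elim0)

@[simp] theorem rn_inl {m n : ℕ} (w : Fin m → Fin n) (x : ℕ) :
    (rn w : Repl L m n) (.inl x) = Term.var (.inl x) := rfl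
@[simp] theorem rn_inr {m n : ℕ} (w : Fin m → Fin n) (i : Fin m) :
    (rn w : Repl L m n) (.inr i) = Term.var (.inr (w i)) := rfl
@[simp] theorem fs_inl (s : Subst L 0) (n : ℕ) (x : ℕ) : fs s n (.inl x) = (s x).emb n := rfl
@[simp] theorem fs_inr (s : Subst L 0) (n : ℕ) (i : Fin n) :
    fs s n (.inr i) = Term.var (.inr i) := rfl
@[simp] theorem subst_var_apply {α β : Type*} (a : α) (s : α → L.Term β) :
    (Term.var a : L.Term α).subst s = s a := rfl

theorem emb_eq_ev {n : ℕ} (M : Msg L 0) : M.emb n = ev M (fun x => Term.var (.inl x)) := by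
  rw [Msg.emb, relabel_eq_subst, ev]
  exact subst_congr M (fun _ _ => rfl) (fun i => i.elim0)

@[simp] theorem emb_var {n : ℕ} (x : ℕ) :
    Msg.emb n (Term.var (.inl x) : Msg L 0) = Term.var (.inl x) := rfl
@[simp] theorem ev_var {n : ℕ} (x : ℕ) (Δ : ℕ → Msg L n) :
    ev (Term.var (.inl x) : Msg L 0) Δ = Δ x := rfl

theorem wk_eq_subst {n k : ℕ} (M : Msg L n) : M.wk k = M.subst (rn (Fin.castAdd k)) := by
  rw [Msg.wk, relabel_eq_subst]
  congr 1; funext a; rcases a with x | i <;> rfl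

theorem ev_subst {m n : ℕ} (M : Msg L 0) (Δ : ℕ → Msg L m) (s : Repl L m n) :
    (ev M Δ).subst s = ev M (fun x => (Δ x).subst s) := by
  rw [ev, subst_subst]
  exact subst_congr M (fun _ _ => rfl) (fun i => i.elim0)

theorem ev_ev {m : ℕ} (M : Msg L 0) (s : Subst L 0) (Δ : ℕ → Msg L m) :
    ev (ev M s) Δ = ev M (fun x => ev (s x) Δ) := by
  rw [show ev (ev M s) Δ = (ev M s).subst (Sum.elim Δ Fin.elim0) from rfl, ev_subst]; rfl

theorem ev_congr {m : ℕ} (M : Msg L 0) {Δ Δ' : ℕ → Msg L m} (h : ∀ x ∈ M.fv, Δ x = Δ' x) :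
    ev M Δ = ev M Δ' := subst_congr M h (fun i => i.elim0)

theorem subst_eq_ev {m : ℕ} (M : Msg L 0) (s : Repl L 0 m) :
    M.subst s = ev M (fun x => s (.inl x)) := subst_congr M (fun _ _ => rfl) (fun i => i.elim0)

theorem emb_subst {m n : ℕ} (M : Msg L 0) (s : Repl L m n) :
    (M.emb m).subst s = ev M (fun x => s (.inl x)) := by
  rw [emb_eq_ev, ev_subst]; rfl

theorem ev_ident (M : Msg L 0) : ev M (fun x => Term.var (.inl x)) = M := by
  rw [ev]
  conv_rhs => rw [← subst_var M]
  exact subst_congr M (fun _ _ => rfl) (fun i => i.elim0)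

@[simp] theorem emb_zero (M : Msg L 0) : M.emb 0 = M := by rw [emb_eq_ev, ev_ident]

theorem mem_fv_ev {m : ℕ} (M : Msg L 0) (Δ : ℕ → Msg L m) (y : ℕ) :
    y ∈ (ev M Δ).fv ↔ ∃ x ∈ M.fv, y ∈ (Δ x).fv := by
  constructor
  · intro h
    rcases mem_fv_subst M _ y h with h | ⟨i, _⟩
    · exact h
    · exact i.elim0
  · rintro ⟨x, hx, hy⟩
    exact mem_fv_subst_of_mem M _ x y hx hy

@[simp] theorem fv_emb {n : ℕ} (M : Msg L 0) : (M.emb n).fv = M.fv := by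
  ext y; rw [emb_eq_ev, mem_fv_ev]; simp

theorem mem_fv_rn {m n : ℕ} (M : Msg L m) (w : Fin m → Fin n) (y : ℕ) :
    y ∈ Msg.fv (M.subst (rn w)) ↔ y ∈ M.fv := by
  constructor
  · intro h
    rcases mem_fv_subst M _ y h with ⟨x, hx, hy⟩ | ⟨i, hi⟩
    · simp at hy; subst hy; exact hx
    · simp at hi
  · intro h; exact mem_fv_subst_of_mem M _ y y h (by simp)

@[simp] theorem fv_rn {m n : ℕ} (M : Msg L m) (w : Fin m → Fin n) :
    Msg.fv (M.subst (rn w)) = M.fv := Finset.ext fun y => mem_fv_rn M w y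

@[simp] theorem fv_wk {n k : ℕ} (M : Msg L n) : (M.wk k).fv = M.fv := by rw [wk_eq_subst, fv_rn]

theorem mem_fv_fs {n : ℕ} (M : Msg L n) (s : Subst L 0) (y : ℕ) :
    y ∈ Msg.fv (M.subst (fs s n)) ↔ ∃ x ∈ M.fv, y ∈ (s x).fv := by
  constructor
  · intro h
    rcases mem_fv_subst M _ y h with ⟨x, hx, hy⟩ | ⟨i, hi⟩
    · exact ⟨x, hx, by simpa using hy⟩
    · simp at hi
  · rintro ⟨x, hx, hy⟩; exact mem_fv_subst_of_mem M _ x y hx (by simpa using hy)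

@[simp] theorem lift_inl {m n : ℕ} (s : Repl L m n) (x : ℕ) :
    s.lift (.inl x) = (s (.inl x)).wk 1 := rfl
@[simp] theorem lift_inr_castSucc {m n : ℕ} (s : Repl L m n) (i : Fin m) :
    s.lift (.inr i.castSucc) = (s (.inr i)).wk 1 := by simp [Repl.lift]
@[simp] theorem lift_inr_last {m n : ℕ} (s : Repl L m n) :
    s.lift (.inr (Fin.last m)) = Term.var (.inr (Fin.last n)) := by simp [Repl.lift]

theorem repl_ext {m n : ℕ} {s t : Repl L (m + 1) n} (h : ∀ x, s (.inl x) = t (.inl x))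
    (h' : ∀ i : Fin m, s (.inr i.castSucc) = t (.inr i.castSucc))
    (h'' : s (.inr (Fin.last m)) = t (.inr (Fin.last m))) : s = t := by
  funext a
  rcases a with x | i
  · exact h x
  · induction i using Fin.lastCases with
    | last => exact h''
    | cast i => exact h' i

theorem wk_one_eq {n : ℕ} (M : Msg L n) : M.wk 1 = M.subst (rn Fin.castSucc) := wk_eq_subst M

theorem subst_eq_of {m n k : ℕ} (M : Msg L m) {s : Repl L m n} {t : Repl L n k} {r : Repl L m k}
    (h : ∀ a, (s a).subst t = r a) : (M.subst s).subst t = M.subst r := by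
  rw [subst_subst]; congr 1; funext a; exact h a

theorem subst_comm {m n k l : ℕ} (M : Msg L m) {s : Repl L m n} {t : Repl L n k} {r : Repl L m l}
    {q : Repl L l k} (h : ∀ a, (s a).subst t = (r a).subst q) :
    (M.subst s).subst t = (M.subst r).subst q := by
  rw [subst_subst, subst_subst]; congr 1; funext a; exact h a

theorem wk_subst_lift {m n : ℕ} (M : Msg L m) (s : Repl L m n) :
    (M.wk 1).subst s.lift = Msg.wk 1 (M.subst s) := by
  rw [wk_one_eq, wk_one_eq]
  refine subst_comm M fun a => ?_
  rcases a with x | i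
  · simp [wk_one_eq]
  · simp [wk_one_eq]

theorem lift_thn {k m n : ℕ} (s : Repl L k m) (t : Repl L m n) :
    (s.thn t).lift = s.lift.thn t.lift := by
  refine repl_ext (fun x => ?_) (fun i => ?_) ?_
  · simp [Repl.thn, wk_subst_lift]
  · simp [Repl.thn, wk_subst_lift]
  · simp [Repl.thn]

theorem lift_fs (s : Subst L 0) (n : ℕ) : (fs s n).lift = fs s (n + 1) := by
  refine repl_ext (fun x => ?_) (fun i => ?_) ?_
  · simp only [lift_inl, fs_inl, wk_one_eq, emb_eq_ev, ev_subst]; rfl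
  · simp [wk_one_eq]
  · simp

/-- Renamings pass under a binder. -/
def liftFin {m n : ℕ} (w : Fin m → Fin n) : Fin (m + 1) → Fin (n + 1) :=
  Fin.lastCases (Fin.last n) (fun i => (w i).castSucc)

@[simp] theorem liftFin_castSucc {m n : ℕ} (w : Fin m → Fin n) (i : Fin m) :
    liftFin w i.castSucc = (w i).castSucc := by simp [liftFin]
@[simp] theorem liftFin_last {m n : ℕ} (w : Fin m → Fin n) :
    liftFin w (Fin.last m) = Fin.last n := by simp [liftFin]

theorem lift_rn {m n : ℕ} (w : Fin m → Fin n) : (rn w : Repl L m n).lift = rn (liftFin w) := by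
  refine repl_ext (fun x => ?_) (fun i => ?_) ?_
  · simp [wk_one_eq]
  · simp [wk_one_eq]
  · simp

theorem rn_id {n : ℕ} : (rn id : Repl L n n) = fun a => Term.var a := by
  funext a; rcases a with x | i <;> rfl

theorem lift_var {n : ℕ} : Repl.lift (fun a => Term.var a : Repl L n n) = fun a => Term.var a := by
  refine repl_ext (fun x => ?_) (fun i => ?_) ?_
  · simp [wk_one_eq]
  · simp [wk_one_eq]
  · simp

theorem fs_thn_rn {m n : ℕ} (s : Subst L 0) (w : Fin m → Fin n) :
    (fs s m).thn (rn w) = (rn w).thn (fs s n) := by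
  funext a; rcases a with x | i
  · simp only [Repl.thn, fs_inl, rn_inl, subst_var_apply, emb_eq_ev, ev_subst]
  · rfl

theorem rn_thn_rn {k m n : ℕ} (w : Fin k → Fin m) (w' : Fin m → Fin n) :
    (rn w : Repl L k m).thn (rn w') = rn (w' ∘ w) := by
  funext a; rcases a with x | i <;> rfl

/-- Composition of substitutions. -/
def sc (s t : Subst L 0) : Subst L 0 := fun x => ev (s x) t

theorem fs_thn_fs {n : ℕ} (s t : Subst L 0) : (fs s n).thn (fs t n) = fs (sc s t) n := by
  funext a; rcases a with x | i
  · simp only [Repl.thn, fs_inl, emb_subst, sc]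
    rw [emb_eq_ev, ev_ev]
    simp only [emb_eq_ev]
  · rfl

theorem emb_fs {n : ℕ} (M : Msg L 0) (s : Subst L 0) :
    (M.emb n).subst (fs s n) = (ev M s).emb n := by
  rw [emb_subst, emb_eq_ev, ev_ev]
  simp only [fs_inl, emb_eq_ev]

theorem msg_rn_fs {m n : ℕ} (M : Msg L m) (s : Subst L 0) (w : Fin m → Fin n) :
    (M.subst (rn w)).subst (fs s n) = (M.subst (fs s m)).subst (rn w) :=
  subst_comm M fun a => (congrFun (fs_thn_rn s w) a).symm

theorem msg_fs_fs {n : ℕ} (M : Msg L n) (s t : Subst L 0) :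
    (M.subst (fs s n)).subst (fs t n) = M.subst (fs (sc s t) n) :=
  subst_eq_of M fun a => congrFun (fs_thn_fs s t) a

theorem fs_ident {n : ℕ} : fs (fun x => Term.var (.inl x) : Subst L 0) n = fun a => Term.var a := by
  funext a; rcases a with x | i <;> rfl

/-! ## Equational theories -/

variable (E : Set (L.Term ℕ × L.Term ℕ))

theorem EqE.of_eq {α : Type} {t t' : L.Term α} (h : t = t') : EqE E t t' := h ▸ .refl t

variable {E}

theorem EqE.subst {α β : Type} {t t' : L.Term α} (h : EqE E t t') (s : α → L.Term β) :
    EqE E (t.subst s) (t'.subst s) := by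
  induction h with
  | ax l r h s' => rw [subst_subst, subst_subst]; exact .ax l r h _
  | refl t => exact .refl _
  | symm _ ih => exact ih.symm
  | trans _ _ ih ih' => exact ih.trans ih'
  | congr f ts us _ ih => exact .congr f _ _ ih

theorem EqE.subst_congr {m : ℕ} {β : Type} (t : Msg L m) {s s' : ℕ ⊕ Fin m → L.Term β}
    (h : ∀ x ∈ t.fv, EqE E (s (.inl x)) (s' (.inl x))) (h' : ∀ i, EqE E (s (.inr i)) (s' (.inr i))) :
    EqE E (t.subst s) (t.subst s') := by
  induction t with
  | var a =>
    rcases a with x | i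
    · exact h x (by simp)
    · exact h' i
  | func f ts ih =>
    exact .congr f _ _ fun i => ih i fun x hx => h x ((mem_fv_func f ts x).2 ⟨i, hx⟩)

theorem EqE.emb {n : ℕ} {M N : Msg L 0} (h : EqE E M N) : EqE E (M.emb n) (N.emb n) := by
  rw [emb_eq_ev, emb_eq_ev]; exact h.subst _

theorem EqE.fs_left {n : ℕ} (M : Msg L n) {s s' : Subst L 0} (h : ∀ x, EqE E (s x) (s' x)) :
    EqE E (M.subst (fs s n)) (M.subst (fs s' n)) :=
  EqE.subst_congr M (fun x _ => (h x).emb) (fun _ => .refl _)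

end

section

variable {L : FirstOrder.Language.{u, v}}

/-! ## Replacement in processes -/

theorem repl_repl {k m n : ℕ} (P : Proc L k) (s : Repl L k m) (t : Repl L m n) :
    (P.repl s).repl t = P.repl (s.thn t) := by
  induction P generalizing m n with
  | nil => rfl
  | out M N P ih => simp only [Proc.repl, ih, subst_subst]; rfl
  | inp M P ih => simp only [Proc.repl, ih, subst_subst, lift_thn]; rfl
  | mat M N P ih => simp only [Proc.repl, ih, subst_subst]; rfl
  | mismat M N P ih => simp only [Proc.repl, ih, subst_subst]; rfl
  | new P ih => simp only [Proc.repl, ih, lift_thn]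
  | par P Q ih ih' => simp only [Proc.repl, ih, ih']
  | choice P Q ih ih' => simp only [Proc.repl, ih, ih']
  | bang P ih => simp only [Proc.repl, ih]

theorem repl_var {n : ℕ} (P : Proc L n) : P.repl (fun a => Term.var a) = P := by
  induction P with
  | nil => rfl
  | out M N P ih => simp only [Proc.repl, ih, subst_var]
  | inp M P ih => simp only [Proc.repl, ih, subst_var, lift_var]
  | mat M N P ih => simp only [Proc.repl, ih, subst_var]
  | mismat M N P ih => simp only [Proc.repl, ih, subst_var]
  | new P ih => simp only [Proc.repl, ih, lift_var]
  | par P Q ih ih' => simp only [Proc.repl, ih, ih']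
  | choice P Q ih ih' => simp only [Proc.repl, ih, ih']
  | bang P ih => simp only [Proc.repl, ih]

theorem lift_congr {m n : ℕ} {s t : Repl L m n} (h' : ∀ i, s (.inr i) = t (.inr i))
    (i : Fin (m + 1)) : s.lift (.inr i) = t.lift (.inr i) := by
  induction i using Fin.lastCases with
  | last => simp
  | cast i => simp [h']

theorem repl_congr {m n : ℕ} (P : Proc L m) {s t : Repl L m n}
    (h : ∀ x ∈ P.fv, s (.inl x) = t (.inl x)) (h' : ∀ i, s (.inr i) = t (.inr i)) :
    P.repl s = P.repl t := by
  induction P generalizing n with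
  | nil => rfl
  | out M N P ih =>
    simp only [Proc.fv, Finset.mem_union] at h
    simp only [Proc.repl]
    rw [subst_congr M (fun x hx => h x (by simp [hx])) h',
      subst_congr N (fun x hx => h x (by simp [hx])) h', ih (fun x hx => h x (by simp [hx])) h']
  | inp M P ih =>
    simp only [Proc.fv, Finset.mem_union] at h
    simp only [Proc.repl]
    rw [subst_congr M (fun x hx => h x (by simp [hx])) h',
      ih (t := t.lift) (fun x hx => by simp [h x (.inr hx)]) (lift_congr h')]
  | mat M N P ih =>
    simp only [Proc.fv, Finset.mem_union] at h
    simp only [Proc.repl]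
    rw [subst_congr M (fun x hx => h x (by simp [hx])) h',
      subst_congr N (fun x hx => h x (by simp [hx])) h', ih (fun x hx => h x (by simp [hx])) h']
  | mismat M N P ih =>
    simp only [Proc.fv, Finset.mem_union] at h
    simp only [Proc.repl]
    rw [subst_congr M (fun x hx => h x (by simp [hx])) h',
      subst_congr N (fun x hx => h x (by simp [hx])) h', ih (fun x hx => h x (by simp [hx])) h']
  | new P ih =>
    simp only [Proc.fv] at h
    simp only [Proc.repl]
    rw [ih (t := t.lift) (fun x hx => by simp [h x hx]) (lift_congr h')]
  | par P Q ih ih' =>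
    simp only [Proc.fv, Finset.mem_union] at h
    simp only [Proc.repl]
    rw [ih (fun x hx => h x (.inl hx)) h', ih' (fun x hx => h x (.inr hx)) h']
  | choice P Q ih ih' =>
    simp only [Proc.fv, Finset.mem_union] at h
    simp only [Proc.repl]
    rw [ih (fun x hx => h x (.inl hx)) h', ih' (fun x hx => h x (.inr hx)) h']
  | bang P ih =>
    simp only [Proc.fv] at h
    simp only [Proc.repl]
    rw [ih h h']

theorem lift_avoid {m n : ℕ} {s : Repl L m n} {y : ℕ} (h : ∀ i, y ∉ (s (.inr i)).fv)
    (i : Fin (m + 1)) : y ∉ (s.lift (.inr i)).fv := by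
  induction i using Fin.lastCases with
  | last => simp
  | cast i => simpa using h i

theorem notMem_fv_subst {m n : ℕ} (M : Msg L m) {s : Repl L m n} {y : ℕ}
    (h : ∀ x ∈ M.fv, y ∉ (s (.inl x)).fv) (h' : ∀ i, y ∉ (s (.inr i)).fv) :
    y ∉ Msg.fv (M.subst s) := by
  intro hy
  rcases mem_fv_subst M s y hy with ⟨x, hx, hxy⟩ | ⟨i, hi⟩
  · exact h x hx hxy
  · exact h' i hi

theorem notMem_fv_repl {m n : ℕ} (P : Proc L m) {s : Repl L m n} {y : ℕ}
    (h : ∀ x ∈ P.fv, y ∉ (s (.inl x)).fv) (h' : ∀ i, y ∉ (s (.inr i)).fv) :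
    y ∉ (P.repl s).fv := by
  induction P generalizing n with
  | nil => simp [Proc.repl, Proc.fv]
  | out M N P ih =>
    simp only [Proc.fv, Finset.mem_union] at h
    simp only [Proc.repl, Proc.fv, Finset.mem_union, not_or]
    exact ⟨⟨notMem_fv_subst M (fun x hx => h x (by simp [hx])) h',
      notMem_fv_subst N (fun x hx => h x (by simp [hx])) h'⟩, ih (fun x hx => h x (by simp [hx])) h'⟩
  | inp M P ih =>
    simp only [Proc.fv, Finset.mem_union] at h
    simp only [Proc.repl, Proc.fv, Finset.mem_union, not_or]
    exact ⟨notMem_fv_subst M (fun x hx => h x (by simp [hx])) h',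
      ih (fun x hx => by simpa using h x (.inr hx)) (lift_avoid h')⟩
  | mat M N P ih =>
    simp only [Proc.fv, Finset.mem_union] at h
    simp only [Proc.repl, Proc.fv, Finset.mem_union, not_or]
    exact ⟨⟨notMem_fv_subst M (fun x hx => h x (by simp [hx])) h',
      notMem_fv_subst N (fun x hx => h x (by simp [hx])) h'⟩, ih (fun x hx => h x (by simp [hx])) h'⟩
  | mismat M N P ih =>
    simp only [Proc.fv, Finset.mem_union] at h
    simp only [Proc.repl, Proc.fv, Finset.mem_union, not_or]
    exact ⟨⟨notMem_fv_subst M (fun x hx => h x (by simp [hx])) h',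
      notMem_fv_subst N (fun x hx => h x (by simp [hx])) h'⟩, ih (fun x hx => h x (by simp [hx])) h'⟩
  | new P ih =>
    simp only [Proc.fv] at h
    simp only [Proc.repl, Proc.fv]
    exact ih (fun x hx => by simpa using h x hx) (lift_avoid h')
  | par P Q ih ih' =>
    simp only [Proc.fv, Finset.mem_union] at h
    simp only [Proc.repl, Proc.fv, Finset.mem_union, not_or]
    exact ⟨ih (fun x hx => h x (.inl hx)) h', ih' (fun x hx => h x (.inr hx)) h'⟩
  | choice P Q ih ih' =>
    simp only [Proc.fv, Finset.mem_union] at h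
    simp only [Proc.repl, Proc.fv, Finset.mem_union, not_or]
    exact ⟨ih (fun x hx => h x (.inl hx)) h', ih' (fun x hx => h x (.inr hx)) h'⟩
  | bang P ih =>
    simp only [Proc.fv] at h
    simp only [Proc.repl, Proc.fv]
    exact ih h h'

@[simp] theorem fv_repl_rn {m n : ℕ} (P : Proc L m) (w : Fin m → Fin n) :
    (P.repl (rn w)).fv = P.fv := by
  induction P generalizing n with
  | nil => rfl
  | out M N P ih => simp only [Proc.repl, Proc.fv, fv_rn, ih]
  | inp M P ih => simp only [Proc.repl, Proc.fv, fv_rn, lift_rn, ih]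
  | mat M N P ih => simp only [Proc.repl, Proc.fv, fv_rn, ih]
  | mismat M N P ih => simp only [Proc.repl, Proc.fv, fv_rn, ih]
  | new P ih => simp only [Proc.repl, Proc.fv, lift_rn, ih]
  | par P Q ih ih' => simp only [Proc.repl, Proc.fv, ih, ih']
  | choice P Q ih ih' => simp only [Proc.repl, Proc.fv, ih, ih']
  | bang P ih => simp only [Proc.repl, Proc.fv, ih]

theorem proc_wk_eq {n k : ℕ} (P : Proc L n) : P.wk k = P.repl (rn (Fin.castAdd k)) := rfl

theorem proc_wk_one_eq {n : ℕ} (P : Proc L n) : P.wk 1 = P.repl (rn Fin.castSucc) := rfl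

/-- The replacement of the newest bound name by a message. -/
def instRepl {n : ℕ} (N : Msg L n) : Repl L (n + 1) n :=
  Sum.elim (fun x => Term.var (.inl x)) (Fin.lastCases N (fun i => Term.var (.inr i)))

theorem inst_eq {n : ℕ} (P : Proc L (n + 1)) (N : Msg L n) : P.inst N = P.repl (instRepl N) := rfl

@[simp] theorem instRepl_inl {n : ℕ} (N : Msg L n) (x : ℕ) :
    instRepl N (.inl x) = Term.var (.inl x) := rfl
@[simp] theorem instRepl_castSucc {n : ℕ} (N : Msg L n) (i : Fin n) :
    instRepl N (.inr i.castSucc) = Term.var (.inr i) := by simp [instRepl]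
@[simp] theorem instRepl_last {n : ℕ} (N : Msg L n) : instRepl N (.inr (Fin.last n)) = N := by
  simp [instRepl]

@[simp] theorem wk_subst_inst {n : ℕ} (M N : Msg L n) : (M.wk 1).subst (instRepl N) = M := by
  rw [wk_one_eq, subst_eq_of (r := fun a => Term.var a) M, subst_var]
  rintro (x | i) <;> simp

theorem instRepl_thn {m n : ℕ} (N : Msg L m) (s : Repl L m n) :
    (instRepl N).thn s = s.lift.thn (instRepl (N.subst s)) := by
  refine repl_ext (fun x => ?_) (fun i => ?_) ?_
  · simp [Repl.thn]
  · simp [Repl.thn]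
  · simp [Repl.thn]

theorem inst_repl {m n : ℕ} (P : Proc L (m + 1)) (N : Msg L m) (s : Repl L m n) :
    (P.inst N).repl s = (P.repl s.lift).inst (N.subst s) := by
  rw [inst_eq, inst_eq, repl_repl, repl_repl, instRepl_thn]

theorem repl_comm {m n k l : ℕ} (P : Proc L m) {s : Repl L m n} {t : Repl L n k} {r : Repl L m l}
    {q : Repl L l k} (h : ∀ a, (s a).subst t = (r a).subst q) :
    (P.repl s).repl t = (P.repl r).repl q := by
  rw [repl_repl, repl_repl]; congr 1; funext a; exact h a

theorem proc_rn_fs {m n : ℕ} (P : Proc L m) (s : Subst L 0) (w : Fin m → Fin n) :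
    (P.repl (rn w)).repl (fs s n) = (P.repl (fs s m)).repl (rn w) :=
  repl_comm P fun a => (congrFun (fs_thn_rn s w) a).symm

theorem proc_fs_fs {n : ℕ} (P : Proc L n) (s t : Subst L 0) :
    (P.repl (fs s n)).repl (fs t n) = P.repl (fs (sc s t) n) := by
  rw [repl_repl, fs_thn_fs]

theorem proc_rn_rn {k m n : ℕ} (P : Proc L k) (w : Fin k → Fin m) (w' : Fin m → Fin n) :
    (P.repl (rn w)).repl (rn w') = P.repl (rn (w' ∘ w)) := by
  rw [repl_repl, rn_thn_rn]

theorem msg_rn_rn {k m n : ℕ} (M : Msg L k) (w : Fin k → Fin m) (w' : Fin m → Fin n) :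
    (M.subst (rn w)).subst (rn w') = M.subst (rn (w' ∘ w)) :=
  subst_eq_of M fun a => congrFun (rn_thn_rn w w') a

theorem proc_rn_id {n : ℕ} (P : Proc L n) : P.repl (rn id) = P := by rw [rn_id, repl_var]

theorem msg_rn_id {n : ℕ} (M : Msg L n) : M.subst (rn id) = M := by rw [rn_id, subst_var]

theorem proc_fs_congr {n : ℕ} (P : Proc L n) {s t : Subst L 0} (h : ∀ x ∈ P.fv, s x = t x) :
    P.repl (fs s n) = P.repl (fs t n) :=
  repl_congr P (fun x hx => by simp [h x hx]) (fun _ => rfl)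

theorem msg_fs_congr {n : ℕ} (M : Msg L n) {s t : Subst L 0} (h : ∀ x ∈ M.fv, s x = t x) :
    M.subst (fs s n) = M.subst (fs t n) :=
  subst_congr M (fun x hx => by simp [h x hx]) (fun _ => rfl)

theorem proc_fs_self {n : ℕ} (P : Proc L n) {s : Subst L 0}
    (h : ∀ x ∈ P.fv, s x = Term.var (.inl x)) : P.repl (fs s n) = P := by
  rw [proc_fs_congr P h, fs_ident, repl_var]

theorem msg_fs_self {n : ℕ} (M : Msg L n) {s : Subst L 0}
    (h : ∀ x ∈ M.fv, s x = Term.var (.inl x)) : M.subst (fs s n) = M := by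
  rw [msg_fs_congr M h, fs_ident, subst_var]

end

section

variable {L : FirstOrder.Language.{u, v}}

/-! ## Admissible substitutions, for a set of private variables -/

/-- `s` renames the private variables `W` injectively into `W'`, and it does not introduce a
renamed private variable elsewhere. -/
def Adm (W W' : Set ℕ) (s : Subst L 0) : Prop :=
  W'ᶜ.Infinite ∧ ∃ f : ℕ → ℕ, (∀ w ∈ W, f w ∈ W' ∧ s w = Term.var (.inl (f w))) ∧ Set.InjOn f W ∧
    ∀ x, x ∉ W → ∀ w ∈ W, f w ∉ (s x).fv

/-- Worlds form a category, which is what makes forcing persistent. A renamed private variable in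
`(s x)t` comes from some `y` in `s x`; if `y` is private, injectivity of the second renaming forces
it to be a renamed private variable already. -/
theorem Adm.comp {W W' W'' : Set ℕ} {s t : Subst L 0} (h : Adm W W' s) (h' : Adm W' W'' t) :
    Adm W W'' (sc s t) := by
  obtain ⟨-, f, hf, hfi, hfx⟩ := h
  obtain ⟨hW, g, hg, hgi, hgx⟩ := h'
  refine ⟨hW, g ∘ f, fun w hw => ⟨(hg _ (hf w hw).1).1, ?_⟩, ?_, ?_⟩
  · simp [sc, (hf w hw).2, (hg _ (hf w hw).1).2]
  · intro a ha b hb hab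
    exact hfi ha hb (hgi (hf a ha).1 (hf b hb).1 hab)
  · intro x hx w hw hmem
    rw [sc, mem_fv_ev] at hmem
    obtain ⟨y, hy, hmem⟩ := hmem
    by_cases hyW : y ∈ W'
    · rw [(hg y hyW).2] at hmem
      have : g (f w) = g y := by simpa using hmem
      have := hgi (hf w hw).1 hyW this
      exact hfx x hx w hw (this ▸ hy)
    · exact hgx y hyW _ (hf w hw).1 hmem

/-- The world `∅` is the weakest assumption: everything is one of its futures, so what is forced
there is forced after every substitution. -/
theorem adm_empty {W' : Set ℕ} (hW : W'ᶜ.Infinite) (s : Subst L 0) : Adm ∅ W' s :=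
  ⟨hW, id, by simp, by simp, by simp⟩

theorem adm_ident {W W' : Set ℕ} (hW : W'ᶜ.Infinite) (h : W ⊆ W') :
    Adm W W' (fun x => Term.var (.inl x) : Subst L 0) :=
  ⟨hW, id, fun w hw => ⟨h hw, rfl⟩, Function.injective_id.injOn, by
    intro x hx w hw; simp only [fv_var_inl, Finset.mem_singleton, id]; rintro rfl; exact hx hw⟩

variable (E : Set (L.Term ℕ × L.Term ℕ))

/-- `M` and `N` are not unified by any admissible substitution. -/
def Apart (W : Set ℕ) {n : ℕ} (M N : Msg L n) : Prop :=
  ∀ (W' : Set ℕ) (s : Subst L 0), Adm W W' s → ¬ EqE E (M.subst (fs s n)) (N.subst (fs s n))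

/-! ## Transitions with explicit scopes -/

/-- The kinds of actions, without their channel. -/
inductive Kind (L : FirstOrder.Language.{u, v}) (n : ℕ) : Type u
  | tau : Kind L n
  | out : Kind L n
  | inp (N : Msg L n) : Kind L n

/-- Replacement in a kind of action. -/
def Kind.repl {m n : ℕ} (s : Repl L m n) : Kind L m → Kind L n
  | .tau => .tau
  | .out => .out
  | .inp N => .inp (N.subst s)

/-- The result of a transition: the new scope and the embedding of the old scope into it, the message
that is output, if any, and the residual process. -/
structure Agent (L : FirstOrder.Language.{u, v}) (n : ℕ) : Type u where
  scope : ℕ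
  ren : Fin n → Fin scope
  msg : Option (Msg L scope)
  proc : Proc L scope

namespace Agent

/-- Restriction of the newest name. -/
def res {n : ℕ} (R : Agent L (n + 1)) : Agent L n := ⟨R.scope, R.ren ∘ Fin.castSucc, R.msg, R.proc⟩

/-- Parallel composition with a process on the right. -/
def parR {n : ℕ} (R : Agent L n) (Q : Proc L n) : Agent L n :=
  ⟨R.scope, R.ren, R.msg, .par R.proc (Q.repl (rn R.ren))⟩

/-- Parallel composition with a process on the left. -/
def parL {n : ℕ} (Q : Proc L n) (R : Agent L n) : Agent L n :=
  ⟨R.scope, R.ren, R.msg, .par (Q.repl (rn R.ren)) R.proc⟩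

/-- Communication, with the sender on the left. -/
def closeL {n : ℕ} (R : Agent L n) (S : Agent L R.scope) : Agent L n :=
  ⟨S.scope, S.ren ∘ R.ren, none, .par (R.proc.repl (rn S.ren)) S.proc⟩

/-- Communication, with the sender on the right. -/
def closeR {n : ℕ} (R : Agent L n) (S : Agent L R.scope) : Agent L n :=
  ⟨S.scope, S.ren ∘ R.ren, none, .par S.proc (R.proc.repl (rn S.ren))⟩

/-- Substitution for the free variables. -/
def fs {n : ℕ} (s : Subst L 0) (R : Agent L n) : Agent L n :=
  ⟨R.scope, R.ren, R.msg.map (fun N => N.subst (AppliedPi.fs s _)), R.proc.repl (AppliedPi.fs s _)⟩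

theorem fs_parR {n : ℕ} (s : Subst L 0) (R : Agent L n) (Q : Proc L n) :
    (R.parR Q).fs s = (R.fs s).parR (Q.repl (AppliedPi.fs s n)) := by
  simp only [fs, parR, Proc.repl, proc_rn_fs]

theorem fs_parL {n : ℕ} (s : Subst L 0) (R : Agent L n) (Q : Proc L n) :
    (R.parL Q).fs s = (R.fs s).parL (Q.repl (AppliedPi.fs s n)) := by
  simp only [fs, parL, Proc.repl, proc_rn_fs]

theorem fs_closeL {n : ℕ} (s : Subst L 0) (R : Agent L n) (S : Agent L R.scope) :
    (R.closeL S).fs s = (R.fs s).closeL (S.fs s) := by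
  simp only [fs, closeL, Proc.repl, proc_rn_fs]; rfl

theorem fs_closeR {n : ℕ} (s : Subst L 0) (R : Agent L n) (S : Agent L R.scope) :
    (R.closeR S).fs s = (R.fs s).closeR (S.fs s) := by
  simp only [fs, closeR, Proc.repl, proc_rn_fs]; rfl

theorem fs_self {n : ℕ} (R : Agent L n) : R.fs (fun x => Term.var (.inl x)) = R := by
  obtain ⟨k, w, N, P⟩ := R
  simp only [fs, fs_ident, repl_var, subst_var, Option.map_id']

end Agent

/-- Transitions, for a set `W` of private variables. The channel is irrelevant if the kind of the
action is `tau`. -/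
inductive CStep (W : Set ℕ) : {n : ℕ} → Proc L n → Kind L n → Msg L n → Agent L n → Prop
  | inp {n : ℕ} (M C N : Msg L n) (P : Proc L (n + 1)) : EqE E M C →
      CStep W (.inp M P) (.inp N) C ⟨n, id, none, P.inst N⟩
  | out {n : ℕ} (M C N : Msg L n) (P : Proc L n) : EqE E M C →
      CStep W (.out M N P) .out C ⟨n, id, some N, P⟩
  | sum_l {n : ℕ} (P Q : Proc L n) (K : Kind L n) (C : Msg L n) (R : Agent L n) :
      CStep W P K C R → CStep W (.choice P Q) K C R
  | sum_r {n : ℕ} (P Q : Proc L n) (K : Kind L n) (C : Msg L n) (R : Agent L n) :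
      CStep W Q K C R → CStep W (.choice P Q) K C R
  | mat {n : ℕ} (M N : Msg L n) (P : Proc L n) (K : Kind L n) (C : Msg L n) (R : Agent L n) :
      EqE E M N → CStep W P K C R → CStep W (.mat M N P) K C R
  | mismat {n : ℕ} (M N : Msg L n) (P : Proc L n) (K : Kind L n) (C : Msg L n) (R : Agent L n) :
      Apart E W M N → CStep W P K C R → CStep W (.mismat M N P) K C R
  | res {n : ℕ} (P : Proc L (n + 1)) (K : Kind L n) (C : Msg L n) (R : Agent L (n + 1)) :
      CStep W P (K.repl (rn Fin.castSucc)) (C.wk 1) R → CStep W (.new P) K C R.res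
  | par_l {n : ℕ} (P Q : Proc L n) (K : Kind L n) (C : Msg L n) (R : Agent L n) :
      CStep W P K C R → CStep W (.par P Q) K C (R.parR Q)
  | par_r {n : ℕ} (P Q : Proc L n) (K : Kind L n) (C : Msg L n) (R : Agent L n) :
      CStep W Q K C R → CStep W (.par P Q) K C (R.parL P)
  | rep_act {n : ℕ} (P : Proc L n) (K : Kind L n) (C : Msg L n) (R : Agent L n) :
      CStep W P K C R → CStep W (.bang P) K C (R.parR (.bang P))
  | close_l {n : ℕ} (P Q : Proc L n) (C C' : Msg L n) (R : Agent L n) (N : Msg L R.scope)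
      (S : Agent L R.scope) : CStep W P .out C' R → R.msg = some N →
      CStep W (Q.repl (rn R.ren)) (.inp N) (C'.subst (rn R.ren)) S →
      CStep W (.par P Q) .tau C (R.closeL S)
  | close_r {n : ℕ} (P Q : Proc L n) (C C' : Msg L n) (R : Agent L n) (N : Msg L R.scope)
      (S : Agent L R.scope) : CStep W Q .out C' R → R.msg = some N →
      CStep W (P.repl (rn R.ren)) (.inp N) (C'.subst (rn R.ren)) S →
      CStep W (.par P Q) .tau C (R.closeR S)
  | rep_close {n : ℕ} (P : Proc L n) (C C' : Msg L n) (R : Agent L n) (N : Msg L R.scope)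
      (S : Agent L R.scope) : CStep W P .out C' R → R.msg = some N →
      CStep W (P.repl (rn R.ren)) (.inp N) (C'.subst (rn R.ren)) S →
      CStep W (.bang P) .tau C ((R.closeL S).parR (.bang P))

/-! ## Symbolic transitions -/

/-- A condition for a transition: an equation, or an apartness. -/
structure Cond (L : FirstOrder.Language.{u, v}) : Type u where
  scope : ℕ
  pos : Bool
  left : Msg L scope
  right : Msg L scope

/-- The condition holds for the instance by `s`, if the variables of `W` are private. -/
def Cond.Holds (W : Set ℕ) (s : Subst L 0) (c : Cond L) : Prop :=
  if c.pos then EqE E (c.left.subst (fs s _)) (c.right.subst (fs s _))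
  else Apart E W (c.left.subst (fs s _)) (c.right.subst (fs s _))

/-- A symbolic transition. -/
structure Sym (L : FirstOrder.Language.{u, v}) (n : ℕ) : Type u where
  chan : Msg L n
  conds : List (Cond L)
  res : Agent L n

/-- `T` describes the transitions of all instances of `P`. -/
def IsSym {n : ℕ} (P : Proc L n) (K : Kind L n) (T : Set (Sym L n)) : Prop :=
  ∀ (W : Set ℕ) (s : Subst L 0) (C : Msg L n) (R : Agent L n),
    CStep E W (P.repl (fs s n)) (K.repl (fs s n)) C R ↔
      ∃ p ∈ T, (∀ c ∈ p.conds, c.Holds E W s) ∧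
        (K ≠ .tau → EqE E (p.chan.subst (fs s n)) C) ∧ R = p.res.fs s

/-- `P` has a finite symbolic description of its transitions of kind `K`. -/
def SymAt {n : ℕ} (P : Proc L n) (K : Kind L n) : Prop := ∃ T, T.Finite ∧ IsSym E P K T

variable {E}

/-! ### Existence of finite symbolic descriptions of transitions. -/

theorem Kind.repl_repl {k m n : ℕ} (K : Kind L k) (s : Repl L k m) (t : Repl L m n) :
    (K.repl s).repl t = K.repl (s.thn t) := by
  cases K with
  | inp N => simp only [Kind.repl, subst_subst]; rfl
  | _ => rfl

theorem Kind.repl_comm {m n k l : ℕ} (K : Kind L m) {s : Repl L m n} {t : Repl L n k}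
    {r : Repl L m l} {q : Repl L l k} (h : ∀ a, (s a).subst t = (r a).subst q) :
    (K.repl s).repl t = (K.repl r).repl q := by
  rw [Kind.repl_repl, Kind.repl_repl]; congr 1; funext a; exact h a

theorem Kind.repl_var {n : ℕ} (K : Kind L n) : K.repl (fun a => Term.var a) = K := by
  cases K with
  | inp N => simp only [Kind.repl, subst_var]
  | _ => rfl

theorem Kind.repl_tau_iff {m n : ℕ} {K : Kind L m} {s : Repl L m n} :
    K.repl s = .tau ↔ K = .tau := by
  cases K <;> simp [Kind.repl]

theorem Kind.repl_out_iff {m n : ℕ} {K : Kind L m} {s : Repl L m n} :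
    K.repl s = .out ↔ K = .out := by
  cases K <;> simp [Kind.repl]

theorem symAt_nil {n : ℕ} (K : Kind L n) : SymAt E .nil K :=
  ⟨∅, Set.finite_empty, fun W s C R => ⟨fun h => (by cases h), (by simp)⟩⟩

theorem symAt_out {n : ℕ} (M N : Msg L n) (P : Proc L n) (K : Kind L n) :
    SymAt E (.out M N P) K := by
  cases K with
  | tau => exact ⟨∅, Set.finite_empty, fun W s C R => ⟨fun h => (by cases h), (by simp)⟩⟩
  | inp N => exact ⟨∅, Set.finite_empty, fun W s C R => ⟨fun h => (by cases h), (by simp)⟩⟩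
  | out =>
    refine ⟨{⟨M, [], ⟨n, id, some N, P⟩⟩}, Set.finite_singleton _, fun W s C R => ⟨fun h => ?_, ?_⟩⟩
    · cases h with
      | out _ _ _ _ h => exact ⟨_, rfl, by simp, fun _ => h, rfl⟩
    · rintro ⟨p, rfl, -, h, rfl⟩
      exact .out _ _ _ _ (h (by simp))

theorem symAt_inp {n : ℕ} (M : Msg L n) (P : Proc L (n + 1)) (K : Kind L n) :
    SymAt E (.inp M P) K := by
  cases K with
  | tau => exact ⟨∅, Set.finite_empty, fun W s C R => ⟨fun h => (by cases h), (by simp)⟩⟩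
  | out => exact ⟨∅, Set.finite_empty, fun W s C R => ⟨fun h => (by cases h), (by simp)⟩⟩
  | inp N =>
    refine ⟨{⟨M, [], ⟨n, id, none, P.inst N⟩⟩}, Set.finite_singleton _,
      fun W s C R => ⟨fun h => ?_, ?_⟩⟩
    · cases h with
      | inp _ _ _ _ h =>
        refine ⟨_, rfl, by simp, fun _ => h, ?_⟩
        simp only [Agent.fs, inst_repl]; rfl
    · rintro ⟨p, rfl, -, h, rfl⟩
      have := CStep.inp (E := E) (W := W) _ C (N.subst (fs s n)) (P.repl (fs s n).lift)
        (h (by simp))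
      rw [← inst_repl] at this
      exact this

theorem symAt_choice {n : ℕ} {P Q : Proc L n} {K : Kind L n} (hP : SymAt E P K)
    (hQ : SymAt E Q K) : SymAt E (.choice P Q) K := by
  obtain ⟨T, hT, hTs⟩ := hP
  obtain ⟨U, hU, hUs⟩ := hQ
  refine ⟨T ∪ U, hT.union hU, fun W s C R => ⟨fun h => ?_, ?_⟩⟩
  · cases h with
    | sum_l _ _ _ _ _ h =>
      obtain ⟨p, hp, h⟩ := (hTs W s C R).1 h
      exact ⟨p, .inl hp, h⟩
    | sum_r _ _ _ _ _ h =>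
      obtain ⟨p, hp, h⟩ := (hUs W s C R).1 h
      exact ⟨p, .inr hp, h⟩
  · rintro ⟨p, hp | hp, h⟩
    · exact .sum_l _ _ _ _ _ ((hTs W s C R).2 ⟨p, hp, h⟩)
    · exact .sum_r _ _ _ _ _ ((hUs W s C R).2 ⟨p, hp, h⟩)

theorem symAt_mat {n : ℕ} (M N : Msg L n) {P : Proc L n} {K : Kind L n} (hP : SymAt E P K) :
    SymAt E (.mat M N P) K := by
  obtain ⟨T, hT, hTs⟩ := hP
  refine ⟨(fun p => ⟨p.chan, ⟨n, true, M, N⟩ :: p.conds, p.res⟩) '' T, hT.image _,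
    fun W s C R => ⟨fun h => ?_, ?_⟩⟩
  · cases h with
    | mat _ _ _ _ _ _ he h =>
      obtain ⟨p, hp, hc, h⟩ := (hTs W s C R).1 h
      refine ⟨_, ⟨p, hp, rfl⟩, ?_, h⟩
      intro c hc'
      rcases List.mem_cons.1 hc' with rfl | hc'
      · simpa [Cond.Holds] using he
      · exact hc c hc'
  · rintro ⟨_, ⟨p, hp, rfl⟩, hc, h⟩
    refine .mat _ _ _ _ _ _ ?_
      ((hTs W s C R).2 ⟨p, hp, fun c hc' => hc c (List.mem_cons_of_mem _ hc'), h⟩)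
    simpa [Cond.Holds] using hc _ (List.mem_cons_self ..)

theorem symAt_mismat {n : ℕ} (M N : Msg L n) {P : Proc L n} {K : Kind L n} (hP : SymAt E P K) :
    SymAt E (.mismat M N P) K := by
  obtain ⟨T, hT, hTs⟩ := hP
  refine ⟨(fun p => ⟨p.chan, ⟨n, false, M, N⟩ :: p.conds, p.res⟩) '' T, hT.image _,
    fun W s C R => ⟨fun h => ?_, ?_⟩⟩
  · cases h with
    | mismat _ _ _ _ _ _ he h =>
      obtain ⟨p, hp, hc, h⟩ := (hTs W s C R).1 h
      refine ⟨_, ⟨p, hp, rfl⟩, ?_, h⟩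
      intro c hc'
      rcases List.mem_cons.1 hc' with rfl | hc'
      · simpa [Cond.Holds] using he
      · exact hc c hc'
  · rintro ⟨_, ⟨p, hp, rfl⟩, hc, h⟩
    refine .mismat _ _ _ _ _ _ ?_
      ((hTs W s C R).2 ⟨p, hp, fun c hc' => hc c (List.mem_cons_of_mem _ hc'), h⟩)
    simpa [Cond.Holds] using hc _ (List.mem_cons_self ..)

theorem msg_lower {n : ℕ} (M : Msg L (n + 1)) (s : Subst L 0) :
    (M.subst (instRepl (Term.var (.inl 0)))).subst (fs s n) =
      (M.subst (fs s (n + 1))).subst (instRepl ((s 0).emb n)) := by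
  have := subst_comm M (congrFun (instRepl_thn (Term.var (.inl 0)) (fs s n)))
  rwa [lift_fs] at this

/-- Restriction requires the channel to avoid the new name, but only up to the equational theory.
The symbolic channel is therefore lowered, with a dummy variable in place of the new name, and a
condition demands that it equal the weakening of the lowered one. If any channel without the new
name works, the lowered one does: substitute for that name in the equation. -/
theorem symAt_new {n : ℕ} {P : Proc L (n + 1)} {K : Kind L n}
    (hP : SymAt E P (K.repl (rn Fin.castSucc))) : SymAt E (.new P) K := by
  obtain ⟨T, hT, hTs⟩ := hP
  have hK : ∀ s : Subst L 0, (K.repl (fs s n)).repl (rn Fin.castSucc) =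
      (K.repl (rn Fin.castSucc)).repl (fs s (n + 1)) := fun s =>
    Kind.repl_comm K fun a => congrFun (fs_thn_rn s _) a
  by_cases hτ : K = .tau
  · refine ⟨(fun p => ⟨Term.var (.inl 0), p.conds, p.res.res⟩) '' T, hT.image _,
      fun W s C R => ⟨fun h => ?_, ?_⟩⟩
    · cases h with
      | res _ _ _ R h =>
        rw [lift_fs, hK] at h
        obtain ⟨p, hp, hc, -, rfl⟩ := (hTs W s _ R).1 h
        exact ⟨_, ⟨p, hp, rfl⟩, hc, fun h => absurd hτ h, rfl⟩
    · rintro ⟨_, ⟨p, hp, rfl⟩, hc, -, rfl⟩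
      refine .res _ _ _ (p.res.fs s) ?_
      rw [lift_fs, hK]
      exact (hTs W s _ _).2 ⟨p, hp, hc, fun h => absurd (by rw [hτ]; rfl) h, rfl⟩
  · have hτ' : K.repl (rn Fin.castSucc) ≠ .tau := fun h => hτ (Kind.repl_tau_iff.1 h)
    refine ⟨(fun p => ⟨p.chan.subst (instRepl (Term.var (.inl 0))),
      ⟨n + 1, true, p.chan, Msg.wk 1 (p.chan.subst (instRepl (Term.var (.inl 0))))⟩ :: p.conds,
      p.res.res⟩) '' T, hT.image _, fun W s C R => ⟨fun h => ?_, ?_⟩⟩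
    · cases h with
      | res _ _ _ R h =>
        rw [lift_fs, hK] at h
        obtain ⟨p, hp, hc, he, rfl⟩ := (hTs W s _ R).1 h
        have he := he hτ'
        have he' := he.subst (instRepl ((s 0).emb n))
        rw [wk_subst_inst, ← msg_lower] at he'
        refine ⟨_, ⟨p, hp, rfl⟩, ?_, fun _ => he', rfl⟩
        intro c hc'
        rcases List.mem_cons.1 hc' with rfl | hc'
        · simp only [Cond.Holds, if_true]
          refine he.trans ?_
          rw [wk_one_eq, wk_one_eq, msg_rn_fs]
          exact he'.symm.subst _
        · exact hc c hc'
    · rintro ⟨_, ⟨p, hp, rfl⟩, hc, he, rfl⟩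
      refine .res _ _ _ (p.res.fs s) ?_
      rw [lift_fs, hK]
      refine (hTs W s _ _).2 ⟨p, hp, fun c hc' => hc c (List.mem_cons_of_mem _ hc'),
        fun _ => ?_, rfl⟩
      have h1 := hc _ (List.mem_cons_self ..)
      simp only [Cond.Holds, if_true] at h1
      refine h1.trans ?_
      rw [wk_one_eq, wk_one_eq, msg_rn_fs]
      exact (he hτ).subst _

/-- A communication is a symbolic output followed by a symbolic input of the other process, taken in
the scope enlarged by the extruded names. The equality of their two channels becomes an additional
condition. -/
theorem exists_sym_close {n : ℕ} {P Q : Proc L n} (hP : SymAt E P .out)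
    (hQ : ∀ {k : ℕ} (w : Fin n → Fin k) (K : Kind L k), SymAt E (Q.repl (rn w)) K) :
    ∃ T : Set (List (Cond L) × (Σ R : Agent L n, Agent L R.scope)), T.Finite ∧
      ∀ (W : Set ℕ) (s : Subst L 0) (R : Agent L n) (S : Agent L R.scope),
        (∃ (C : Msg L n) (N : Msg L R.scope), CStep E W (P.repl (fs s n)) .out C R ∧
          R.msg = some N ∧
          CStep E W ((Q.repl (fs s n)).repl (rn R.ren)) (.inp N) (C.subst (rn R.ren)) S) ↔
        ∃ p ∈ T, (∀ c ∈ p.1, c.Holds E W s) ∧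
          (⟨R, S⟩ : Σ R : Agent L n, Agent L R.scope) = ⟨p.2.1.fs s, p.2.2.fs s⟩ := by
  obtain ⟨T, hT, hTs⟩ := hP
  -- The receiver's description depends on the sender's residual, since the received message lives
  -- in its scope. Only finitely many residuals occur, so the union below stays finite.
  choose U hU hUs using fun (R : Agent L n) (N : Msg L R.scope) => hQ R.ren (.inp N)
  refine ⟨⋃ p ∈ T, {r | ∃ N, p.res.msg = some N ∧ ∃ q ∈ U p.res N,
    r = (⟨p.res.scope, true, p.chan.subst (rn p.res.ren), q.chan⟩ :: (p.conds ++ q.conds),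
      ⟨p.res, q.res⟩)}, ?_, ?_⟩
  · refine hT.biUnion fun p _ => ?_
    cases hmsg : p.res.msg with
    | none => simp
    | some N =>
      refine ((hU p.res N).image (fun q => ((⟨p.res.scope, true, p.chan.subst (rn p.res.ren),
        q.chan⟩ : Cond L) :: (p.conds ++ q.conds), (⟨p.res, q.res⟩ :
        Σ R : Agent L n, Agent L R.scope)))).subset ?_
      rintro r ⟨N', hN', q, hq, rfl⟩
      obtain rfl : N = N' := by simpa using hN'
      exact ⟨q, hq, rfl⟩
  · intro W s R S
    constructor
    · rintro ⟨C, N, h1, hN, h2⟩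
      obtain ⟨p, hp, hc, he, rfl⟩ := (hTs W s C R).1 h1
      obtain ⟨N0, hN0, rfl⟩ : ∃ N0, p.res.msg = some N0 ∧
          N0.subst (fs s _) = N := Option.map_eq_some_iff.1 hN
      have h2' : CStep E W ((Q.repl (rn p.res.ren)).repl (fs s _)) ((Kind.inp N0).repl (fs s _))
          (C.subst (rn p.res.ren)) S := by
        rw [proc_rn_fs]; exact h2
      obtain ⟨q, hq, hc', he', rfl⟩ := (hUs p.res N0 W s _ S).1 h2'
      refine ⟨_, Set.mem_biUnion hp ⟨N0, hN0, q, hq, rfl⟩, ?_, rfl⟩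
      intro c hcm
      rcases List.mem_cons.1 hcm with rfl | hcm
      · simp only [Cond.Holds, if_true]
        rw [msg_rn_fs]
        exact ((he (by simp)).subst _).trans (he' (by simp)).symm
      · rcases List.mem_append.1 hcm with hcm | hcm
        · exact hc c hcm
        · exact hc' c hcm
    · rintro ⟨r, hr, hc, heq⟩
      obtain ⟨p, hp, N0, hN0, q, hq, rfl⟩ := Set.mem_iUnion₂.1 hr
      cases heq
      have h1 := hc _ (List.mem_cons_self ..)
      simp only [Cond.Holds, if_true] at h1
      refine ⟨p.chan.subst (fs s n), N0.subst (fs s _), ?_, ?_, ?_⟩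
      · exact (hTs W s _ _).2 ⟨p, hp, fun c hcm => hc c (by simp [hcm]), fun _ => .refl _, rfl⟩
      · simp [Agent.fs, hN0]
      · have := (hUs p.res N0 W s ((p.chan.subst (fs s n)).subst (rn p.res.ren)) (q.res.fs s)).2
          ⟨q, hq, fun c hcm => hc c (by simp [hcm]), fun _ => ?_, rfl⟩
        · rw [proc_rn_fs] at this; exact this
        · rw [← msg_rn_fs]; exact h1.symm

theorem symAt_par {n : ℕ} {P Q : Proc L n}
    (hP : ∀ {k : ℕ} (w : Fin n → Fin k) (K : Kind L k), SymAt E (P.repl (rn w)) K)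
    (hQ : ∀ {k : ℕ} (w : Fin n → Fin k) (K : Kind L k), SymAt E (Q.repl (rn w)) K)
    (K : Kind L n) : SymAt E (.par P Q) K := by
  have hP' : ∀ K, SymAt E P K := fun K => by simpa only [proc_rn_id] using hP id K
  have hQ' : ∀ K, SymAt E Q K := fun K => by simpa only [proc_rn_id] using hQ id K
  obtain ⟨T, hT, hTs⟩ := hP' K
  obtain ⟨U, hU, hUs⟩ := hQ' K
  obtain ⟨A, hA, hAs⟩ := exists_sym_close (hP' .out) hQ
  obtain ⟨B, hB, hBs⟩ := exists_sym_close (hQ' .out) hP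
  refine ⟨((fun p => ⟨p.chan, p.conds, p.res.parR Q⟩) '' T ∪
    (fun p => ⟨p.chan, p.conds, p.res.parL P⟩) '' U) ∪
    ({p | K = .tau ∧ p ∈ (fun r => (⟨Term.var (.inl 0), r.1, r.2.1.closeL r.2.2⟩ : Sym L n)) '' A} ∪
    {p | K = .tau ∧ p ∈ (fun r => (⟨Term.var (.inl 0), r.1, r.2.1.closeR r.2.2⟩ : Sym L n)) '' B}),
    ((hT.image _).union (hU.image _)).union (((hA.image _).subset fun p hp => hp.2).union
      ((hB.image _).subset fun p hp => hp.2)), fun W s C R => ⟨fun h => ?_, ?_⟩⟩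
  · generalize hK : K.repl (fs s n) = K' at h
    cases h with
    | par_l _ _ _ _ R h =>
      subst hK
      obtain ⟨p, hp, hc, he, rfl⟩ := (hTs W s _ R).1 h
      exact ⟨_, .inl (.inl ⟨p, hp, rfl⟩), hc, he, (Agent.fs_parR ..).symm⟩
    | par_r _ _ _ _ R h =>
      subst hK
      obtain ⟨p, hp, hc, he, rfl⟩ := (hUs W s _ R).1 h
      exact ⟨_, .inl (.inr ⟨p, hp, rfl⟩), hc, he, (Agent.fs_parL ..).symm⟩
    | close_l _ _ _ C' R N S h1 hN h2 =>
      obtain ⟨⟨cs, R0, S0⟩, hp, hc, heq⟩ := (hAs W s R S).1 ⟨C', N, h1, hN, h2⟩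
      cases heq
      exact ⟨_, .inr (.inl ⟨Kind.repl_tau_iff.1 hK, _, hp, rfl⟩), hc,
        fun h => absurd (Kind.repl_tau_iff.1 hK) h, (Agent.fs_closeL ..).symm⟩
    | close_r _ _ _ C' R N S h1 hN h2 =>
      obtain ⟨⟨cs, R0, S0⟩, hp, hc, heq⟩ := (hBs W s R S).1 ⟨C', N, h1, hN, h2⟩
      cases heq
      exact ⟨_, .inr (.inr ⟨Kind.repl_tau_iff.1 hK, _, hp, rfl⟩), hc,
        fun h => absurd (Kind.repl_tau_iff.1 hK) h, (Agent.fs_closeR ..).symm⟩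
  · rintro ⟨_, (⟨p, hp, rfl⟩ | ⟨p, hp, rfl⟩) | (⟨hK, p, hp, rfl⟩ | ⟨hK, p, hp, rfl⟩), hc, he, rfl⟩
    · rw [Agent.fs_parR]
      exact .par_l _ _ _ _ _ ((hTs W s C _).2 ⟨p, hp, hc, he, rfl⟩)
    · rw [Agent.fs_parL]
      exact .par_r _ _ _ _ _ ((hUs W s C _).2 ⟨p, hp, hc, he, rfl⟩)
    · subst hK
      obtain ⟨C', N, h1, hN, h2⟩ := (hAs W s _ _).2 ⟨p, hp, hc, rfl⟩
      rw [Agent.fs_closeL]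
      exact .close_l _ _ _ C' _ N _ h1 hN h2
    · subst hK
      obtain ⟨C', N, h1, hN, h2⟩ := (hBs W s _ _).2 ⟨p, hp, hc, rfl⟩
      rw [Agent.fs_closeR]
      exact .close_r _ _ _ C' _ N _ h1 hN h2

theorem symAt_bang {n : ℕ} {P : Proc L n}
    (hP : ∀ {k : ℕ} (w : Fin n → Fin k) (K : Kind L k), SymAt E (P.repl (rn w)) K)
    (K : Kind L n) : SymAt E (.bang P) K := by
  have hP' : ∀ K, SymAt E P K := fun K => by simpa only [proc_rn_id] using hP id K
  obtain ⟨T, hT, hTs⟩ := hP' K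
  obtain ⟨A, hA, hAs⟩ := exists_sym_close (hP' .out) hP
  refine ⟨((fun p => ⟨p.chan, p.conds, p.res.parR (.bang P)⟩) '' T) ∪
    {p | K = .tau ∧ p ∈ (fun r => (⟨Term.var (.inl 0), r.1,
      (r.2.1.closeL r.2.2).parR (.bang P)⟩ : Sym L n)) '' A},
    (hT.image _).union ((hA.image _).subset fun p hp => hp.2), fun W s C R => ⟨fun h => ?_, ?_⟩⟩
  · generalize hK : K.repl (fs s n) = K' at h
    cases h with
    | rep_act _ _ _ R h =>
      subst hK
      obtain ⟨p, hp, hc, he, rfl⟩ := (hTs W s _ R).1 h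
      exact ⟨_, .inl ⟨p, hp, rfl⟩, hc, he, (Agent.fs_parR s p.res (.bang P)).symm⟩
    | rep_close _ _ C' R N S h1 hN h2 =>
      obtain ⟨⟨cs, R0, S0⟩, hp, hc, heq⟩ := (hAs W s R S).1 ⟨C', N, h1, hN, h2⟩
      cases heq
      refine ⟨_, .inr ⟨Kind.repl_tau_iff.1 hK, _, hp, rfl⟩, hc,
        fun h => absurd (Kind.repl_tau_iff.1 hK) h, ?_⟩
      simp only [Agent.fs_parR, Agent.fs_closeL]; rfl
  · rintro ⟨_, ⟨p, hp, rfl⟩ | ⟨hK, p, hp, rfl⟩, hc, he, rfl⟩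
    · rw [Agent.fs_parR]
      exact .rep_act _ _ _ _ ((hTs W s C _).2 ⟨p, hp, hc, he, rfl⟩)
    · subst hK
      obtain ⟨C', N, h1, hN, h2⟩ := (hAs W s _ _).2 ⟨p, hp, hc, rfl⟩
      rw [Agent.fs_parR, Agent.fs_closeL]
      exact .rep_close _ _ C' _ N _ h1 hN h2

/-- The induction is over all renamings of bound names, because in a communication the receiver is
moved into the scope of the sender's residual. -/
theorem symAt_rn {m n : ℕ} (P : Proc L m) (w : Fin m → Fin n) (K : Kind L n) :
    SymAt E (P.repl (rn w)) K := by
  induction P generalizing n with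
  | nil => exact symAt_nil K
  | out M N P ih => exact symAt_out _ _ _ K
  | inp M P ih => exact symAt_inp _ _ K
  | mat M N P ih => exact symAt_mat _ _ (ih w K)
  | mismat M N P ih => exact symAt_mismat _ _ (ih w K)
  | new P ih => refine symAt_new ?_; rw [lift_rn]; exact ih _ _
  | par P Q ih ih' =>
    refine symAt_par (fun w' K => ?_) (fun w' K => ?_) K
    · rw [proc_rn_rn]; exact ih _ _
    · rw [proc_rn_rn]; exact ih' _ _
  | choice P Q ih ih' => exact symAt_choice (ih w K) (ih' w K)
  | bang P ih =>
    refine symAt_bang (fun w' K => ?_) K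
    rw [proc_rn_rn]; exact ih _ _

theorem symAt {n : ℕ} (P : Proc L n) (K : Kind L n) : SymAt E P K := by
  simpa only [proc_rn_id] using symAt_rn P id K

end

variable {L : FirstOrder.Language.{u, v}} {E : Set (L.Term ℕ × L.Term ℕ)}

/-! ## Consequences of the symbolic description -/

theorem Apart.adm {W W' : Set ℕ} {n : ℕ} {M N : Msg L n} (h : Apart E W M N) {s : Subst L 0}
    (hs : Adm W W' s) : Apart E W' (M.subst (fs s n)) (N.subst (fs s n)) := by
  intro W'' t ht
  rw [msg_fs_fs, msg_fs_fs]
  exact h _ _ (hs.comp ht)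

theorem Apart.congr {W : Set ℕ} {n : ℕ} {M N M' N' : Msg L n} (h : Apart E W M N)
    (hM : EqE E M M') (hN : EqE E N N') : Apart E W M' N' := fun W' s hs H =>
  h W' s hs ((hM.subst _).trans (H.trans (hN.subst _).symm))

theorem Cond.Holds.adm {W W' : Set ℕ} {s t : Subst L 0} {c : Cond L} (h : c.Holds E W s)
    (ht : Adm W W' t) : c.Holds E W' (sc s t) := by
  unfold Cond.Holds at h ⊢
  split
  · rename_i hp
    rw [if_pos hp] at h
    rw [← msg_fs_fs, ← msg_fs_fs]; exact h.subst _
  · rename_i hp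
    rw [if_neg hp] at h
    rw [← msg_fs_fs, ← msg_fs_fs]; exact h.adm ht

theorem Cond.Holds.congr {W : Set ℕ} {s t : Subst L 0} {c : Cond L} (h : c.Holds E W s)
    (ht : ∀ x, EqE E (s x) (t x)) : c.Holds E W t := by
  unfold Cond.Holds at h ⊢
  split
  · rename_i hp
    rw [if_pos hp] at h
    exact (EqE.fs_left _ ht).symm.trans (h.trans (EqE.fs_left _ ht))
  · rename_i hp
    rw [if_neg hp] at h
    exact h.congr (EqE.fs_left _ ht) (EqE.fs_left _ ht)

/-- The identity substitution, in the form that is used here. -/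
abbrev idS : Subst L 0 := fun x => Term.var (.inl x)

@[simp] theorem sc_idS_left (s : Subst L 0) : sc idS s = s := rfl

@[simp] theorem sc_idS_right (s : Subst L 0) : sc s idS = s := funext fun x => ev_ident (s x)

theorem IsSym.self {n : ℕ} {P : Proc L n} {K : Kind L n} {T : Set (Sym L n)}
    (h : IsSym E P K T) (W : Set ℕ) (C : Msg L n) (R : Agent L n) :
    CStep E W P K C R ↔ ∃ p ∈ T, (∀ c ∈ p.conds, c.Holds E W idS) ∧
      (K ≠ .tau → EqE E p.chan C) ∧ R = p.res := by
  have := h W idS C R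
  simpa only [fs_ident, repl_var, Kind.repl_var, subst_var, Agent.fs_self] using this

/-- Image finiteness holds on the nose, not just up to the equational theory: every residual is one
of the finitely many symbolic residuals. -/
theorem finite_steps (W : Set ℕ) {n : ℕ} (P : Proc L n) (K : Kind L n) (C : Msg L n) :
    {R | CStep E W P K C R}.Finite := by
  obtain ⟨T, hT, hTs⟩ := symAt (E := E) P K
  refine (hT.image Sym.res).subset fun R hR => ?_
  obtain ⟨p, hp, -, -, rfl⟩ := (hTs.self W C R).1 hR
  exact ⟨p, hp, rfl⟩

theorem CStep.adm {W W' : Set ℕ} {n : ℕ} {P : Proc L n} {K : Kind L n} {C : Msg L n}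
    {R : Agent L n} (h : CStep E W P K C R) {s : Subst L 0} (hs : Adm W W' s) :
    CStep E W' (P.repl (fs s n)) (K.repl (fs s n)) (C.subst (fs s n)) (R.fs s) := by
  obtain ⟨T, hT, hTs⟩ := symAt (E := E) P K
  obtain ⟨p, hp, hc, he, rfl⟩ := (hTs.self W C R).1 h
  exact (hTs W' s _ _).2 ⟨p, hp, fun c hcm => by simpa using (hc c hcm).adm hs,
    fun hK => (he hK).subst _, rfl⟩

/-- Conditions and channels are insensitive to the equational theory, so the same symbolic
transition is available to both instances. The residuals are instances of one agent `R0`, which lets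
inductions continue. -/
theorem CStep.congr {W : Set ℕ} {n : ℕ} {P : Proc L n} {K : Kind L n} {C C' : Msg L n}
    {R : Agent L n} {s s' : Subst L 0} (h : CStep E W (P.repl (fs s n)) (K.repl (fs s n)) C R)
    (hs : ∀ x, EqE E (s x) (s' x)) (hC : K ≠ .tau → EqE E C C') :
    ∃ R0 : Agent L n, R = R0.fs s ∧
      CStep E W (P.repl (fs s' n)) (K.repl (fs s' n)) C' (R0.fs s') := by
  obtain ⟨T, hT, hTs⟩ := symAt (E := E) P K
  obtain ⟨p, hp, hc, he, rfl⟩ := (hTs W s C R).1 h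
  exact ⟨p.res, rfl, (hTs W s' _ _).2 ⟨p, hp, fun c hcm => (hc c hcm).congr hs,
    fun hK => (EqE.fs_left _ hs).symm.trans ((he hK).trans (hC hK)), rfl⟩⟩

theorem CStep.chan {W : Set ℕ} {n : ℕ} {P : Proc L n} {K : Kind L n} {C C' : Msg L n}
    {R : Agent L n} (h : CStep E W P K C R) (hC : K ≠ .tau → EqE E C C') : CStep E W P K C' R := by
  obtain ⟨T, hT, hTs⟩ := symAt (E := E) P K
  obtain ⟨p, hp, hc, he, rfl⟩ := (hTs.self W C R).1 h
  exact (hTs.self W C' _).2 ⟨p, hp, hc, fun hK => (he hK).trans (hC hK), rfl⟩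

/-- The free variables of a kind of action. -/
def Kind.fv {n : ℕ} : Kind L n → Finset ℕ
  | .inp N => N.fv
  | _ => ∅

theorem Kind.fs_self {n : ℕ} (K : Kind L n) {s : Subst L 0}
    (h : ∀ x ∈ K.fv, s x = Term.var (.inl x)) : K.repl (fs s n) = K := by
  cases K with
  | inp N => simp only [Kind.repl, msg_fs_self N h]
  | _ => rfl

theorem Agent.notMem_fv_fs {n : ℕ} (R : Agent L n) {s : Subst L 0} {y : ℕ}
    (h : ∀ x, y ∉ (s x).fv) :
    y ∉ (R.fs s).proc.fv ∧ ∀ N, (R.fs s).msg = some N → y ∉ N.fv := by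
  have h1 : ∀ (k x : ℕ), y ∉ (AppliedPi.fs s k (.inl x)).fv := fun k x => by simpa using h x
  have h2 : ∀ (k : ℕ) (i : Fin k), y ∉ (AppliedPi.fs s k (.inr i)).fv := fun k i => by simp
  refine ⟨notMem_fv_repl _ (fun x _ => h1 _ x) (h2 _), fun N hN => ?_⟩
  obtain ⟨N0, -, rfl⟩ := Option.map_eq_some_iff.1 hN
  exact notMem_fv_subst _ (fun x _ => h1 _ x) (h2 _)

theorem CStep.notMem_fv {W : Set ℕ} {n : ℕ} {P : Proc L n} {K : Kind L n} {C : Msg L n}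
    {R : Agent L n} (h : CStep E W P K C R) {x : ℕ} (hP : x ∉ P.fv) (hK : x ∉ K.fv) :
    x ∉ R.proc.fv ∧ ∀ N, R.msg = some N → x ∉ N.fv := by
  obtain ⟨T, hT, hTs⟩ := symAt (E := E) P K
  -- This substitution fixes `P` and `K` but has no `x` in its range. Applying the description to it
  -- exhibits the residual as an instance by `s`, which cannot contain `x`.
  let s : Subst L 0 := fun y => Term.var (.inl (if y = x then x + 1 else y))
  have hs : ∀ y, y ≠ x → s y = Term.var (.inl y) := fun y hy => by simp [s, hy]
  have h1 : P.repl (fs s n) = P := proc_fs_self P fun y hy => hs y (by rintro rfl; exact hP hy)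
  have h2 : K.repl (fs s n) = K := Kind.fs_self K fun y hy => hs y (by rintro rfl; exact hK hy)
  have h3 := hTs W s C R
  rw [h1, h2] at h3
  obtain ⟨p, hp, -, -, rfl⟩ := h3.1 h
  refine Agent.notMem_fv_fs _ fun y => ?_
  by_cases hy : y = x
  · simp [s, hy]
  · simp only [s, hy, if_false, fv_var_inl, Finset.mem_singleton]; exact fun h => hy h.symm

theorem CStep.msg_isSome {W : Set ℕ} {n : ℕ} {P : Proc L n} {K : Kind L n} {C : Msg L n}
    {R : Agent L n} (h : CStep E W P K C R) : K = .out ↔ ∃ N, R.msg = some N := by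
  induction h with
  | inp => simp
  | out => simp
  | sum_l _ _ _ _ _ _ ih => exact ih
  | sum_r _ _ _ _ _ _ ih => exact ih
  | mat _ _ _ _ _ _ _ _ ih => exact ih
  | mismat _ _ _ _ _ _ _ _ ih => exact ih
  | res _ K _ R _ ih => rw [Kind.repl_out_iff] at ih; exact ih
  | par_l _ _ _ _ _ _ ih => exact ih
  | par_r _ _ _ _ _ _ ih => exact ih
  | rep_act _ _ _ _ _ ih => exact ih
  | close_l => simp [Agent.closeL]
  | close_r => simp [Agent.closeR]
  | rep_close => simp [Agent.closeL, Agent.parR]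

/-! ### Private variables that do not occur can be forgotten. -/

theorem exists_bound (F : Set ℕ) (hF : F.Finite) : ∃ N, ∀ x ∈ F, x < N := by
  obtain ⟨N, hN⟩ := hF.bddAbove
  exact ⟨N + 1, fun x hx => Nat.lt_succ_of_le (hN hx)⟩

theorem infinite_compl_of {W F : Set ℕ} (hF : F.Finite) (N : ℕ)
    (h : ∀ w ∈ W, w ∈ F ∨ ∃ k, w = 2 * k + N) : Wᶜ.Infinite := by
  have h1 : (Set.range fun k => 2 * k + 1 + N).Infinite := Set.infinite_range_of_injective
    fun a b hab => by have : 2 * a + 1 + N = 2 * b + 1 + N := hab; omega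
  refine (h1.sdiff hF).mono ?_
  rintro x ⟨⟨k, rfl⟩, hx⟩ hxW
  rcases h _ hxW with h | ⟨l, hl⟩
  · exact hx h
  · simp only at hl; omega

/-- A unifier admissible for the smaller set `U` extends to one admissible for `W`: the additional
private variables do not occur in the two messages and may be sent to fresh places. -/
theorem Apart.of_unused {W U : Set ℕ} {n : ℕ} {M N : Msg L n} (hUW : U ⊆ W) (hU : U.Finite)
    (hM : ∀ x ∈ M.fv, x ∈ W → x ∈ U) (hN : ∀ x ∈ N.fv, x ∈ W → x ∈ U) (h : Apart E W M N) :
    Apart E U M N := by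
  classical
  rintro W5 s ⟨-, f, hf, hfi, hfx⟩ H
  let X : Finset ℕ := M.fv ∪ N.fv
  obtain ⟨B, hB⟩ := exists_bound ((f '' U) ∪ (X.biUnion fun x => (s x).fv : Finset ℕ))
    ((hU.image _).union (Finset.finite_toSet _))
  have hBf : ∀ w ∈ U, f w < B := fun w hw => hB _ (.inl ⟨w, hw, rfl⟩)
  have hBs : ∀ x ∈ X, ∀ y ∈ (s x).fv, y < B := fun x hx y hy =>
    hB _ (.inr (Finset.mem_coe.2 (Finset.mem_biUnion.2 ⟨x, hx, hy⟩)))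
  -- The bound `B` lies above all relevant images, so the positions `2 * w + B` collide with none of
  -- them. They leave the positions of the other parity free, among them `B + 1`, which receives the
  -- irrelevant variables, and keep the complement infinite.
  let g : ℕ → ℕ := fun w => if w ∈ U then f w else 2 * w + B
  let t : Subst L 0 := fun x => if x ∈ W then Term.var (.inl (g x)) else
    if x ∈ X then s x else Term.var (.inl (B + 1))
  have ht : Adm W (g '' W) t := by
    refine ⟨infinite_compl_of (hU.image f) B ?_, g, fun w hw => ⟨⟨w, hw, rfl⟩, by simp [t, hw]⟩,
      ?_, ?_⟩
    · rintro _ ⟨w, hw, rfl⟩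
      by_cases hwU : w ∈ U
      · exact .inl ⟨w, hwU, by simp [g, hwU]⟩
      · exact .inr ⟨w, by simp [g, hwU]⟩
    · intro a ha b hb hab
      by_cases haU : a ∈ U <;> by_cases hbU : b ∈ U <;> simp only [g, haU, hbU, if_true, if_false] at hab
      · exact hfi haU hbU hab
      · have := hBf a haU; omega
      · have := hBf b hbU; omega
      · omega
    · intro x hx w hw hmem
      simp only [t, hx, if_false] at hmem
      by_cases hxX : x ∈ X
      · rw [if_pos hxX] at hmem
        by_cases hwU : w ∈ U
        · simp only [g, hwU, if_true] at hmem
          exact hfx x (fun h => hx (hUW h)) w hwU hmem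
        · simp only [g, hwU, if_false] at hmem
          have := hBs x hxX _ hmem; omega
      · rw [if_neg hxX] at hmem
        simp only [fv_var_inl, Finset.mem_singleton] at hmem
        by_cases hwU : w ∈ U
        · simp only [g, hwU, if_true] at hmem
          have := hBf w hwU; omega
        · simp only [g, hwU, if_false] at hmem; omega
  have key : ∀ x ∈ X, (x ∈ W → x ∈ U) → t x = s x := by
    intro x hx hxU
    by_cases hxW : x ∈ W
    · simp only [t, hxW, if_true, g, hxU hxW, (hf x (hxU hxW)).2]
    · simp only [t, hxW, if_false, hx, if_true]
  refine h _ t ht ?_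
  rwa [msg_fs_congr M fun x hx => key x (Finset.mem_union_left _ hx) (hM x hx),
    msg_fs_congr N fun x hx => key x (Finset.mem_union_right _ hx) (hN x hx)]

theorem CStep.of_unused {W U : Set ℕ} {n : ℕ} {P : Proc L n} {K : Kind L n} {C : Msg L n}
    {R : Agent L n} (h : CStep E W P K C R) (hUW : U ⊆ W) (hU : U.Finite) (hW : Wᶜ.Infinite)
    (hP : ∀ x ∈ P.fv, x ∈ W → x ∈ U) (hK : ∀ x ∈ K.fv, x ∈ W → x ∈ U) : CStep E U P K C R := by
  classical
  obtain ⟨T, hT, hTs⟩ := symAt (E := E) P K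
  obtain ⟨c0, hc0⟩ := hW.nonempty
  -- All superfluous private variables are sent to one public variable `c0`. The process and the
  -- kind are unaffected, while the instantiated conditions mention private variables of `U` only.
  let s : Subst L 0 := fun y => Term.var (.inl (if y ∈ W ∧ y ∉ U then c0 else y))
  have hs : ∀ y, (y ∈ W → y ∈ U) → s y = Term.var (.inl y) := fun y hy => by
    simp only [s]; rw [if_neg]; rintro ⟨h1, h2⟩; exact h2 (hy h1)
  have h1 : P.repl (fs s n) = P := proc_fs_self P fun y hy => hs y (hP y hy)
  have h2 : K.repl (fs s n) = K := Kind.fs_self K fun y hy => hs y (hK y hy)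
  have h3 := fun W => hTs W s C R
  rw [h1, h2] at h3
  obtain ⟨p, hp, hc, he, rfl⟩ := (h3 W).1 h
  have hfv : ∀ {k : ℕ} (M : Msg L k), ∀ x ∈ Msg.fv (M.subst (fs s k)), x ∈ W → x ∈ U := by
    intro k M x hx hxW
    by_contra hxU
    rw [mem_fv_fs] at hx
    obtain ⟨y, -, hy⟩ := hx
    simp only [s, fv_var_inl, Finset.mem_singleton] at hy
    split at hy
    · subst hy; exact hc0 hxW
    · rename_i hn; subst hy; exact hn ⟨hxW, hxU⟩
  refine (h3 U).2 ⟨p, hp, fun c hcm => ?_, he, rfl⟩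
  have := hc c hcm
  unfold Cond.Holds at this ⊢
  split
  · rename_i hpos; rwa [if_pos hpos] at this
  · rename_i hpos; rw [if_neg hpos] at this
    exact this.of_unused hUW hU (hfv _) (hfv _)

/-! ## A semantics of formulae over flat states -/

/-- The assignment after a transition: `y` is assigned the message that is output, if any. -/
def nextA {m : ℕ} (Δ : ℕ → Msg L m) (y : ℕ) (R : Agent L m) : ℕ → Msg L R.scope :=
  match R.msg with
  | some N => Function.update (fun x => (Δ x).subst (rn R.ren)) y N
  | none => fun x => (Δ x).subst (rn R.ren)

/-- The kind of an action, evaluated at an assignment. -/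
def Label.kind {m : ℕ} (π : Label L 0) (Δ : ℕ → Msg L m) : Kind L m :=
  match π with
  | .tau => .tau
  | .out _ _ => .out
  | .inp _ N => .inp (ev N Δ)

/-- The channel of an action, evaluated at an assignment. -/
def Label.chan {m : ℕ} (π : Label L 0) (Δ : ℕ → Msg L m) : Msg L m :=
  match π with
  | .tau => Term.var (.inl 0)
  | .out M _ => ev M Δ
  | .inp M _ => ev M Δ

/-- The variable that is bound by an action; it is irrelevant unless the action is an output. -/
def Label.bv {m : ℕ} : Label L m → ℕ
  | .out _ x => x
  | _ => 0

variable (E) in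
/-- Satisfaction of a formula at the state with process `P`, for the assignment `Δ` of its free
variables, if the variables of `W` are private. -/
def Forces : Formula L → Set ℕ → {m : ℕ} → (ℕ → Msg L m) → Proc L m → Prop
  | .tt, _, _, _, _ => True
  | .ff, _, _, _, _ => False
  | .eq M N, _, _, Δ, _ => EqE E (ev M Δ) (ev N Δ)
  | .and φ ψ, W, _, Δ, P => Forces φ W Δ P ∧ Forces ψ W Δ P
  | .or φ ψ, W, _, Δ, P => Forces φ W Δ P ∨ Forces ψ W Δ P
  | .imp φ ψ, W, m, Δ, P => ∀ (W' : Set ℕ) (s : Subst L 0), Adm W W' s →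
      Forces φ W' (fun x => (Δ x).subst (fs s m)) (P.repl (fs s m)) →
      Forces ψ W' (fun x => (Δ x).subst (fs s m)) (P.repl (fs s m))
  | .dia π φ, W, _, Δ, P => ∃ R, CStep E W P (π.kind Δ) (π.chan Δ) R ∧
      Forces φ W (nextA Δ π.bv R) R.proc
  | .box π φ, W, m, Δ, P => ∀ (W' : Set ℕ) (s : Subst L 0) (R : Agent L m), Adm W W' s →
      CStep E W' (P.repl (fs s m)) (π.kind fun x => (Δ x).subst (fs s m))
        (π.chan fun x => (Δ x).subst (fs s m)) R →
      Forces φ W' (nextA (fun x => (Δ x).subst (fs s m)) π.bv R) R.proc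

theorem nextA_fs {m : ℕ} (Δ : ℕ → Msg L m) (y : ℕ) (R : Agent L m) (s : Subst L 0) :
    nextA (fun x => (Δ x).subst (fs s m)) y (R.fs s) =
      fun x => (nextA Δ y R x).subst (fs s R.scope) := by
  obtain ⟨k, w, N, P⟩ := R
  funext x
  cases N with
  | none => simp only [nextA, Agent.fs, Option.map_none, msg_rn_fs]
  | some N =>
    simp only [nextA, Agent.fs, Option.map_some, Function.update_apply]
    split
    · rfl
    · rw [msg_rn_fs]

theorem Label.kind_fs {m : ℕ} (π : Label L 0) (Δ : ℕ → Msg L m) (s : Subst L 0) :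
    π.kind (fun x => (Δ x).subst (fs s m)) = (π.kind Δ).repl (fs s m) := by
  cases π <;> simp [Label.kind, Kind.repl, ev_subst]

theorem Label.chan_fs {m : ℕ} (π : Label L 0) (Δ : ℕ → Msg L m) (s : Subst L 0) (h : π ≠ .tau) :
    π.chan (fun x => (Δ x).subst (fs s m)) = (π.chan Δ).subst (fs s m) := by
  cases π with
  | tau => exact absurd rfl h
  | _ => simp [Label.chan, ev_subst]

theorem Label.kind_tau_iff {m : ℕ} {π : Label L 0} {Δ : ℕ → Msg L m} :
    π.kind Δ = .tau ↔ π = .tau := by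
  cases π <;> simp [Label.kind]

/-- Formulae are persistent. -/
theorem Forces.adm {φ : Formula L} {W : Set ℕ} {m : ℕ} {Δ : ℕ → Msg L m} {P : Proc L m}
    (h : Forces E φ W Δ P) {W' : Set ℕ} {s : Subst L 0} (hs : Adm W W' s) :
    Forces E φ W' (fun x => (Δ x).subst (fs s m)) (P.repl (fs s m)) := by
  induction φ generalizing W m W' s with
  | tt => trivial
  | ff => exact h
  | eq M N => simp only [Forces] at h ⊢; rw [← ev_subst, ← ev_subst]; exact h.subst _
  | and φ ψ ih ih' => exact ⟨ih h.1 hs, ih' h.2 hs⟩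
  | or φ ψ ih ih' => exact h.elim (fun h => .inl (ih h hs)) (fun h => .inr (ih' h hs))
  | imp φ ψ ih ih' =>
    intro W'' t ht h1
    simp only [msg_fs_fs, proc_fs_fs] at h1 ⊢
    exact h W'' _ (hs.comp ht) h1
  -- The diamond does not quantify over futures, so here persistence must come from the persistence
  -- of transitions.
  | dia π φ ih =>
    obtain ⟨R, hR, h⟩ := h
    refine ⟨R.fs s, ?_, ?_⟩
    · rw [Label.kind_fs]
      refine (hR.adm hs).chan fun hτ => ?_
      rw [Label.chan_fs]
      · exact .refl _
      · rwa [Ne, Kind.repl_tau_iff, Label.kind_tau_iff] at hτ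
    · rw [nextA_fs]; exact ih h hs
  | box π φ ih =>
    intro W'' t R ht h1
    simp only [msg_fs_fs, proc_fs_fs] at h1 ⊢
    exact h W'' _ R (hs.comp ht) h1

/-- Satisfaction is invariant under the equational theory. -/
theorem Forces.congr {φ : Formula L} {W : Set ℕ} {m : ℕ} {Δ : ℕ → Msg L m} {P : Proc L m}
    {s s' : Subst L 0} (hs : ∀ x, EqE E (s x) (s' x))
    (h : Forces E φ W (fun x => (Δ x).subst (fs s m)) (P.repl (fs s m))) :
    Forces E φ W (fun x => (Δ x).subst (fs s' m)) (P.repl (fs s' m)) := by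
  induction φ generalizing W m s s' with
  | tt => trivial
  | ff => exact h
  | eq M N =>
    simp only [Forces] at h ⊢; rw [← ev_subst, ← ev_subst] at h ⊢
    exact (EqE.fs_left _ hs).symm.trans (h.trans (EqE.fs_left _ hs))
  | and φ ψ ih ih' => exact ⟨ih hs h.1, ih' hs h.2⟩
  | or φ ψ ih ih' => exact h.elim (fun h => .inl (ih hs h)) (fun h => .inr (ih' hs h))
  | imp φ ψ ih ih' =>
    intro W'' t ht h1
    have h2 := h W'' t ht
    simp only [msg_fs_fs, proc_fs_fs] at h1 h2 ⊢
    have hst : ∀ x, EqE E (sc s t x) (sc s' t x) := fun x => (hs x).subst _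
    exact ih' hst (h2 (ih (fun x => (hst x).symm) h1))
  | dia π φ ih =>
    obtain ⟨R, hR, h⟩ := h
    rw [Label.kind_fs] at hR
    -- Both residuals are instances of `R0`, so the induction hypothesis applies to it with the two
    -- substitutions.
    obtain ⟨R0, rfl, hR'⟩ := hR.congr (C' := π.chan fun x => (Δ x).subst (fs s' m)) hs (by
      intro hτ
      rw [Ne, Label.kind_tau_iff] at hτ
      rw [Label.chan_fs _ _ _ hτ, Label.chan_fs _ _ _ hτ]
      exact EqE.fs_left _ hs)
    refine ⟨R0.fs s', by rwa [Label.kind_fs], ?_⟩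
    rw [nextA_fs] at h ⊢
    exact ih hs h
  | box π φ ih =>
    intro W'' t R ht h1
    have h2 := h W'' t
    simp only [msg_fs_fs, proc_fs_fs] at h1 h2 ⊢
    have hst : ∀ x, EqE E (sc s t x) (sc s' t x) := fun x => (hs x).subst _
    rw [Label.kind_fs] at h1
    obtain ⟨R0, rfl, hR'⟩ := h1.congr (C' := π.chan fun x => (Δ x).subst (fs (sc s t) m))
      (fun x => (hst x).symm) (by
      intro hτ
      rw [Ne, Label.kind_tau_iff] at hτ
      rw [Label.chan_fs _ _ _ hτ, Label.chan_fs _ _ _ hτ]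
      exact (EqE.fs_left _ hst).symm)
    have h3 := h2 (R0.fs (sc s t)) ht (by rwa [Label.kind_fs])
    rw [nextA_fs] at h3 ⊢
    exact ih hst h3

/-- The free variables of the messages of an action. -/
def Label.fv : Label L 0 → Finset ℕ
  | .tau => ∅
  | .out M _ => M.fv
  | .inp M N => M.fv ∪ N.fv

theorem Label.kind_congr {m : ℕ} (π : Label L 0) {Δ Δ' : ℕ → Msg L m}
    (h : ∀ x ∈ π.fv, Δ x = Δ' x) : π.kind Δ = π.kind Δ' := by
  cases π with
  | inp M N => simp only [Label.kind, ev_congr N fun x hx => h x (Finset.mem_union_right _ hx)]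
  | _ => rfl

theorem Label.chan_congr {m : ℕ} (π : Label L 0) {Δ Δ' : ℕ → Msg L m}
    (h : ∀ x ∈ π.fv, Δ x = Δ' x) : π.chan Δ = π.chan Δ' := by
  cases π with
  | tau => rfl
  | out M x => exact ev_congr M h
  | inp M N => exact ev_congr M fun x hx => h x (Finset.mem_union_left _ hx)

theorem mem_fv_dia {π : Label L 0} {φ : Formula L} {x : ℕ} :
    x ∈ (Formula.dia π φ).fv ↔ x ∈ π.fv ∨ x ∈ φ.fv ∧ x ∉ π.bn := by
  cases π <;> simp [Formula.fv, Label.fv, Label.bn, and_comm, or_assoc]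

theorem mem_fv_box {π : Label L 0} {φ : Formula L} {x : ℕ} :
    x ∈ (Formula.box π φ).fv ↔ x ∈ π.fv ∨ x ∈ φ.fv ∧ x ∉ π.bn := by
  cases π <;> simp [Formula.fv, Label.fv, Label.bn, and_comm, or_assoc]

/-- The transition enters through its kind only: a residual carries a message exactly for outputs.
Hence the default value of `Label.bv` is never read. -/
theorem nextA_congr {W : Set ℕ} {m : ℕ} {π : Label L 0} {Δ Δ' Δ'' : ℕ → Msg L m} {P : Proc L m}
    {C : Msg L m} {R : Agent L m} (hR : CStep E W P (π.kind Δ'') C R) {x : ℕ}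
    (h : x ∉ π.bn → Δ x = Δ' x) : nextA Δ π.bv R x = nextA Δ' π.bv R x := by
  obtain ⟨k, w, N, P'⟩ := R
  have := hR.msg_isSome
  cases π with
  | out M y =>
    obtain ⟨N', rfl⟩ : ∃ N', N = some N' := this.1 rfl
    simp only [nextA, Function.update_apply, Label.bv]
    split
    · rfl
    · rename_i hxy
      rw [h (by simpa [Label.bn] using hxy)]
  | tau =>
    cases N with
    | none => simp only [nextA]; rw [h (by simp [Label.bn])]
    | some N => exact absurd (this.2 ⟨N, rfl⟩) (by simp [Label.kind])
  | inp M M' =>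
    cases N with
    | none => simp only [nextA]; rw [h (by simp [Label.bn])]
    | some N => exact absurd (this.2 ⟨N, rfl⟩) (by simp [Label.kind])

/-- Satisfaction depends only on the assignment of the free variables. -/
theorem Forces.local {φ : Formula L} {W : Set ℕ} {m : ℕ} {Δ Δ' : ℕ → Msg L m} {P : Proc L m}
    (hΔ : ∀ x ∈ φ.fv, Δ x = Δ' x) (h : Forces E φ W Δ P) : Forces E φ W Δ' P := by
  induction φ generalizing W m with
  | tt => trivial
  | ff => exact h
  | eq M N =>
    simp only [Formula.fv, Finset.mem_union] at hΔ
    simp only [Forces] at h ⊢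
    rwa [← ev_congr M fun x hx => hΔ x (.inl hx), ← ev_congr N fun x hx => hΔ x (.inr hx)]
  | and φ ψ ih ih' =>
    simp only [Formula.fv, Finset.mem_union] at hΔ
    exact ⟨ih (fun x hx => hΔ x (.inl hx)) h.1, ih' (fun x hx => hΔ x (.inr hx)) h.2⟩
  | or φ ψ ih ih' =>
    simp only [Formula.fv, Finset.mem_union] at hΔ
    exact h.elim (fun h => .inl (ih (fun x hx => hΔ x (.inl hx)) h))
      (fun h => .inr (ih' (fun x hx => hΔ x (.inr hx)) h))
  | imp φ ψ ih ih' =>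
    simp only [Formula.fv, Finset.mem_union] at hΔ
    intro W' s hs h1
    exact ih' (fun x hx => by simp only [hΔ x (.inr hx)])
      (h W' s hs (ih (fun x hx => by simp only [hΔ x (.inl hx)]) h1))
  | dia π φ ih =>
    simp only [mem_fv_dia] at hΔ
    obtain ⟨R, hR, h⟩ := h
    refine ⟨R, ?_, ih (fun x hx => nextA_congr hR fun hx' => hΔ x (.inr ⟨hx, hx'⟩)) h⟩
    rwa [← Label.kind_congr π fun x hx => hΔ x (.inl hx),
      ← Label.chan_congr π fun x hx => hΔ x (.inl hx)]
  | box π φ ih =>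
    simp only [mem_fv_box] at hΔ
    intro W' s R hs h1
    have h2 := h1
    rw [← Label.kind_congr π (Δ := fun x => (Δ x).subst (fs s m))
        fun x hx => by simp only [hΔ x (.inl hx)],
      ← Label.chan_congr π (Δ := fun x => (Δ x).subst (fs s m))
        fun x hx => by simp only [hΔ x (.inl hx)]] at h1
    exact ih (fun x hx => nextA_congr h2 fun hx' => by simp only [hΔ x (.inr ⟨hx, hx'⟩)])
      (h W' s R hs h1)

/-! ## Finite conjunctions and disjunctions -/

theorem exists_bigAnd {ι : Type*} {T : Set ι} (hT : T.Finite) (g : ι → Formula L) :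
    ∃ φ : Formula L, (∀ v ∈ φ.fv, ∃ i ∈ T, v ∈ (g i).fv) ∧
      ∀ (W : Set ℕ) {m : ℕ} (Δ : ℕ → Msg L m) (P : Proc L m),
        Forces E φ W Δ P ↔ ∀ i ∈ T, Forces E (g i) W Δ P := by
  induction T, hT using Set.Finite.induction_on with
  | empty => exact ⟨.tt, by simp [Formula.fv], by simp [Forces]⟩
  | @insert i T _ _ ih =>
    obtain ⟨φ, h1, h2⟩ := ih
    refine ⟨.and (g i) φ, fun v hv => ?_, fun W m Δ P => ?_⟩
    · rcases Finset.mem_union.1 hv with hv | hv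
      · exact ⟨i, Set.mem_insert _ _, hv⟩
      · obtain ⟨k, hk, hv⟩ := h1 v hv
        exact ⟨k, Set.mem_insert_of_mem _ hk, hv⟩
    · simp only [Forces, h2, Set.mem_insert_iff, forall_eq_or_imp]

theorem exists_bigOr {ι : Type*} {T : Set ι} (hT : T.Finite) (g : ι → Formula L) :
    ∃ φ : Formula L, (∀ v ∈ φ.fv, ∃ i ∈ T, v ∈ (g i).fv) ∧
      ∀ (W : Set ℕ) {m : ℕ} (Δ : ℕ → Msg L m) (P : Proc L m),
        Forces E φ W Δ P ↔ ∃ i ∈ T, Forces E (g i) W Δ P := by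
  induction T, hT using Set.Finite.induction_on with
  | empty => exact ⟨.ff, by simp [Formula.fv], by simp [Forces]⟩
  | @insert i T _ _ ih =>
    obtain ⟨φ, h1, h2⟩ := ih
    refine ⟨.or (g i) φ, fun v hv => ?_, fun W m Δ P => ?_⟩
    · rcases Finset.mem_union.1 hv with hv | hv
      · exact ⟨i, Set.mem_insert _ _, hv⟩
      · obtain ⟨k, hk, hv⟩ := h1 v hv
        exact ⟨k, Set.mem_insert_of_mem _ hk, hv⟩
    · simp only [Forces, h2, Set.mem_insert_iff, exists_eq_or_imp]

/-! ## Guards: formulae that describe a future world -/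

/-- A formula written now can only speak about present variables, so each variable `y` of the future
world must be the image of a present one, `b y`. Changing `s` outside the finite set `X` makes this
possible. The range of `b` is kept co-infinite, to leave names for the variables bound by outputs.
-/
theorem exists_world {W W' : Set ℕ} {s : Subst L 0} (hs : Adm W W' s) (hW : Wᶜ.Infinite)
    (X : Finset ℕ) : ∃ (t : Subst L 0) (b : ℕ → ℕ), Adm W W' t ∧ (∀ x ∈ X, t x = s x) ∧
      (∀ y, t (b y) = Term.var (.inl y)) ∧ (Set.range b)ᶜ.Infinite := by
  classical
  obtain ⟨hW', f, hf, hfi, hfx⟩ := hs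
  have hinf : (Wᶜ \ (X : Set ℕ)).Infinite := hW.sdiff (Finset.finite_toSet X)
  let c := hinf.natEmbedding
  have hc : ∀ k, (c k : ℕ) ∉ W ∧ (c k : ℕ) ∉ X := fun k =>
    ⟨(c k).2.1, fun h => (c k).2.2 (Finset.mem_coe.2 h)⟩
  have hci : ∀ k l, (c k : ℕ) = c l → k = l := fun k l h => c.injective (Subtype.ext h)
  obtain ⟨z, hz⟩ := hW'.nonempty
  -- Renamed private variables have a private preimage. The other variables get one from the even
  -- part of a supply `c` outside `W` and `X`, and the odd part stays outside the range of `b`.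
  let b : ℕ → ℕ := fun y => if h : ∃ w ∈ W, f w = y then h.choose else c (2 * y)
  let t : Subst L 0 := fun x => if x ∈ X ∨ x ∈ W then s x else
    if h : ∃ y, x = c (2 * y) ∧ ∀ w ∈ W, f w ≠ y then Term.var (.inl h.choose)
    else Term.var (.inl z)
  have hbW : ∀ y (h : ∃ w ∈ W, f w = y), b y ∈ W ∧ f (b y) = y := fun y h => by
    simp only [b, dif_pos h]; exact h.choose_spec
  have hbc : ∀ y, (¬ ∃ w ∈ W, f w = y) → b y = c (2 * y) := fun y h => by
    simp only [b, dif_neg h]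
  refine ⟨t, b, ⟨hW', f, fun w hw => ⟨(hf w hw).1, by simp [t, hw, (hf w hw).2]⟩, hfi, ?_⟩,
    fun x hx => by simp [t, hx], ?_, ?_⟩
  · intro x hx w hw hmem
    simp only [t, hx, or_false] at hmem
    split at hmem
    · exact hfx x hx w hw hmem
    · split at hmem
      · rename_i h
        simp only [fv_var_inl, Finset.mem_singleton] at hmem
        exact h.choose_spec.2 w hw hmem
      · simp only [fv_var_inl, Finset.mem_singleton] at hmem
        exact hz (hmem ▸ (hf w hw).1)
  · intro y
    by_cases h : ∃ w ∈ W, f w = y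
    · obtain ⟨h1, h2⟩ := hbW y h
      simp only [t, h1, or_true, if_true, (hf _ h1).2, h2]
    · rw [hbc y h]
      have h' : ∃ y', (c (2 * y) : ℕ) = c (2 * y') ∧ ∀ w ∈ W, f w ≠ y' :=
        ⟨y, rfl, fun w hw hfw => h ⟨w, hw, hfw⟩⟩
      have : h'.choose = y := by
        have := hci _ _ h'.choose_spec.1
        omega
      simp only [t, (hc (2 * y)).1, (hc (2 * y)).2, or_self, if_false, dif_pos h', this]
  · refine (Set.infinite_range_of_injective (f := fun k => (c (2 * k + 1) : ℕ)) fun k l h => ?_).mono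
      ?_
    · have := hci _ _ h; omega
    · rintro _ ⟨k, rfl⟩ ⟨y, hy⟩
      by_cases h : ∃ w ∈ W, f w = y
      · have h3 := (hbW y h).1
        rw [hy] at h3
        exact (hc (2 * k + 1)).1 h3
      · rw [hbc y h] at hy
        have := hci _ _ hy; omega

/-- The formula says that `a x` equals `s x`, where the variables of `s x` are renamed by `a ∘ b`. -/
theorem exists_guard (X : Finset ℕ) (a b : ℕ → ℕ) (s : Subst L 0) :
    ∃ γ : Formula L, (∀ v ∈ γ.fv, v ∈ Set.range a) ∧
      ∀ (W : Set ℕ) {m : ℕ} (Δ : ℕ → Msg L m) (P : Proc L m), Forces E γ W Δ P ↔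
        ∀ x ∈ X, EqE E (Δ (a x)) (ev (s x) fun y => Δ (a (b y))) := by
  obtain ⟨γ, h1, h2⟩ := exists_bigAnd (E := E) (Finset.finite_toSet X) fun x =>
    .eq (Term.var (.inl (a x))) (ev (s x) fun y => Term.var (.inl (a (b y))))
  refine ⟨γ, fun v hv => ?_, fun W m Δ P => ?_⟩
  · obtain ⟨x, -, hv⟩ := h1 v hv
    simp only [Formula.fv, Finset.mem_union, fv_var_inl, Finset.mem_singleton, mem_fv_ev] at hv
    rcases hv with rfl | ⟨y, -, rfl⟩
    · exact ⟨_, rfl⟩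
    · exact ⟨_, rfl⟩
  · rw [h2]
    simp only [Forces, ev_var, ev_ev, Finset.mem_coe]

/-- Replaces bound names by the variable `0`. -/
def ground (n m : ℕ) : Repl L n m :=
  Sum.elim (fun x => Term.var (.inl x)) (fun _ => Term.var (.inl 0))

theorem emb_ground {n m : ℕ} (M : Msg L 0) : (M.emb n).subst (ground n m) = M.emb m := by
  rw [emb_subst, emb_eq_ev]; rfl

theorem EqE.of_emb {n : ℕ} {M N : Msg L 0} (h : EqE E (M.emb n) (N.emb n)) : EqE E M N := by
  have := h.subst (ground n 0)
  rwa [emb_ground, emb_ground, emb_zero, emb_zero] at this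

theorem var_fs {m : ℕ} (y : ℕ) (t : Subst L 0) :
    (Term.var (.inl y) : Msg L m).subst (fs t m) = (t y).emb m := rfl

/-- A future `r` that satisfies the guard factors, up to the equational theory, as `t` followed by
`y ↦ r (b y)`. What is forced after `t` in the world `∅` persists along the second factor and
transfers to `r`. -/
theorem forces_guard_imp {X : Finset ℕ} {a b : ℕ → ℕ} {s t : Subst L 0} {γ Θ : Formula L}
    (hγ : ∀ (W : Set ℕ) {m : ℕ} (Δ : ℕ → Msg L m) (P : Proc L m), Forces E γ W Δ P ↔
        ∀ x ∈ X, EqE E (Δ (a x)) (ev (s x) fun y => Δ (a (b y))))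
    (hX : ∀ x ∈ X, t x = s x) (hb : ∀ y, t (b y) = Term.var (.inl y))
    {m : ℕ} {Δ : ℕ → Msg L m} {P : Proc L m} (ha : ∀ y, Δ (a y) = Term.var (.inl y))
    (hP : P.fv ⊆ X) (hΘ : ∀ v ∈ Θ.fv, ∀ x ∈ (Δ v).fv, x ∈ X ∨ x ∈ Set.range b)
    (h : Forces E Θ ∅ (fun x => (Δ x).subst (fs t m)) (P.repl (fs t m))) :
    Forces E (.imp γ Θ) ∅ Δ P := by
  classical
  intro W r hr hg
  rw [hγ] at hg
  simp only [ha, var_fs] at hg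
  let t' : Subst L 0 := fun y => r (b y)
  have h1 := h.adm (adm_empty hr.1 t')
  simp only [msg_fs_fs, proc_fs_fs] at h1
  -- The factorisation holds only for the relevant variables, whereas invariance needs it
  -- everywhere. Elsewhere `q` is taken to be `r`, which changes nothing because `P` and the
  -- assigned messages do not mention those variables.
  let q : Subst L 0 := fun x => if x ∈ X ∨ x ∈ Set.range b then sc t t' x else r x
  have hq : ∀ x, EqE E (q x) (r x) := by
    intro x
    by_cases hxX : x ∈ X
    · simp only [q, hxX, true_or, if_true]
      have := hg x hxX
      rw [sc, hX x hxX]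
      refine EqE.of_emb (n := m) ?_
      rw [emb_eq_ev (ev _ _), ev_ev]
      simp only [← emb_eq_ev]
      exact this.symm
    · by_cases hxb : x ∈ Set.range b
      · simp only [q, hxb, or_true, if_true]
        obtain ⟨y, rfl⟩ := hxb
        rw [sc, hb]; exact .refl _
      · simp only [q, hxX, hxb, or_self, if_false]; exact .refl _
  refine Forces.congr (s := q) hq ?_
  rw [proc_fs_congr P (s := q) (t := sc t t') fun x hx => by simp [q, hP hx]]
  refine h1.local fun v hv => ?_
  refine msg_fs_congr _ fun x hx => ?_
  simp only [q, hΘ v hv x hx, if_true]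

/-- The substitution `t` is itself a future in which the guard holds. -/
theorem not_forces_guard_imp {X : Finset ℕ} {a b : ℕ → ℕ} {s t : Subst L 0} {γ Θ : Formula L}
    (hγ : ∀ (W : Set ℕ) {m : ℕ} (Δ : ℕ → Msg L m) (P : Proc L m), Forces E γ W Δ P ↔
        ∀ x ∈ X, EqE E (Δ (a x)) (ev (s x) fun y => Δ (a (b y))))
    (hX : ∀ x ∈ X, t x = s x) (hb : ∀ y, t (b y) = Term.var (.inl y))
    {W W' : Set ℕ} (ht : Adm W W' t)
    {m : ℕ} {Δ : ℕ → Msg L m} {P : Proc L m} (ha : ∀ y, Δ (a y) = Term.var (.inl y))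
    (h : ¬ Forces E Θ W' (fun x => (Δ x).subst (fs t m)) (P.repl (fs t m))) :
    ¬ Forces E (.imp γ Θ) W Δ P := by
  intro H
  refine h (H W' t ht ?_)
  rw [hγ]
  intro x hx
  simp only [ha, var_fs, hX x hx, hb, emb_var, ← emb_eq_ev]
  exact .refl _

/-! ## Formulae for conditions -/

/-- The variables of a message are renamed by `a`, and the bound names are represented by the
variables `a (w i)`. -/
def hat (a w : ℕ → ℕ) {p : ℕ} (M : Msg L p) : Msg L 0 :=
  M.subst (Sum.elim (fun x => Term.var (.inl (a x))) (fun i => Term.var (.inl (a (w i)))))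

theorem fv_hat {a w : ℕ → ℕ} {p : ℕ} (M : Msg L p) {v : ℕ} (h : v ∈ (hat a w M).fv) :
    v ∈ Set.range a := by
  rcases mem_fv_subst M _ v h with ⟨x, -, hx⟩ | ⟨i, hi⟩
  · exact ⟨x, (Finset.mem_singleton.1 hx).symm⟩
  · exact ⟨w i, (Finset.mem_singleton.1 hi).symm⟩

theorem ev_hat {a w : ℕ → ℕ} {p m : ℕ} (M : Msg L p) {t : Subst L 0} {Δ : ℕ → Msg L m}
    (h : ∀ y, Δ (a y) = (t y).emb m) :
    ev (hat a w M) Δ = M.subst (Sum.elim (fun x => (t x).emb m) (fun i => (t (w i)).emb m)) := by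
  rw [ev, hat, subst_subst]
  congr 1; funext x
  rcases x with x | i
  · exact h x
  · exact h (w i)

theorem eqE_hat {a w : ℕ → ℕ} {p m : ℕ} {M N : Msg L p} {t : Subst L 0} {Δ : ℕ → Msg L m}
    (h : ∀ y, Δ (a y) = (t y).emb m) (he : EqE E (M.subst (fs t p)) (N.subst (fs t p))) :
    EqE E (ev (hat a w M) Δ) (ev (hat a w N) Δ) := by
  have key : ∀ M : Msg L p, (M.subst (fs t p)).subst (Sum.elim (fun x => Term.var (.inl x))
      (fun i => (t (w i)).emb m) : Repl L p m) = ev (hat a w M) Δ := by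
    intro M
    rw [ev_hat M h]
    refine subst_eq_of M fun x => ?_
    rcases x with x | i
    · simp only [fs_inl, emb_subst, Sum.elim_inl, ← emb_eq_ev]
    · simp
  rw [← key, ← key]; exact he.subst _

/-- Pairwise distinct variables that occur nowhere else behave like bound names: an equation between
them can be abstracted back into the larger scope. This is where private variables stand in for
bound names inside formulae. -/
theorem eqE_of_hat {a w : ℕ → ℕ} {p m : ℕ} {M N : Msg L p} {t : Subst L 0} {Δ : ℕ → Msg L m}
    (h : ∀ y, Δ (a y) = (t y).emb m) {g : ℕ → ℕ} (hg : ∀ i, t (w i) = Term.var (.inl (g i)))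
    (hgi : Function.Injective g) (hM : ∀ x ∈ M.fv, ∀ i, g i ∉ (t x).fv)
    (hN : ∀ x ∈ N.fv, ∀ i, g i ∉ (t x).fv)
    (he : EqE E (ev (hat a w M) Δ) (ev (hat a w N) Δ)) :
    EqE E (M.subst (fs t p)) (N.subst (fs t p)) := by
  classical
  let r : Repl L m p := Sum.elim (fun y => if h : ∃ i : Fin p, g i = y then Term.var (.inr h.choose)
    else Term.var (.inl y)) (fun _ => Term.var (.inl 0))
  have hr1 : ∀ i : Fin p, r (.inl (g i)) = Term.var (.inr i) := by
    intro i
    have h : ∃ j : Fin p, g j = g i := ⟨i, rfl⟩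
    have : h.choose = i := Fin.ext (hgi h.choose_spec)
    simp only [r, Sum.elim_inl, dif_pos h, this]
  have hr2 : ∀ y, (∀ i, g i ≠ y) → r (.inl y) = Term.var (.inl y) := by
    intro y hy
    simp only [r, Sum.elim_inl]
    rw [dif_neg]
    rintro ⟨i, hi⟩; exact hy i hi
  have key : ∀ M : Msg L p, (∀ x ∈ M.fv, ∀ i, g i ∉ (t x).fv) →
      (ev (hat a w M) Δ).subst r = M.subst (fs t p) := by
    intro M hM
    rw [ev_hat M h, subst_subst]
    refine subst_congr M (fun x hx => ?_) (fun i => ?_)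
    · simp only [Sum.elim_inl, fs_inl, emb_subst]
      rw [emb_eq_ev]
      exact ev_congr _ fun y hy => hr2 y fun i hi => hM x hx i (hi ▸ hy)
    · simp only [Sum.elim_inr, hg, emb_var, fs_inr, subst_var_apply, hr1]
  rw [← key M hM, ← key N hN]; exact he.subst _

theorem exists_reserve {W : Set ℕ} (hW : W.Infinite) (F : Finset ℕ) :
    ∃ w : ℕ → ℕ, Function.Injective w ∧ ∀ i, w i ∈ W ∧ w i ∉ F := by
  have h := hW.sdiff (Finset.finite_toSet F)
  let e := Set.Infinite.natEmbedding _ h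
  exact ⟨fun i => e i, fun i j hij => e.injective (Subtype.ext hij),
    fun i => ⟨(e i).2.1, fun hF => (e i).2.2 (Finset.mem_coe.2 hF)⟩⟩

/-- A formula that holds for the given state, and that implies the condition. -/
theorem exists_cond_guard {W : Set ℕ} (hW : W.Infinite) (a : ℕ → ℕ)
    {c : Cond L} (hc : c.Holds E W idS) :
    ∃ κ : Formula L, (∀ v ∈ κ.fv, v ∈ Set.range a) ∧
      (∀ {m : ℕ} (Δ : ℕ → Msg L m) (P : Proc L m), (∀ y, Δ (a y) = Term.var (.inl y)) →
        Forces E κ W Δ P) ∧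
      ∀ (W' : Set ℕ) (t : Subst L 0) {m : ℕ} (Δ : ℕ → Msg L m) (P : Proc L m), W'ᶜ.Infinite →
        (∀ y, Δ (a y) = (t y).emb m) → Forces E κ W' Δ P → c.Holds E W' t := by
  obtain ⟨p, pos, M, N⟩ := c
  cases pos with
  | true =>
    simp only [Cond.Holds, if_true, fs_ident, subst_var] at hc
    -- An equation that holds now holds under every substitution and needs no guard.
    exact ⟨.tt, by simp [Formula.fv], fun _ _ _ => trivial, fun W' t m Δ P _ _ _ => by
      simp only [Cond.Holds, if_true]; exact hc.subst _⟩
  | false =>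
    simp only [Cond.Holds, Bool.false_eq_true, if_false, fs_ident, subst_var] at hc
    obtain ⟨w, hwi, hw⟩ := exists_reserve hW (M.fv ∪ N.fv)
    have hwM : ∀ x ∈ M.fv, ∀ i, w i ≠ x := fun x hx i h =>
      (hw i).2 (h ▸ Finset.mem_union_left _ hx)
    have hwN : ∀ x ∈ N.fv, ∀ i, w i ≠ x := fun x hx i h =>
      (hw i).2 (h ▸ Finset.mem_union_right _ hx)
    -- Apartness is the intuitionistic negation of the equation, with bound names replaced by unused
    -- private variables `w i`. These stay distinct from everything else in all futures of `W`, so a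
    -- future solving the equation would be a forbidden unifier.
    refine ⟨.imp (.eq (hat a w M) (hat a w N)) .ff, ?_, ?_, ?_⟩
    · intro v hv
      simp only [Formula.fv, Finset.mem_union, Finset.notMem_empty, or_false] at hv
      exact hv.elim (fv_hat M) (fv_hat N)
    · intro m Δ P ha W' t ht he
      have ha' : ∀ y, (Δ (a y)).subst (fs t m) = (t y).emb m := fun y => by rw [ha]; rfl
      obtain ⟨-, f, hf, hfi, hfx⟩ := id ht
      have havoid : ∀ x, (∀ i, w i ≠ x) → ∀ i, f (w i) ∉ (t x).fv := by
        intro x hx i hmem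
        by_cases hxW : x ∈ W
        · rw [(hf x hxW).2] at hmem
          exact hx i (hfi (hw i).1 hxW (by simpa using hmem))
        · exact hfx x hxW _ (hw i).1 hmem
      exact hc W' t ht (eqE_of_hat (g := fun i => f (w i))
        (Δ := fun x => (Δ x).subst (fs t m)) ha' (fun i => (hf _ (hw i).1).2)
        (fun i j hij => hwi (hfi (hw i).1 (hw j).1 hij)) (fun x hx => havoid x (hwM x hx))
        (fun x hx => havoid x (hwN x hx)) he)
    · intro W' t m Δ P _ ha hκ
      simp only [Cond.Holds, Bool.false_eq_true, if_false]
      intro W'' r hr he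
      refine hκ W'' r hr ?_
      rw [msg_fs_fs, msg_fs_fs] at he
      refine eqE_hat (t := sc t r) (Δ := fun x => (Δ x).subst (fs r m)) (fun y => ?_) he
      rw [ha, emb_fs]; rfl

/-- A formula that fails for the given state, and that is implied by the condition. -/
theorem exists_cond_blocker {W : Set ℕ} (hW : W.Infinite) (hWc : Wᶜ.Infinite) (a : ℕ → ℕ)
    {c : Cond L} (hc : ¬ c.Holds E W idS) :
    ∃ χ : Formula L, (∀ v ∈ χ.fv, v ∈ Set.range a) ∧
      (∀ {m : ℕ} (Δ : ℕ → Msg L m) (P : Proc L m), (∀ y, Δ (a y) = Term.var (.inl y)) →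
        ¬ Forces E χ W Δ P) ∧
      ∀ (W' : Set ℕ) (t : Subst L 0) {m : ℕ} (Δ : ℕ → Msg L m) (P : Proc L m),
        (∀ y, Δ (a y) = (t y).emb m) → c.Holds E W' t → Forces E χ W' Δ P := by
  obtain ⟨p, pos, M, N⟩ := c
  cases pos with
  | true =>
    simp only [Cond.Holds, if_true] at hc
    obtain ⟨w, hwi, hw⟩ := exists_reserve hW (M.fv ∪ N.fv)
    -- The equation itself serves. It fails now because unused private variables are as generic as
    -- the bound names that they replace.
    refine ⟨.eq (hat a w M) (hat a w N), ?_, ?_, ?_⟩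
    · intro v hv
      simp only [Formula.fv, Finset.mem_union] at hv
      exact hv.elim (fv_hat M) (fv_hat N)
    · intro m Δ P ha he
      refine hc (eqE_of_hat (w := w) (g := w) (Δ := Δ) ha (fun i => rfl) hwi (fun x hx i h => ?_)
        (fun x hx i h => ?_) he)
      · exact (hw i).2 (Finset.mem_union_left _ (by simp at h; rwa [h]))
      · exact (hw i).2 (Finset.mem_union_right _ (by simp at h; rwa [h]))
    · intro W' t m Δ P ha he
      simp only [Cond.Holds, if_true] at he
      exact eqE_hat ha he
  | false =>
    simp only [Cond.Holds, Bool.false_eq_true, if_false, fs_ident, subst_var, Apart] at hc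
    push Not at hc
    obtain ⟨W', s, hs, he⟩ := hc
    obtain ⟨t, b, ht, hX, hb, -⟩ := exists_world hs hWc (M.fv ∪ N.fv)
    obtain ⟨γ, hγv, hγ⟩ := exists_guard (E := E) (M.fv ∪ N.fv) a b s
    -- Failure of apartness is witnessed by an admissible unifier `s`. The formula excludes this one
    -- unifier; it fails now since `s` can be reached, and apartness implies it since every future
    -- satisfying `γ` is an instance of `s` on these variables, hence a unifier.
    refine ⟨.imp γ .ff, ?_, ?_, ?_⟩
    · intro v hv
      simp only [Formula.fv, Finset.mem_union, Finset.notMem_empty, or_false] at hv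
      exact hγv v hv
    · intro m Δ P ha
      exact not_forces_guard_imp hγ hX hb ht ha (fun h => h)
    · intro W₁ q m Δ P ha hap
      simp only [Cond.Holds, Bool.false_eq_true, if_false] at hap
      intro W₂ r hr hg
      rw [hγ] at hg
      refine hap W₂ r hr ?_
      have h1 := he.subst (fs (fun y => sc q r (b y)) p)
      rw [msg_fs_fs, msg_fs_fs] at h1 ⊢
      have key : ∀ x ∈ M.fv ∪ N.fv, EqE E (sc q r x) (sc s (fun y => sc q r (b y)) x) := by
        intro x hx
        have := hg x hx
        simp only [ha, emb_fs] at this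
        refine EqE.of_emb (n := m) ?_
        refine this.trans (EqE.of_eq _ ?_)
        rw [emb_eq_ev (sc s _ x), sc, ev_ev]
        simp only [← emb_eq_ev]; rfl
      have hM : EqE E (M.subst (fs (sc q r) p)) (M.subst (fs (sc s fun y => sc q r (b y)) p)) :=
        EqE.subst_congr M (fun x hx => (key x (Finset.mem_union_left _ hx)).emb) (fun i => .refl _)
      have hN : EqE E (N.subst (fs (sc q r) p)) (N.subst (fs (sc s fun y => sc q r (b y)) p)) :=
        EqE.subst_congr N (fun x hx => (key x (Finset.mem_union_right _ hx)).emb) (fun i => .refl _)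
      exact hM.trans (h1.trans hN.symm)

/-! ## Distinguishing formulae for one transition -/

theorem Forces.mp {φ ψ : Formula L} {W : Set ℕ} (hW : Wᶜ.Infinite) {m : ℕ} {Δ : ℕ → Msg L m}
    {P : Proc L m} (h : Forces E (.imp φ ψ) W Δ P) (h' : Forces E φ W Δ P) : Forces E ψ W Δ P := by
  have := h W idS (adm_ident hW subset_rfl)
  simp only [fs_ident, subst_var, repl_var] at this
  exact this h'

/-- The action is written in terms of other variables, and its bound variable is renamed. -/
def Label.inst (lk : ℕ → Msg L 0) (y : ℕ) : Label L 0 → Label L 0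
  | .tau => .tau
  | .out M _ => .out (ev M lk) y
  | .inp M N => .inp (ev M lk) (ev N lk)

theorem Label.kind_inst {lk : ℕ → Msg L 0} {m : ℕ} {Δ Δ₁ : ℕ → Msg L m}
    (h : ∀ x, Δ x = ev (lk x) Δ₁) (π : Label L 0) (y : ℕ) :
    (π.inst lk y).kind Δ₁ = π.kind Δ := by
  obtain rfl : Δ = fun x => ev (lk x) Δ₁ := funext h
  cases π <;> simp [Label.inst, Label.kind, ev_ev]

theorem Label.chan_inst {lk : ℕ → Msg L 0} {m : ℕ} {Δ Δ₁ : ℕ → Msg L m}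
    (h : ∀ x, Δ x = ev (lk x) Δ₁) (π : Label L 0) (y : ℕ) :
    (π.inst lk y).chan Δ₁ = π.chan Δ := by
  obtain rfl : Δ = fun x => ev (lk x) Δ₁ := funext h
  cases π <;> simp [Label.inst, Label.chan, ev_ev]

theorem Label.fv_inst {lk : ℕ → Msg L 0} {π : Label L 0} {y v : ℕ} (h : v ∈ (π.inst lk y).fv) :
    ∃ x ∈ π.fv, v ∈ (lk x).fv := by
  cases π with
  | tau => simp [Label.inst, Label.fv] at h
  | out M x => simpa only [Label.inst, Label.fv, mem_fv_ev] using h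
  | inp M N =>
    simp only [Label.inst, Label.fv, mem_fv_ev, Finset.mem_union] at h
    rcases h with ⟨x, h, hx⟩ | ⟨x, h, hx⟩
    · exact ⟨x, Finset.mem_union_left _ h, hx⟩
    · exact ⟨x, Finset.mem_union_right _ h, hx⟩

theorem nextA_of_notMem {W : Set ℕ} {m : ℕ} {π : Label L 0} {Δ Δ' : ℕ → Msg L m} {P : Proc L m}
    {C : Msg L m} {R : Agent L m} (hR : CStep E W P (π.kind Δ') C R) {x : ℕ} (hx : x ∉ π.bn) :
    nextA Δ π.bv R x = (Δ x).subst (rn R.ren) := by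
  have := hR.msg_isSome
  cases hN : R.msg with
  | none => simp only [nextA, hN]
  | some N =>
    simp only [nextA, hN]
    cases π with
    | out M y => exact Function.update_of_ne (by simpa [Label.bn, Label.bv] using hx) _ _
    | _ => exact absurd (this.2 ⟨N, hN⟩) (by simp [Label.kind])

theorem nextA_of_mem {W : Set ℕ} {m : ℕ} {π : Label L 0} {Δ Δ' : ℕ → Msg L m} {P : Proc L m}
    {C : Msg L m} {R : Agent L m} (hR : CStep E W P (π.kind Δ') C R) {x : ℕ} (hx : x ∈ π.bn) :
    R.msg = some (nextA Δ π.bv R x) := by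
  have := hR.msg_isSome
  cases π with
  | out M y =>
    obtain rfl : x = y := hx
    obtain ⟨N, hN⟩ := this.1 rfl
    simp only [nextA, hN, Label.bv, Function.update_self]
  | _ => exact absurd hx (by simp [Label.bn])

/-- The left state moves to `R`, and each of the finitely many answers on the right is refuted by
some formula; the diamond of their conjunction does the rest. In the world `∅` the conditions of the
left move might fail for lack of private variables, so the diamond is protected by `κ`, which
implies these conditions and holds on the right because they hold in `W`. -/
theorem exists_dia {W : Set ℕ} (hW : W.Infinite) (hWc : Wᶜ.Infinite) {a : ℕ → ℕ}
    {lk : ℕ → Msg L 0} {m m' : ℕ} {Δ Δ₁ : ℕ → Msg L m} {Δ' Δ₁' : ℕ → Msg L m'}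
    {P : Proc L m} {Q : Proc L m'}
    (ha : ∀ y, Δ₁ (a y) = Term.var (.inl y)) (ha' : ∀ y, Δ₁' (a y) = Term.var (.inl y))
    (hlk : ∀ x, Δ x = ev (lk x) Δ₁) (hlk' : ∀ x, Δ' x = ev (lk x) Δ₁')
    (π : Label L 0) (y : ℕ) (V : Set ℕ) {R : Agent L m}
    (hR : CStep E W P (π.kind Δ) (π.chan Δ) R)
    (ih : ∀ R', CStep E W Q (π.kind Δ') (π.chan Δ') R' → ∃ φ : Formula L, (∀ v ∈ φ.fv, v ∈ V) ∧
      Forces E φ ∅ (nextA Δ₁ (π.inst lk y).bv R) R.proc ∧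
      ¬ Forces E φ W (nextA Δ₁' (π.inst lk y).bv R') R'.proc) :
    ∃ Θ : Formula L, (∀ v ∈ Θ.fv, v ∈ Set.range a ∨ (∃ x, v ∈ (lk x).fv) ∨
      v ∈ V ∧ v ∉ (π.inst lk y).bn) ∧ Forces E Θ ∅ Δ₁ P ∧ ¬ Forces E Θ W Δ₁' Q := by
  have : Inhabited (Formula L) := ⟨.tt⟩
  choose! g hgv hgA hgB using ih
  obtain ⟨Φ, hΦv, hΦ⟩ := exists_bigAnd (E := E)
    (finite_steps (E := E) W Q (π.kind Δ') (π.chan Δ')) g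
  obtain ⟨T, -, hTs⟩ := symAt (E := E) P (π.kind Δ)
  obtain ⟨p, hp, hc, he, rfl⟩ := (hTs.self W _ _).1 hR
  choose! k hkv hkB hkA using fun c (hcm : c ∈ p.conds) =>
    exists_cond_guard hW a (hc c hcm)
  obtain ⟨κ, hκv, hκ⟩ := exists_bigAnd (E := E) (List.finite_toSet p.conds) k
  have hkind := Label.kind_inst hlk π y
  have hchan := Label.chan_inst hlk π y
  refine ⟨.imp κ (.dia (π.inst lk y) Φ), ?_, ?_, ?_⟩
  · intro v hv
    rcases Finset.mem_union.1 hv with hv | hv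
    · obtain ⟨c, hcm, hv⟩ := hκv v hv
      exact .inl (hkv c hcm v hv)
    · rcases mem_fv_dia.1 hv with hv | ⟨hv, hb⟩
      · exact .inr (.inl ((Label.fv_inst hv).imp fun _ h => h.2))
      · obtain ⟨R', hR', hv⟩ := hΦv v hv
        exact .inr (.inr ⟨hgv R' hR' v hv, hb⟩)
  · intro W' t ht hk
    rw [hκ] at hk
    refine ⟨p.res.fs t, ?_, ?_⟩
    · rw [Label.kind_fs, hkind]
      refine (hTs W' t _ _).2 ⟨p, hp, fun c hcm => ?_, fun hτ => ?_, rfl⟩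
      · exact hkA c hcm W' t _ _ ht.1 (fun y => by rw [ha]; rfl) (hk c hcm)
      · rw [Label.chan_fs, hchan]
        · exact (he hτ).subst _
        · rw [← hkind, Ne, Label.kind_tau_iff] at hτ; exact hτ
    · rw [nextA_fs]
      -- The conjuncts are forced at the symbolic residual in the world `∅` and persist to its
      -- instance.
      refine Forces.adm ?_ (adm_empty ht.1 t)
      exact (hΦ _ _ _).2 fun R' hR' => hgA R' hR'
  · intro H
    obtain ⟨R', hR', h⟩ := H.mp hWc ((hκ _ _ _).2 fun c hcm => hkB c hcm _ _ ha')
    rw [Label.kind_inst hlk', Label.chan_inst hlk'] at hR'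
    exact hgB R' hR' ((hΦ _ _ _).1 h R' hR')

/-- The right state moves to `R'`. A box ranges over the moves of the left state in all futures, but
these are instances of finitely many symbolic moves. One disjunct for each is enough, provided that
it fails at `R'` and holds whenever the move is enabled. -/
theorem exists_box {W : Set ℕ} (hW : W.Infinite) (hWc : Wᶜ.Infinite) {a : ℕ → ℕ}
    {lk : ℕ → Msg L 0} {m m' : ℕ} {Δ Δ₁ : ℕ → Msg L m} {Δ' Δ₁' : ℕ → Msg L m'}
    {P : Proc L m} {Q : Proc L m'}
    (ha : ∀ y, Δ₁ (a y) = Term.var (.inl y)) (ha' : ∀ y, Δ₁' (a y) = Term.var (.inl y))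
    (hlk : ∀ x, Δ x = ev (lk x) Δ₁) (hlk' : ∀ x, Δ' x = ev (lk x) Δ₁')
    (π : Label L 0) {y : ℕ} (hy : y ∉ Set.range a) (V : Set ℕ) {R' : Agent L m'}
    (hR' : CStep E W Q (π.kind Δ') (π.chan Δ') R')
    (ih : ∀ R, CStep E W P (π.kind Δ) (π.chan Δ) R → ∃ φ : Formula L, (∀ v ∈ φ.fv, v ∈ V) ∧
      Forces E φ ∅ (nextA Δ₁ (π.inst lk y).bv R) R.proc ∧
      ¬ Forces E φ W (nextA Δ₁' (π.inst lk y).bv R') R'.proc) :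
    ∃ Θ : Formula L, (∀ v ∈ Θ.fv, v ∈ Set.range a ∨ (∃ x, v ∈ (lk x).fv) ∨
      v ∈ V ∧ v ∉ (π.inst lk y).bn) ∧ Forces E Θ ∅ Δ₁ P ∧ ¬ Forces E Θ W Δ₁' Q := by
  have : Inhabited (Formula L) := ⟨.tt⟩
  obtain ⟨T, hT, hTs⟩ := symAt (E := E) P (π.kind Δ)
  have hkind := Label.kind_inst hlk π y
  have hchan := Label.chan_inst hlk π y
  have hbn : ∀ x, a x ∉ (π.inst lk y).bn := by
    intro x hx
    cases π with
    | out M z =>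
      simp only [Label.inst, Label.bn, Set.mem_singleton_iff] at hx
      exact hy ⟨x, hx⟩
    | _ => simp [Label.inst, Label.bn] at hx
  have hR'' : CStep E W Q ((π.inst lk y).kind Δ₁') (π.chan Δ') R' := by
    rwa [Label.kind_inst hlk']
  have hnext' : ∀ x, nextA Δ₁' (π.inst lk y).bv R' (a x) = Term.var (.inl x) := by
    intro x
    rw [nextA_of_notMem hR'' (hbn x), ha']; rfl
  have hnext : ∀ (p : Sym L m) (W' : Set ℕ) (t : Subst L 0) (C : Msg L m),
      CStep E W' (P.repl (fs t m)) ((π.kind Δ).repl (fs t m)) C (p.res.fs t) → ∀ x,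
      nextA (fun x => (Δ₁ x).subst (fs t m)) (π.inst lk y).bv (p.res.fs t) (a x) =
        (t x).emb p.res.scope := by
    intro p W' t C h x
    rw [← hkind, ← Label.kind_fs] at h
    rw [nextA_of_notMem h (hbn x), ha, var_fs, emb_subst, emb_eq_ev]; rfl
  have main : ∀ p ∈ T, ∃ ψ : Formula L, (∀ v ∈ ψ.fv, v ∈ Set.range a ∨ v ∈ V) ∧
      (∀ (W' : Set ℕ) (t : Subst L 0) (C : Msg L m), W'ᶜ.Infinite → (∀ c ∈ p.conds, c.Holds E W' t) →
        (π ≠ .tau → EqE E (p.chan.subst (fs t m)) ((π.chan Δ).subst (fs t m))) →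
        CStep E W' (P.repl (fs t m)) ((π.kind Δ).repl (fs t m)) C (p.res.fs t) →
        Forces E ψ W' (nextA (fun x => (Δ₁ x).subst (fs t m)) (π.inst lk y).bv (p.res.fs t))
          (p.res.fs t).proc) ∧
      ¬ Forces E ψ W (nextA Δ₁' (π.inst lk y).bv R') R'.proc := by
    intro p hp
    -- A move disabled by a condition `c` now is covered by the blocker of `c`, which holds in every
    -- future that enables the move. It mentions only variables in the range of `a`, whose values
    -- the transition does not change.
    have fail : ∀ c : Cond L, ¬ c.Holds E W idS → ∃ ψ : Formula L, (∀ v ∈ ψ.fv, v ∈ Set.range a) ∧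
        (∀ (W' : Set ℕ) (t : Subst L 0) (C : Msg L m), c.Holds E W' t →
          CStep E W' (P.repl (fs t m)) ((π.kind Δ).repl (fs t m)) C (p.res.fs t) →
          Forces E ψ W' (nextA (fun x => (Δ₁ x).subst (fs t m)) (π.inst lk y).bv (p.res.fs t))
            (p.res.fs t).proc) ∧
        ¬ Forces E ψ W (nextA Δ₁' (π.inst lk y).bv R') R'.proc := by
      intro c hc
      obtain ⟨χ, hχv, hχB, hχA⟩ := exists_cond_blocker hW hWc a hc
      exact ⟨χ, hχv, fun W' t C h h' => hχA W' t _ _ (hnext p W' t C h') h, hχB _ _ hnext'⟩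
    -- If the move is enabled now, the induction hypothesis supplies the disjunct. Otherwise a
    -- condition or the equality of channels fails and is blocked.
    by_cases hc : ∀ c ∈ p.conds, c.Holds E W idS
    · by_cases he : π ≠ .tau → EqE E p.chan (π.chan Δ)
      · have hR := (hTs.self W (π.chan Δ) p.res).2
          ⟨p, hp, hc, by rwa [Ne, Label.kind_tau_iff], rfl⟩
        obtain ⟨ψ, hv, hA, hB⟩ := ih _ hR
        refine ⟨ψ, fun v h => .inr (hv v h), fun W' t C hW' _ _ _ => ?_, hB⟩
        rw [nextA_fs]
        exact hA.adm (adm_empty hW' t)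
      · push Not at he
        obtain ⟨ψ, hv, hA, hB⟩ := fail ⟨m, true, p.chan, π.chan Δ⟩
          (by simpa [Cond.Holds, fs_ident, subst_var] using he.2)
        exact ⟨ψ, fun v h => .inl (hv v h),
          fun W' t C _ _ he' h => hA W' t C (by simpa [Cond.Holds] using he' he.1) h, hB⟩
    · push Not at hc
      obtain ⟨c, hcm, hc⟩ := hc
      obtain ⟨ψ, hv, hA, hB⟩ := fail c hc
      exact ⟨ψ, fun v h => .inl (hv v h), fun W' t C _ hc' _ h => hA W' t C (hc' c hcm) h, hB⟩
  choose! g hgv hgA hgB using main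
  obtain ⟨Φ, hΦv, hΦ⟩ := exists_bigOr (E := E) hT g
  refine ⟨.box (π.inst lk y) Φ, ?_, ?_, ?_⟩
  · intro v hv
    rcases mem_fv_box.1 hv with hv | ⟨hv, hb⟩
    · exact .inr (.inl ((Label.fv_inst hv).imp fun _ h => h.2))
    · obtain ⟨p, hp, hv⟩ := hΦv v hv
      exact (hgv p hp v hv).imp id fun h => .inr ⟨h, hb⟩
  · intro W' t R ht hR
    rw [Label.kind_fs, hkind] at hR
    obtain ⟨p, hp, hc, he, rfl⟩ := (hTs W' t _ _).1 hR
    rw [hΦ]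
    refine ⟨p, hp, hgA p hp W' t _ ht.1 hc (fun hτ => ?_) hR⟩
    have := he (by rwa [Ne, Label.kind_tau_iff])
    rwa [Label.chan_fs, hchan] at this
    cases π <;> simp_all [Label.inst]
  · intro H
    have := H W idS R' (adm_ident hWc subset_rfl)
    simp only [fs_ident, subst_var, repl_var] at this
    rw [Label.kind_inst hlk', Label.chan_inst hlk', hΦ] at this
    obtain ⟨p, hp, h⟩ := this hR'
    exact hgB p hp h

/-! ## The bisimulation game -/

/-- A process, with an assignment of messages to the variables of its observer. -/
structure State (L : FirstOrder.Language.{u, v}) : Type u where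
  scope : ℕ
  asg : ℕ → Msg L scope
  proc : Proc L scope

open Classical in
/-- The assignment after a substitution `s` and the introduction of the aliases `e` for the variables
of `D'` outside `D`. -/
def futA {m : ℕ} (D D' : Set ℕ) (s e : Subst L 0) (Δ : ℕ → Msg L m) : ℕ → Msg L m := fun x =>
  if x ∈ D then (Δ x).subst (fs s m) else if x ∈ D' then (e x).emb m else Term.var (.inl x)

namespace State

/-- The state after a substitution and the introduction of aliases. -/
def fut (D D' : Set ℕ) (s e : Subst L 0) (A : State L) : State L :=
  ⟨A.scope, futA D D' s e A.asg, A.proc.repl (fs s _)⟩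

/-- The state after a transition. -/
def next (A : State L) (y : ℕ) (R : Agent L A.scope) : State L :=
  ⟨R.scope, nextA A.asg y R, R.proc⟩

variable (E) in
/-- The transitions of a state. -/
def Steps (W : Set ℕ) (A : State L) (π : Label L 0) (R : Agent L A.scope) : Prop :=
  CStep E W A.proc (π.kind A.asg) (π.chan A.asg) R

variable (E) in
/-- Static equivalence of states. -/
def Static (A B : State L) : Prop :=
  ∀ M N : Msg L 0, EqE E (ev M A.asg) (ev N A.asg) ↔ EqE E (ev M B.asg) (ev N B.asg)

variable (E) in
/-- The transitions of `A` are matched by `B`, up to `X`. -/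
def Matched (X : Set ℕ → Set ℕ → State L → State L → Prop) (D W : Set ℕ) (A B : State L) : Prop :=
  ∀ (π : Label L 0) (R : Agent L A.scope), Disjoint π.bn D → A.Steps E W π R →
    ∃ R', B.Steps E W π R' ∧ X (D ∪ π.bn) W (A.next π.bv R) (B.next π.bv R')

end State

variable (E) in
/-- The approximants of bisimilarity of states, where `D` are the aliases in use and `W` are the
private variables. -/
def Apx : ℕ → Set ℕ → Set ℕ → State L → State L → Prop
  | 0, _, _, _, _ => True
  | j + 1, D, W, A, B => ∀ (s e : Subst L 0) (W' D' : Set ℕ), Adm W W' s → D ⊆ D' → D'.Finite →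
      State.Static E (A.fut D D' s e) (B.fut D D' s e) ∧
      State.Matched E (Apx j) D' W' (A.fut D D' s e) (B.fut D D' s e) ∧
      State.Matched E (fun D W B A => Apx j D W A B) D' W' (B.fut D D' s e) (A.fut D D' s e)

theorem Apx.symm {j : ℕ} {D W : Set ℕ} {A B : State L} (h : Apx E j D W A B) :
    Apx E j D W B A := by
  induction j generalizing D W A B with
  | zero => trivial
  | succ j ih =>
    intro s e W' D' hs hD hD'
    obtain ⟨h1, h2, h3⟩ := h s e W' D' hs hD hD'
    refine ⟨fun M N => (h1 M N).symm, fun π R hπ hR => ?_, fun π R hπ hR => ?_⟩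
    · obtain ⟨R', hR', h⟩ := h3 π R hπ hR
      exact ⟨R', hR', ih h⟩
    · obtain ⟨R', hR', h⟩ := h2 π R hπ hR
      exact ⟨R', hR', ih h⟩

theorem Apx.of_succ {j : ℕ} {D W : Set ℕ} {A B : State L} (h : Apx E (j + 1) D W A B) :
    Apx E j D W A B := by
  induction j generalizing D W A B with
  | zero => trivial
  | succ j ih =>
    intro s e W' D' hs hD hD'
    obtain ⟨h1, h2, h3⟩ := h s e W' D' hs hD hD'
    refine ⟨h1, fun π R hπ hR => ?_, fun π R hπ hR => ?_⟩
    · obtain ⟨R', hR', h⟩ := h2 π R hπ hR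
      exact ⟨R', hR', ih h⟩
    · obtain ⟨R', hR', h⟩ := h3 π R hπ hR
      exact ⟨R', hR', ih h⟩

theorem Apx.of_le {j k : ℕ} (hjk : j ≤ k) {D W : Set ℕ} {A B : State L} (h : Apx E k D W A B) :
    Apx E j D W A B := by
  induction hjk with
  | refl => exact h
  | step _ ih => exact ih h.of_succ

theorem State.fut_fut {D D' D'' : Set ℕ} (hD : D ⊆ D') (hD' : D' ⊆ D'') (s e s' e' : Subst L 0) :
    ∃ e'', ∀ A : State L,
      (A.fut D D' s e).fut D' D'' s' e' = A.fut D D'' (sc s s') e'' := by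
  classical
  refine ⟨fun x => if x ∈ D' then ev (e x) s' else e' x, fun A => ?_⟩
  simp only [fut, proc_fs_fs, State.mk.injEq, heq_eq_eq, true_and, and_true]
  funext x
  unfold futA
  by_cases h : x ∈ D
  · simp only [h, hD h, if_true, msg_fs_fs]
  · by_cases h' : x ∈ D'
    · simp only [h, h', hD' h', if_true, if_false, emb_fs]
    · simp only [h, h', if_false]

theorem Apx.fut {j : ℕ} {D W D' W' : Set ℕ} {A B : State L} (h : Apx E j D W A B)
    {s : Subst L 0} (e : Subst L 0) (hs : Adm W W' s) (hD : D ⊆ D') :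
    Apx E j D' W' (A.fut D D' s e) (B.fut D D' s e) := by
  cases j with
  | zero => trivial
  | succ j =>
    intro s' e' W'' D'' hs' hD' hD''
    obtain ⟨e'', he⟩ := State.fut_fut hD hD' s e s' e'
    rw [he, he]
    exact h _ _ _ _ (hs.comp hs') (hD.trans hD') hD''

variable (E) in
/-- Bisimilarity of states. -/
def Bis (D W : Set ℕ) (A B : State L) : Prop := ∀ j, Apx E j D W A B

theorem Bis.symm {D W : Set ℕ} {A B : State L} (h : Bis E D W A B) : Bis E D W B A :=
  fun j => (h j).symm

theorem Bis.fut {D W D' W' : Set ℕ} {A B : State L} (h : Bis E D W A B)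
    {s : Subst L 0} (e : Subst L 0) (hs : Adm W W' s) (hD : D ⊆ D') :
    Bis E D' W' (A.fut D D' s e) (B.fut D D' s e) := fun j => (h j).fut e hs hD

/-- The variables other than the aliases are assigned themselves. -/
def State.Plain (D : Set ℕ) (A : State L) : Prop := ∀ x, x ∉ D → A.asg x = Term.var (.inl x)

theorem State.Plain.fut_self {D : Set ℕ} {A : State L} (h : A.Plain D) (e : Subst L 0) :
    A.fut D D idS e = A := by
  obtain ⟨m, Δ, P⟩ := A
  simp only [fut, fs_ident, repl_var, State.mk.injEq, heq_eq_eq, true_and, and_true]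
  funext x
  by_cases hx : x ∈ D
  · simp only [futA, hx, if_true, fs_ident, subst_var]
  · simp only [futA, hx, if_false]; exact (h x hx).symm

theorem Bis.static {D W : Set ℕ} (hD : D.Finite) (hW : Wᶜ.Infinite) {A B : State L}
    (hA : A.Plain D) (hB : B.Plain D) (h : Bis E D W A B) : A.Static E B := by
  have := (h 1 idS idS W D (adm_ident hW subset_rfl) subset_rfl hD).1
  rwa [hA.fut_self, hB.fut_self] at this

/-- By image finiteness, a single answer survives at all levels: otherwise each of the finitely many
answers fails at some level, and all fail at a common bound, as the approximants decrease. -/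
theorem Bis.matched {D W : Set ℕ} (hD : D.Finite) (hW : Wᶜ.Infinite) {A B : State L}
    (hA : A.Plain D) (hB : B.Plain D) (h : Bis E D W A B) :
    State.Matched E (Bis E) D W A B := by
  intro π R hπ hR
  have h1 : ∀ j, ∃ R', B.Steps E W π R' ∧
      Apx E j (D ∪ π.bn) W (A.next π.bv R) (B.next π.bv R') := by
    intro j
    have := (h (j + 1) idS idS W D (adm_ident hW subset_rfl) subset_rfl hD).2.1
    rw [hA.fut_self, hB.fut_self] at this
    exact this π R hπ hR
  by_contra hn
  push Not at hn
  have h2 : ∀ R', B.Steps E W π R' →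
      ∃ j, ¬ Apx E j (D ∪ π.bn) W (A.next π.bv R) (B.next π.bv R') := fun R' hR' => by
    simpa [Bis] using hn R' hR'
  choose! g hg using h2
  obtain ⟨N, hN⟩ := ((finite_steps (E := E) W B.proc (π.kind B.asg) (π.chan B.asg)).image g).bddAbove
  obtain ⟨R', hR', h⟩ := h1 N
  exact hg R' hR' (h.of_le (hN ⟨R', hR', rfl⟩))

/-! ## Distinguishing formulae -/

theorem Adm.infinite {W W' : Set ℕ} {s : Subst L 0} (h : Adm W W' s) (hW : W.Infinite) :
    W'.Infinite := by
  obtain ⟨-, f, hf, hfi, -⟩ := h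
  refine (hW.image hfi).mono ?_
  rintro _ ⟨w, hw, rfl⟩
  exact (hf w hw).1

theorem Label.mem_bn_inst {π : Label L 0} {lk : ℕ → Msg L 0} {x y : ℕ} (h : x ∈ π.bn) :
    y ∈ (π.inst lk y).bn := by
  cases π <;> simp_all [Label.inst, Label.bn]

theorem Label.eq_of_mem_bn_inst {π : Label L 0} {lk : ℕ → Msg L 0} {x y : ℕ}
    (h : x ∈ (π.inst lk y).bn) : x = y := by
  cases π with
  | out M z => exact h
  | _ => exact absurd h (by simp [Label.inst, Label.bn])

-- The invariants of the construction survive a transition. Formula variables still denote the free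
-- variables, and aliases are still expressed through the formula assignment, a new alias being the
-- bound variable `y` of the modality.
open Classical in
theorem nextA_inst {W D : Set ℕ} {c : ℕ → ℕ} {lk : ℕ → Msg L 0} {y : ℕ} (hyc : y ∉ Set.range c)
    (hyD : ∀ x ∈ D, y ∉ (lk x).fv) {m : ℕ} {P : Proc L m} {Δ Δ₁ : ℕ → Msg L m} {π : Label L 0}
    {R : Agent L m} (hΔ : ∀ x, Δ x = ev (lk x) Δ₁)
    (hR : CStep E W P (π.kind Δ) (π.chan Δ) R) :
    (∀ x ∈ D ∪ π.bn, nextA Δ π.bv R x = ev (if x ∈ π.bn then Term.var (.inl y) else lk x)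
      (nextA Δ₁ (π.inst lk y).bv R)) ∧
    ((∀ y, Δ₁ (c y) = Term.var (.inl y)) →
      ∀ z, nextA Δ₁ (π.inst lk y).bv R (c z) = Term.var (.inl z)) := by
  have hR' : CStep E W P ((π.inst lk y).kind Δ₁) (π.chan Δ) R := by
    rwa [Label.kind_inst hΔ]
  refine ⟨fun x hx => ?_, fun hΔ₁ z => ?_⟩
  · by_cases hxb : x ∈ π.bn
    · have h1 := nextA_of_mem (Δ := Δ) hR hxb
      have h2 := nextA_of_mem (Δ := Δ₁) hR' (Label.mem_bn_inst hxb)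
      rw [if_pos hxb, ev_var]
      exact Option.some.inj (h1.symm.trans h2)
    · rw [nextA_of_notMem hR hxb, hΔ, if_neg hxb, ev_subst]
      refine ev_congr _ fun v hv => ?_
      rw [nextA_of_notMem hR']
      intro hvb
      exact hyD x (hx.resolve_right hxb) (Label.eq_of_mem_bn_inst hvb ▸ hv)
  · rw [nextA_of_notMem hR' fun hv => hyc ⟨z, Label.eq_of_mem_bn_inst hv⟩, hΔ₁]; rfl

/-- The assignments `Δ₁` and `Δ₁'` interpret the variables of the formula. The variable `a y`
denotes the free variable `y`, and `α x` is an expression for the alias `x` that is valid on both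
sides. In each round `a` becomes `a ∘ b`, since the variables of the later world are named by
present variables. The set `W` must be infinite to represent bound names, and its complement
infinite to name later worlds. -/
theorem exists_distinguishing {j : ℕ} {D W : Set ℕ} (hD : D.Finite) (hW : W.Infinite)
    (hWc : Wᶜ.Infinite) {A B : State L} (h : ¬ Apx E j D W A B) {a : ℕ → ℕ}
    (hai : Function.Injective a) {α : ℕ → Msg L 0} {Δ₁ : ℕ → Msg L A.scope}
    {Δ₁' : ℕ → Msg L B.scope} (ha : ∀ y, Δ₁ (a y) = Term.var (.inl y))
    (ha' : ∀ y, Δ₁' (a y) = Term.var (.inl y)) (hα : ∀ x ∈ D, A.asg x = ev (α x) Δ₁)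
    (hα' : ∀ x ∈ D, B.asg x = ev (α x) Δ₁') :
    ∃ φ : Formula L, (∀ v ∈ φ.fv, v ∈ Set.range a ∨ ∃ x ∈ D, v ∈ (α x).fv) ∧
      Forces E φ ∅ Δ₁ A.proc ∧ ¬ Forces E φ W Δ₁' B.proc := by
  classical
  induction j generalizing D W A B a α with
  | zero => exact absurd trivial h
  | succ j ih =>
    simp only [Apx, not_forall] at h
    obtain ⟨s, e, W', D', hs, hDD, hD', h⟩ := h
    -- All variables on which the substitution of this round can have a visible effect; outside this
    -- set `s` may be replaced by the invertible variant `t`.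
    let X : Finset ℕ := A.proc.fv ∪ B.proc.fv ∪ hD.toFinset.biUnion fun x =>
      (A.asg x).fv ∪ (B.asg x).fv ∪ (α x).fv.biUnion fun v => (Δ₁ v).fv
    have hXA : A.proc.fv ⊆ X := fun x hx => by simp [X, hx]
    have hXB : B.proc.fv ⊆ X := fun x hx => by simp [X, hx]
    have hXA' : ∀ x ∈ D, (A.asg x).fv ⊆ X := fun x hx y hy => by
      simp only [X, Finset.mem_union, Finset.mem_biUnion, Set.Finite.mem_toFinset]
      exact .inr ⟨x, hx, .inl (.inl hy)⟩
    have hXB' : ∀ x ∈ D, (B.asg x).fv ⊆ X := fun x hx y hy => by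
      simp only [X, Finset.mem_union, Finset.mem_biUnion, Set.Finite.mem_toFinset]
      exact .inr ⟨x, hx, .inl (.inr hy)⟩
    have hXα : ∀ x ∈ D, ∀ v ∈ (α x).fv, (Δ₁ v).fv ⊆ X := fun x hx v hv y hy => by
      simp only [X, Finset.mem_union, Finset.mem_biUnion, Set.Finite.mem_toFinset]
      exact .inr ⟨x, hx, .inr ⟨v, hv, hy⟩⟩
    obtain ⟨t, b, ht, hX, hb, hbc⟩ := exists_world hs hWc X
    have hW' := hs.infinite hW
    have hbi : Function.Injective b := fun y z hyz => by
      have := hb y; rw [hyz, hb] at this; simpa using this.symm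
    obtain ⟨γ, hγv, hγ⟩ := exists_guard (E := E) X a b s
    -- The translation of the vocabulary of the game into that of the formula: old aliases by `α`,
    -- new aliases by the messages that they abbreviate, and other variables by their names in the
    -- later world.
    let lk : ℕ → Msg L 0 := fun x => if x ∈ D then α x else if x ∈ D' then
      ev (e x) (fun y => Term.var (.inl (a (b y)))) else Term.var (.inl (a (b x)))
    have hlkfv : ∀ x v, v ∈ (lk x).fv → v ∈ Set.range (a ∘ b) ∨ ∃ x ∈ D, v ∈ (α x).fv := by
      intro x v hv
      by_cases hx : x ∈ D
      · simp only [lk, hx, if_true] at hv; exact .inr ⟨x, hx, hv⟩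
      · by_cases hx' : x ∈ D'
        · simp only [lk, hx, hx', if_true, if_false, mem_fv_ev] at hv
          obtain ⟨y, -, hy⟩ := hv
          exact .inl ⟨y, (Finset.mem_singleton.1 hy).symm⟩
        · simp only [lk, hx, hx', if_false, fv_var_inl, Finset.mem_singleton] at hv
          exact .inl ⟨x, hv.symm⟩
    have hlk : ∀ {m : ℕ} {Δ Δ₁ : ℕ → Msg L m}, (∀ y, Δ₁ (a y) = Term.var (.inl y)) →
        (∀ x ∈ D, Δ x = ev (α x) Δ₁) → (∀ x ∈ D, (Δ x).fv ⊆ X) → ∀ x,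
        futA D D' s e Δ x = ev (lk x) fun v => (Δ₁ v).subst (fs t m) := by
      intro m Δ Δ₁ ha hα hX' x
      by_cases hx : x ∈ D
      · simp only [futA, lk, hx, if_true]
        rw [← ev_subst, ← hα x hx]
        exact msg_fs_congr _ fun y hy => (hX y (hX' x hx hy)).symm
      · by_cases hx' : x ∈ D'
        · simp only [futA, lk, hx, hx', if_true, if_false, ev_ev, ev_var, ha, var_fs, hb, emb_var]
          exact emb_eq_ev _
        · simp only [futA, lk, hx, hx', if_false, ev_var, ha, var_fs, hb, emb_var]
    have hlkA := hlk ha hα hXA'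
    have hlkB := hlk ha' hα' hXB'
    have ha₁ : ∀ y, (Δ₁ ((a ∘ b) y)).subst (fs t A.scope) = Term.var (.inl y) := fun y => by
      simp only [Function.comp, ha, var_fs, hb, emb_var]
    have ha₁' : ∀ y, (Δ₁' ((a ∘ b) y)).subst (fs t B.scope) = Term.var (.inl y) := fun y => by
      simp only [Function.comp, ha', var_fs, hb, emb_var]
    have hPA : A.proc.repl (fs s _) = A.proc.repl (fs t _) :=
      proc_fs_congr _ fun x hx => (hX x (hXA hx)).symm
    have hPB : B.proc.repl (fs s _) = B.proc.repl (fs t _) :=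
      proc_fs_congr _ fun x hx => (hX x (hXB hx)).symm
    -- It suffices to distinguish the states after the substitution; the guard carries the formula
    -- back.
    suffices H : ∃ Θ : Formula L, (∀ v ∈ Θ.fv, v ∈ Set.range (a ∘ b) ∨ ∃ x, v ∈ (lk x).fv) ∧
        Forces E Θ ∅ (fun v => (Δ₁ v).subst (fs t _)) (A.proc.repl (fs s _)) ∧
        ¬ Forces E Θ W' (fun v => (Δ₁' v).subst (fs t _)) (B.proc.repl (fs s _)) by
      obtain ⟨Θ, hΘv, hΘA, hΘB⟩ := H
      have hΘv : ∀ v ∈ Θ.fv, v ∈ Set.range (a ∘ b) ∨ ∃ x ∈ D, v ∈ (α x).fv := fun v hv =>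
        (hΘv v hv).elim .inl fun ⟨x, hx⟩ => hlkfv x v hx
      rw [hPA] at hΘA
      rw [hPB] at hΘB
      refine ⟨.imp γ Θ, fun v hv => ?_, forces_guard_imp hγ hX hb ha hXA (fun v hv x hx => ?_) hΘA,
        not_forces_guard_imp hγ hX hb ht ha' hΘB⟩
      · rcases Finset.mem_union.1 hv with hv | hv
        · exact .inl (hγv v hv)
        · refine (hΘv v hv).imp (fun h => ?_) id
          obtain ⟨y, rfl⟩ := h; exact ⟨b y, rfl⟩
      · rcases hΘv v hv with ⟨y, rfl⟩ | ⟨z, hz, hvz⟩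
        · simp only [Function.comp, ha, fv_var_inl, Finset.mem_singleton] at hx
          exact .inr ⟨y, hx.symm⟩
        · exact .inl (hXα z hz v hvz hx)
    -- A name for the variable bound by an output, unused in the formula vocabulary; it exists
    -- because the range of `b` is co-infinite.
    obtain ⟨y, hyb, hyD⟩ : ∃ y, y ∉ Set.range (a ∘ b) ∧ ∀ x ∈ D', y ∉ (lk x).fv := by
      have h1 : (a '' (Set.range b)ᶜ).Infinite := hbc.image hai.injOn
      obtain ⟨_, ⟨z, hz, rfl⟩, h2⟩ := (h1.sdiff (Finset.finite_toSet
        (hD'.toFinset.biUnion fun x => (lk x).fv))).nonempty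
      refine ⟨a z, ?_, fun x hx hv => h2 ?_⟩
      · rintro ⟨w, hw⟩; exact hz ⟨w, hai hw⟩
      · simp only [Finset.coe_biUnion, Set.mem_iUnion]
        exact ⟨x, by simpa using hx, hv⟩
    have hstep : ∀ (π : Label L 0) (R : Agent L A.scope) (R' : Agent L B.scope),
        CStep E W' (A.proc.repl (fs s _)) (π.kind (futA D D' s e A.asg))
          (π.chan (futA D D' s e A.asg)) R →
        CStep E W' (B.proc.repl (fs s _)) (π.kind (futA D D' s e B.asg))
          (π.chan (futA D D' s e B.asg)) R' →
        ¬ Apx E j (D' ∪ π.bn) W' ((A.fut D D' s e).next π.bv R) ((B.fut D D' s e).next π.bv R') →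
        ∃ φ : Formula L, (∀ v ∈ φ.fv, v ∈ {v | v ∈ Set.range (a ∘ b) ∨ (∃ x, v ∈ (lk x).fv) ∨
            v ∈ (π.inst lk y).bn}) ∧
          Forces E φ ∅ (nextA (fun v => (Δ₁ v).subst (fs t _)) (π.inst lk y).bv R) R.proc ∧
          ¬ Forces E φ W' (nextA (fun v => (Δ₁' v).subst (fs t _)) (π.inst lk y).bv R')
            R'.proc := by
      intro π R R' hR hR' hn
      have hbn : (π.bn).Finite := by cases π <;> simp [Label.bn]
      obtain ⟨h1, h2⟩ := nextA_inst hyb hyD hlkA hR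
      obtain ⟨h3, h4⟩ := nextA_inst hyb hyD hlkB hR'
      obtain ⟨φ, hv, hA, hB⟩ := ih (hD'.union hbn) hW' hs.1 hn (hai.comp hbi) (h2 ha₁) (h4 ha₁')
        h1 h3
      refine ⟨φ, fun v hv' => ?_, hA, hB⟩
      rcases hv v hv' with h | ⟨x, hx, h⟩
      · exact .inl h
      · split at h
        · rename_i hxb
          simp only [fv_var_inl, Finset.mem_singleton] at h
          subst h
          exact .inr (.inr (Label.mem_bn_inst hxb))
        · exact .inr (.inl ⟨x, h⟩)
    -- The name `y` does not escape, since the modality binds it.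
    have hclean : ∀ {Θ : Formula L} (π : Label L 0), (∀ v ∈ Θ.fv, v ∈ Set.range (a ∘ b) ∨
        (∃ x, v ∈ (lk x).fv) ∨ v ∈ {v | v ∈ Set.range (a ∘ b) ∨ (∃ x, v ∈ (lk x).fv) ∨
            v ∈ (π.inst lk y).bn} ∧ v ∉ (π.inst lk y).bn) →
        ∀ v ∈ Θ.fv, v ∈ Set.range (a ∘ b) ∨ ∃ x, v ∈ (lk x).fv := by
      intro Θ π h v hv
      rcases h v hv with h | h | ⟨h | h | h, h'⟩
      · exact .inl h
      · exact .inr h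
      · exact .inl h
      · exact .inr h
      · exact absurd h h'
    have hev : ∀ {m : ℕ} {Δ Δ₁ : ℕ → Msg L m} (_ : ∀ x, Δ x = ev (lk x) Δ₁) (M : Msg L 0),
        ev (ev M lk) Δ₁ = ev M Δ := by
      intro m Δ Δ₁ h M
      rw [ev_ev, show Δ = fun x => ev (lk x) Δ₁ from funext h]
    have hevfv : ∀ M : Msg L 0, ∀ v ∈ (ev M lk).fv, ∃ x, v ∈ (lk x).fv := by
      intro M v hv
      obtain ⟨x, -, hx⟩ := (mem_fv_ev _ _ _).1 hv
      exact ⟨x, hx⟩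
    by_cases hst : State.Static E (A.fut D D' s e) (B.fut D D' s e)
    · by_cases hm : State.Matched E (Apx E j) D' W' (A.fut D D' s e) (B.fut D D' s e)
      · have hm' : ¬ State.Matched E (fun D W B A => Apx E j D W A B) D' W' (B.fut D D' s e)
            (A.fut D D' s e) := fun h' => h ⟨hst, hm, h'⟩
        unfold State.Matched at hm'
        push Not at hm'
        obtain ⟨π, R', -, hR', hn⟩ := hm'
        obtain ⟨Θ, h1, h2, h3⟩ := exists_box (E := E) hW' hs.1 ha₁ ha₁' hlkA hlkB π hyb _ hR'
          fun R hR => hstep π R R' hR hR' (hn R hR)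
        exact ⟨Θ, hclean π h1, h2, h3⟩
      · unfold State.Matched at hm
        push Not at hm
        obtain ⟨π, R, -, hR, hn⟩ := hm
        obtain ⟨Θ, h1, h2, h3⟩ := exists_dia (E := E) hW' hs.1 ha₁ ha₁' hlkA hlkB π y _ hR
          fun R' hR' => hstep π R R' hR hR' (hn R' hR')
        exact ⟨Θ, hclean π h1, h2, h3⟩
    · unfold State.Static at hst
      push Not at hst
      obtain ⟨M, N, ⟨h1, h2⟩ | ⟨h1, h2⟩⟩ := hst
      -- The left state equates the messages and the right one does not: the equation distinguishes
      -- them.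
      · refine ⟨.eq (ev M lk) (ev N lk), fun v hv => .inr ?_, ?_, ?_⟩
        · rcases Finset.mem_union.1 hv with hv | hv
          exacts [hevfv _ v hv, hevfv _ v hv]
        · simp only [Forces, hev hlkA]; exact h1
        · simp only [Forces, hev hlkB]; exact h2
      -- Here the right state equates the messages. The negated equation need not hold on the left,
      -- where a later substitution may make them equal. The equation is instead taken to imply `χ`,
      -- which it entails for the messages of the left state but which fails in `W'`.
      · obtain ⟨χ, hχv, hχB, hχA⟩ := exists_cond_blocker (E := E) hW' hs.1 (a ∘ b)
          (c := ⟨_, true, ev M (A.fut D D' s e).asg, ev N (A.fut D D' s e).asg⟩)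
          (by simpa [Cond.Holds, fs_ident, subst_var] using h1)
        refine ⟨.imp (.eq (ev M lk) (ev N lk)) χ, fun v hv => ?_, ?_, fun H => ?_⟩
        · simp only [Formula.fv, Finset.mem_union] at hv
          rcases hv with (hv | hv) | hv
          exacts [.inr (hevfv _ v hv), .inr (hevfv _ v hv), .inl (hχv v hv)]
        · intro W'' r hr he
          refine hχA W'' r _ _ (fun y => ?_) ?_
          · beta_reduce; rw [ha₁]; rfl
          · simp only [Forces, ← ev_subst, hev hlkA] at he
            simp only [Cond.Holds, if_true]; exact he
        · refine hχB _ _ ha₁' (H.mp hs.1 ?_)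
          simp only [Forces, hev hlkB]; exact h2

/-! ## Transport of transitions between scopes -/

/-- `u'` extends `u` along the embeddings of the old scopes into new ones, where the new names
correspond to each other. -/
inductive Lifts {m' n' : ℕ} (u' : Repl L m' n') :
    {m n : ℕ} → Repl L m n → (Fin m → Fin m') → (Fin n → Fin n') → Prop
  | refl : Lifts u' u' id id
  | step {m n : ℕ} (u : Repl L m n) (w : Fin (m + 1) → Fin m') (w' : Fin (n + 1) → Fin n') :
      Lifts u' u.lift w w' → Lifts u' u (w ∘ Fin.castSucc) (w' ∘ Fin.castSucc)

theorem Lifts.trans {m n m' n' m'' n'' : ℕ} {u : Repl L m n} {u' : Repl L m' n'}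
    {u'' : Repl L m'' n''} {w : Fin m → Fin m'} {w' : Fin n → Fin n'} {z : Fin m' → Fin m''}
    {z' : Fin n' → Fin n''} (h : Lifts u' u w w') (h' : Lifts u'' u' z z') :
    Lifts u'' u (z ∘ w) (z' ∘ w') := by
  induction h with
  | refl => exact h'
  | step u w w' _ ih => exact .step u _ _ ih

theorem Lifts.square {m n m' n' : ℕ} {u : Repl L m n} {u' : Repl L m' n'} {w : Fin m → Fin m'}
    {w' : Fin n → Fin n'} (h : Lifts u' u w w') (a : ℕ ⊕ Fin m) :
    (rn w a).subst u' = (u a).subst (rn w') := by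
  induction h with
  | refl => rw [msg_rn_id]; rcases a with x | i <;> rfl
  | step u w w' _ ih =>
    rw [← msg_rn_rn, ← wk_one_eq]
    rcases a with x | i
    · change _ = (u.lift (.inl x)).subst (rn w')
      rw [← ih (.inl x)]; rfl
    · have := ih (.inr i.castSucc)
      simpa using this

/-- Apartness is transported along `u`. -/
def Good (W W' : Set ℕ) {m n : ℕ} (u : Repl L m n) : Prop :=
  ∀ (X : Set ℕ) (s : Subst L 0), Adm W' X s → ∃ (Y : Set ℕ) (t : Subst L 0) (q : Repl L n m),
    Adm W Y t ∧ ∀ a, ((u a).subst (fs s n)).subst q = fs t m a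

theorem Good.lift {W W' : Set ℕ} {m n : ℕ} {u : Repl L m n} (h : Good W W' u) :
    Good W W' u.lift := by
  intro X s hs
  obtain ⟨Y, t, q, ht, hq⟩ := h X s hs
  refine ⟨Y, t, q.lift, ht, fun a => ?_⟩
  have := congrFun (congrArg Repl.lift (show (u.thn (fs s n)).thn q = fs t m from funext hq)) a
  rw [lift_thn, lift_thn, lift_fs, lift_fs] at this
  exact this

theorem Lifts.good {W W' : Set ℕ} {m n m' n' : ℕ} {u : Repl L m n} {u' : Repl L m' n'}
    {w : Fin m → Fin m'} {w' : Fin n → Fin n'} (h : Lifts u' u w w') (hu : Good W W' u) :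
    Good W W' u' := by
  induction h with
  | refl => exact hu
  | step u w w' _ ih => exact ih hu.lift

/-- A unifier found after `u` is pulled back along `q` to an admissible unifier before `u`. -/
theorem Good.apart {W W' : Set ℕ} {m n : ℕ} {u : Repl L m n} (h : Good W W' u) {M N : Msg L m}
    (hMN : Apart E W M N) : Apart E W' (M.subst u) (N.subst u) := by
  intro X s hs he
  obtain ⟨Y, t, q, ht, hq⟩ := h X s hs
  have key : ∀ M : Msg L m, ((M.subst u).subst (fs s n)).subst q = M.subst (fs t m) := fun M => by
    rw [subst_subst, subst_subst]; congr 1; funext a; rw [← hq, subst_subst]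
  refine hMN Y t ht ?_
  rw [← key, ← key]; exact he.subst q

/-- The agent `R'` corresponds to `R`, under the replacement `u'` for the new scopes. -/
structure Agent.Corr {m n : ℕ} (u : Repl L m n) (R : Agent L m) (R' : Agent L n)
    (u' : Repl L R.scope R'.scope) : Prop where
  lifts : Lifts u' u R.ren R'.ren
  msg : R'.msg = R.msg.map fun N => N.subst u'
  proc : R'.proc = R.proc.repl u'

theorem Lifts.proc {m n m' n' : ℕ} {u : Repl L m n} {u' : Repl L m' n'} {w : Fin m → Fin m'}
    {w' : Fin n → Fin n'} (h : Lifts u' u w w') (P : Proc L m) :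
    (P.repl (rn w)).repl u' = (P.repl u).repl (rn w') := repl_comm P h.square

theorem Lifts.subst {m n m' n' : ℕ} {u : Repl L m n} {u' : Repl L m' n'} {w : Fin m → Fin m'}
    {w' : Fin n → Fin n'} (h : Lifts u' u w w') (M : Msg L m) :
    (M.subst (rn w)).subst u' = (M.subst u).subst (rn w') := subst_comm M h.square

/-- Replacements act on bound names too, so the symbolic description does not apply and the
derivation is followed rule by rule. Only mismatches depend on the private variables, and `Good` is
exactly what they need. -/
theorem CStep.transport {W W' : Set ℕ} {m n : ℕ} {P : Proc L m} {K : Kind L m} {C : Msg L m}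
    {R : Agent L m} (h : CStep E W P K C R) {u : Repl L m n} (hu : Good W W' u) :
    ∃ (R' : Agent L n) (u' : Repl L R.scope R'.scope),
      CStep E W' (P.repl u) (K.repl u) (C.subst u) R' ∧ R.Corr u R' u' := by
  induction h generalizing n with
  | inp M C N P he =>
    exact ⟨_, u, .inp _ _ _ _ (he.subst u), .refl, rfl, (inst_repl _ _ _).symm⟩
  | out M C N P he => exact ⟨_, u, .out _ _ _ _ (he.subst u), .refl, rfl, rfl⟩
  | sum_l P Q K C R _ ih =>
    obtain ⟨R', u', h, hc⟩ := ih hu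
    exact ⟨R', u', .sum_l _ _ _ _ _ h, hc⟩
  | sum_r P Q K C R _ ih =>
    obtain ⟨R', u', h, hc⟩ := ih hu
    exact ⟨R', u', .sum_r _ _ _ _ _ h, hc⟩
  | mat M N P K C R he _ ih =>
    obtain ⟨R', u', h, hc⟩ := ih hu
    exact ⟨R', u', .mat _ _ _ _ _ _ (he.subst u) h, hc⟩
  | mismat M N P K C R ha _ ih =>
    obtain ⟨R', u', h, hc⟩ := ih hu
    exact ⟨R', u', .mismat _ _ _ _ _ _ (hu.apart ha) h, hc⟩
  | res P K C R _ ih =>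
    obtain ⟨R', u', h, hc⟩ := ih hu.lift
    refine ⟨R'.res, u', .res _ _ _ R' ?_, .step u _ _ hc.lifts, hc.msg, hc.proc⟩
    rw [wk_subst_lift] at h
    rwa [Kind.repl_comm K (q := u.lift) (r := rn Fin.castSucc)]
    rintro (x | i)
    · simp [wk_one_eq]
    · simp [wk_one_eq]
  | par_l P Q K C R _ ih =>
    obtain ⟨R', u', h, hc⟩ := ih hu
    refine ⟨R'.parR (Q.repl u), u', .par_l _ _ _ _ _ h, hc.lifts, hc.msg, ?_⟩
    simp only [Agent.parR, Proc.repl, hc.proc, hc.lifts.proc]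
  | par_r P Q K C R _ ih =>
    obtain ⟨R', u', h, hc⟩ := ih hu
    refine ⟨R'.parL (P.repl u), u', .par_r _ _ _ _ _ h, hc.lifts, hc.msg, ?_⟩
    simp only [Agent.parL, Proc.repl, hc.proc, hc.lifts.proc]
  | rep_act P K C R _ ih =>
    obtain ⟨R', u', h, hc⟩ := ih hu
    refine ⟨R'.parR (.bang (P.repl u)), u', .rep_act _ _ _ _ h, hc.lifts, hc.msg, ?_⟩
    simp only [Agent.parR, Proc.repl, hc.proc, hc.lifts.proc]
  | close_l P Q C C' R N S _ hN _ ih ih' =>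
    obtain ⟨R', u', h, hc⟩ := ih hu
    -- The receiver runs in the scope enlarged by the extruded names; the replacement extended to
    -- that scope is still good.
    obtain ⟨S', u'', h', hc'⟩ := ih' (hc.lifts.good hu)
    rw [hc.lifts.proc, hc.lifts.subst] at h'
    refine ⟨R'.closeL S', u'', .close_l _ _ _ _ R' _ S' h (by rw [hc.msg, hN]; rfl) h',
      hc.lifts.trans hc'.lifts, rfl, ?_⟩
    simp only [Agent.closeL, Proc.repl, hc.proc, hc'.proc, hc'.lifts.proc]
  | close_r P Q C C' R N S _ hN _ ih ih' =>
    obtain ⟨R', u', h, hc⟩ := ih hu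
    obtain ⟨S', u'', h', hc'⟩ := ih' (hc.lifts.good hu)
    rw [hc.lifts.proc, hc.lifts.subst] at h'
    refine ⟨R'.closeR S', u'', .close_r _ _ _ _ R' _ S' h (by rw [hc.msg, hN]; rfl) h',
      hc.lifts.trans hc'.lifts, rfl, ?_⟩
    simp only [Agent.closeR, Proc.repl, hc.proc, hc'.proc, hc'.lifts.proc]
  | rep_close P C C' R N S _ hN _ ih ih' =>
    obtain ⟨R', u', h, hc⟩ := ih hu
    obtain ⟨S', u'', h', hc'⟩ := ih' (hc.lifts.good hu)
    rw [hc.lifts.proc, hc.lifts.subst] at h'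
    have hl := hc.lifts.trans hc'.lifts
    refine ⟨(R'.closeL S').parR (.bang (P.repl u)), u'', .rep_close _ _ _ R' _ S' h (by rw [hc.msg, hN]; rfl) h', hl, rfl, ?_⟩
    have hp := hl.proc P
    change (P.repl (rn (S.ren ∘ R.ren))).repl u'' = (P.repl u).repl (rn (S'.ren ∘ R'.ren)) at hp
    simp only [Agent.closeL, Agent.parR, Proc.repl, hc.proc, hc'.proc, hc'.lifts.proc, hp]

/-! ## Opening of bound names -/

/-- An opening of bound names: some of them become free variables, and the others are renumbered. -/
structure IsOpening {m n : ℕ} (o : Fin m → ℕ ⊕ Fin n) : Prop where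
  inj : Function.Injective o
  surj : ∀ j, ∃ i, o i = .inr j

/-- The variables that an opening introduces. -/
def names {m n : ℕ} (o : Fin m → ℕ ⊕ Fin n) : Set ℕ := {x | ∃ i, o i = .inl x}

theorem names_finite {m n : ℕ} (o : Fin m → ℕ ⊕ Fin n) : (names o).Finite := by
  refine ((Set.finite_range o).preimage Sum.inl_injective.injOn).subset ?_
  rintro x ⟨i, hi⟩; exact ⟨i, hi⟩

/-- The replacement that opens bound names. -/
def opn {m n : ℕ} (o : Fin m → ℕ ⊕ Fin n) : Repl L m n :=
  Sum.elim (fun x => Term.var (.inl x)) (fun i => Term.var (o i))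

open Classical in
/-- A variant of `opn` that replaces the variables of the opening by `c`. -/
def opnAvoid (c : ℕ) {m n : ℕ} (o : Fin m → ℕ ⊕ Fin n) : Repl L m n :=
  Sum.elim (fun x => Term.var (.inl (if x ∈ names o then c else x))) (fun i => Term.var (o i))

open Classical in
/-- The inverse of an opening. -/
def cls {m n : ℕ} (o : Fin m → ℕ ⊕ Fin n) : Repl L n m := fun b =>
  if h : ∃ i, o i = b then Term.var (.inr h.choose) else
    Sum.elim (fun x => Term.var (.inl x)) (fun _ => Term.var (.inl 0)) b

@[simp] theorem opn_inl {m n : ℕ} (o : Fin m → ℕ ⊕ Fin n) (x : ℕ) :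
    (opn o : Repl L m n) (.inl x) = Term.var (.inl x) := rfl
@[simp] theorem opn_inr {m n : ℕ} (o : Fin m → ℕ ⊕ Fin n) (i : Fin m) :
    (opn o : Repl L m n) (.inr i) = Term.var (o i) := rfl

theorem IsOpening.cls_apply {m n : ℕ} {o : Fin m → ℕ ⊕ Fin n} (ho : IsOpening o) (i : Fin m) :
    (cls o : Repl L n m) (o i) = Term.var (.inr i) := by
  have h : ∃ j, o j = o i := ⟨i, rfl⟩
  rw [cls, dif_pos h, ho.inj h.choose_spec]

theorem cls_inl {m n : ℕ} {o : Fin m → ℕ ⊕ Fin n} {x : ℕ} (hx : x ∉ names o) :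
    (cls o : Repl L n m) (.inl x) = Term.var (.inl x) := by
  rw [cls, dif_neg (show ¬ ∃ i, o i = .inl x from hx)]; rfl

/-- Openings pass under a binder. -/
def liftO {m n : ℕ} (o : Fin m → ℕ ⊕ Fin n) : Fin (m + 1) → ℕ ⊕ Fin (n + 1) :=
  Fin.lastCases (.inr (Fin.last n)) (fun i => Sum.map id Fin.castSucc (o i))

@[simp] theorem liftO_castSucc {m n : ℕ} (o : Fin m → ℕ ⊕ Fin n) (i : Fin m) :
    liftO o i.castSucc = Sum.map id Fin.castSucc (o i) := by simp [liftO]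
@[simp] theorem liftO_last {m n : ℕ} (o : Fin m → ℕ ⊕ Fin n) :
    liftO o (Fin.last m) = .inr (Fin.last n) := by simp [liftO]

theorem names_liftO {m n : ℕ} (o : Fin m → ℕ ⊕ Fin n) : names (liftO o) = names o := by
  ext x
  constructor
  · rintro ⟨i, hi⟩
    induction i using Fin.lastCases with
    | last => simp at hi
    | cast i =>
      refine ⟨i, ?_⟩
      rw [liftO_castSucc] at hi
      cases h : o i with
      | inl y => rw [h] at hi; simp at hi; rw [hi]
      | inr j => rw [h] at hi; simp at hi
  · rintro ⟨i, hi⟩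
    exact ⟨i.castSucc, by simp [hi]⟩

theorem IsOpening.lift {m n : ℕ} {o : Fin m → ℕ ⊕ Fin n} (ho : IsOpening o) :
    IsOpening (liftO o) := by
  have hinj : Function.Injective (Sum.map id Fin.castSucc : ℕ ⊕ Fin n → ℕ ⊕ Fin (n + 1)) :=
    Function.Injective.sumMap Function.injective_id (Fin.castSucc_injective n)
  have hne : ∀ b : ℕ ⊕ Fin n, Sum.map id Fin.castSucc b ≠ (.inr (Fin.last n) : ℕ ⊕ Fin (n + 1)) := by
    rintro (x | j) h
    · simp at h
    · exact (Fin.castSucc_ne_last j) (Sum.inr_injective h)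
  constructor
  · intro i j hij
    induction i using Fin.lastCases with
    | last =>
      induction j using Fin.lastCases with
      | last => rfl
      | cast j => rw [liftO_last, liftO_castSucc] at hij; exact absurd hij.symm (hne _)
    | cast i =>
      induction j using Fin.lastCases with
      | last => rw [liftO_last, liftO_castSucc] at hij; exact absurd hij (hne _)
      | cast j =>
        rw [liftO_castSucc, liftO_castSucc] at hij
        rw [ho.inj (hinj hij)]
  · intro j
    induction j using Fin.lastCases with
    | last => exact ⟨Fin.last m, by simp⟩
    | cast j =>
      obtain ⟨i, hi⟩ := ho.surj j
      exact ⟨i.castSucc, by simp [hi]⟩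

theorem wk_var {n : ℕ} (b : ℕ ⊕ Fin n) :
    Msg.wk 1 (Term.var b : Msg L n) = Term.var (Sum.map id Fin.castSucc b) := by
  rw [wk_one_eq]; rcases b with x | j <;> rfl

theorem lift_opnAvoid {c m n : ℕ} (o : Fin m → ℕ ⊕ Fin n) :
    (opnAvoid c o : Repl L m n).lift = opnAvoid c (liftO o) := by
  refine repl_ext (fun x => ?_) (fun i => ?_) ?_
  · simp only [Repl.lift, opnAvoid, Sum.elim_inl, wk_var, Sum.map_inl, id]
    classical
    exact congrArg (fun y : ℕ => (Term.var (.inl y) : Msg L (n + 1)))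
      (if_congr (by rw [names_liftO]) rfl rfl)
  · simp [opnAvoid, wk_var]
  · simp [opnAvoid]

theorem lift_cls {m n : ℕ} {o : Fin m → ℕ ⊕ Fin n} (ho : IsOpening o) :
    (cls o : Repl L n m).lift = cls (liftO o) := by
  refine repl_ext (fun x => ?_) (fun j => ?_) ?_
  · by_cases hx : x ∈ names o
    · obtain ⟨i, hi⟩ := hx
      have h1 := ho.cls_apply (L := L) i
      have h2 := ho.lift.cls_apply (L := L) i.castSucc
      rw [liftO_castSucc, hi] at h2
      rw [hi] at h1
      simp only [Sum.map_inl, id] at h2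
      simp [h1, h2, wk_var]
    · simp [cls_inl hx, cls_inl (names_liftO o ▸ hx : x ∉ names (liftO o)), wk_var]
  · obtain ⟨i, hi⟩ := ho.surj j
    have h1 := ho.cls_apply (L := L) i
    have h2 := ho.lift.cls_apply (L := L) i.castSucc
    rw [liftO_castSucc, hi] at h2
    rw [hi] at h1
    simp only [Sum.map_inr] at h2
    simp [h1, h2, wk_var]
  · have h2 := ho.lift.cls_apply (L := L) (Fin.last m)
    rw [liftO_last] at h2
    simp [h2]

/-- `o'` extends the opening `o` along the embeddings of the old scopes into new ones. -/
structure OExt {m n m' n' : ℕ} (o : Fin m → ℕ ⊕ Fin n) (w : Fin m → Fin m') (w' : Fin n → Fin n')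
    (o' : Fin m' → ℕ ⊕ Fin n') : Prop where
  isOpening : IsOpening o'
  names_eq : names o' = names o
  comm : ∀ i, o' (w i) = Sum.map id w' (o i)

theorem OExt.of_lift {m n m' n' : ℕ} {o : Fin m → ℕ ⊕ Fin n} {w : Fin (m + 1) → Fin m'}
    {w' : Fin (n + 1) → Fin n'} {o' : Fin m' → ℕ ⊕ Fin n'} (h : OExt (liftO o) w w' o') :
    OExt o (w ∘ Fin.castSucc) (w' ∘ Fin.castSucc) o' :=
  ⟨h.isOpening, h.names_eq.trans (names_liftO o), fun i => by
    rw [Function.comp, h.comm, liftO_castSucc]; rcases o i with x | j <;> rfl⟩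

theorem OExt.refl {m n : ℕ} {o : Fin m → ℕ ⊕ Fin n} (ho : IsOpening o) : OExt o id id o :=
  ⟨ho, rfl, fun i => by simp⟩

theorem Lifts.opnAvoid {c m n m' n' : ℕ} {o : Fin m → ℕ ⊕ Fin n} (ho : IsOpening o)
    {u' : Repl L m' n'} {w : Fin m → Fin m'} {w' : Fin n → Fin n'}
    (h : Lifts u' (opnAvoid c o) w w') : ∃ o', u' = AppliedPi.opnAvoid c o' ∧ OExt o w w' o' := by
  generalize hu : (AppliedPi.opnAvoid c o : Repl L m n) = u at h
  induction h with
  | refl => exact ⟨o, hu.symm, .refl ho⟩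
  | step u w w' _ ih =>
    obtain ⟨o', h1, h2⟩ := ih ho.lift (by rw [← lift_opnAvoid, hu])
    exact ⟨o', h1, h2.of_lift⟩

theorem Lifts.cls {m n m' n' : ℕ} {o : Fin m → ℕ ⊕ Fin n} (ho : IsOpening o)
    {u' : Repl L n' m'} {w : Fin m → Fin m'} {w' : Fin n → Fin n'}
    (h : Lifts u' (cls o) w' w) : ∃ o', u' = AppliedPi.cls o' ∧ OExt o w w' o' := by
  generalize hu : (AppliedPi.cls o : Repl L n m) = u at h
  induction h with
  | refl => exact ⟨o, hu.symm, .refl ho⟩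
  | step u w w' _ ih =>
    obtain ⟨o', h1, h2⟩ := ih ho.lift (by rw [← lift_cls ho, hu])
    exact ⟨o', h1, h2.of_lift⟩

theorem IsOpening.cls_opn {m n : ℕ} {o : Fin m → ℕ ⊕ Fin n} (ho : IsOpening o) (b : ℕ ⊕ Fin n) :
    ((cls o : Repl L n m) b).subst (opn o) = Term.var b := by
  by_cases h : ∃ i, o i = b
  · obtain ⟨i, rfl⟩ := h
    rw [ho.cls_apply]; rfl
  · rcases b with x | j
    · rw [cls_inl h]; rfl
    · exact absurd (ho.surj j) h

theorem IsOpening.msg_cls_opn {m n : ℕ} {o : Fin m → ℕ ⊕ Fin n} (ho : IsOpening o) (M : Msg L n) :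
    (M.subst (cls o)).subst (opn o) = M := by
  rw [subst_eq_of M ho.cls_opn, subst_var]

theorem IsOpening.proc_cls_opn {m n : ℕ} {o : Fin m → ℕ ⊕ Fin n} (ho : IsOpening o)
    (P : Proc L n) : (P.repl (cls o)).repl (opn o) = P := by
  rw [repl_repl]
  exact (congrArg (fun s => P.repl s) (funext ho.cls_opn)).trans (repl_var P)

theorem IsOpening.msg_opn_cls {m n : ℕ} {o : Fin m → ℕ ⊕ Fin n} (ho : IsOpening o) {M : Msg L m}
    (hM : ∀ x ∈ M.fv, x ∉ names o) : (M.subst (opn o)).subst (cls o) = M := by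
  rw [subst_subst]
  exact (subst_congr M (s := fun a => ((opn o : Repl L m n) a).subst (cls o))
    (t := fun a => Term.var a) (fun x hx => cls_inl (hM x hx))
    (fun i => ho.cls_apply i)).trans (subst_var M)

theorem IsOpening.proc_opn_cls {m n : ℕ} {o : Fin m → ℕ ⊕ Fin n} (ho : IsOpening o) {P : Proc L m}
    (hP : ∀ x ∈ P.fv, x ∉ names o) : (P.repl (opn o)).repl (cls o) = P := by
  rw [repl_repl]
  exact (repl_congr P (s := (opn o : Repl L m n).thn (cls o))
    (t := fun a => Term.var a) (fun x hx => cls_inl (hP x hx))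
    (fun i => ho.cls_apply i)).trans (repl_var P)

theorem msg_opnAvoid {c m n : ℕ} (o : Fin m → ℕ ⊕ Fin n) {M : Msg L m}
    (hM : ∀ x ∈ M.fv, x ∉ names o) : M.subst (opnAvoid c o) = M.subst (opn o) :=
  subst_congr M (fun x hx => by simp [opnAvoid, hM x hx]) (fun _ => rfl)

theorem proc_opnAvoid {c m n : ℕ} (o : Fin m → ℕ ⊕ Fin n) {P : Proc L m}
    (hP : ∀ x ∈ P.fv, x ∉ names o) : P.repl (opnAvoid c o) = P.repl (opn o) :=
  repl_congr P (fun x hx => by simp [opnAvoid, hP x hx]) (fun _ => rfl)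

theorem IsOpening.eqE_opn {m n : ℕ} {o : Fin m → ℕ ⊕ Fin n} (ho : IsOpening o) {M N : Msg L m}
    (hM : ∀ x ∈ M.fv, x ∉ names o) (hN : ∀ x ∈ N.fv, x ∉ names o) :
    EqE E (M.subst (opn o)) (N.subst (opn o)) ↔ EqE E M N := by
  refine ⟨fun h => ?_, fun h => h.subst _⟩
  have := h.subst (cls o)
  rwa [ho.msg_opn_cls hM, ho.msg_opn_cls hN] at this

/-- An admissible substitution keeps the opened names apart from everything else, so they can be
closed again afterwards. This would fail for `opn` itself, which may confuse an opened name with a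
free variable of the same name; hence the detour through `c`. -/
theorem IsOpening.good_opnAvoid {m n : ℕ} {o : Fin m → ℕ ⊕ Fin n} (ho : IsOpening o) {c : ℕ}
    (hc : c ∉ names o) : Good ∅ (names o) (opnAvoid c o : Repl L m n) := by
  classical
  rintro X s ⟨hX, f, hf, hfi, hfx⟩
  let q : Repl L n m := Sum.elim (fun y => if h : ∃ w ∈ names o, f w = y then
    (cls o : Repl L n m) (.inl h.choose) else Term.var (.inl y)) (fun j => cls o (.inr j))
  have hq : ∀ w ∈ names o, q (.inl (f w)) = cls o (.inl w) := by
    intro w hw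
    have h : ∃ w' ∈ names o, f w' = f w := ⟨w, hw, rfl⟩
    simp only [q, Sum.elim_inl, dif_pos h, hfi h.choose_spec.1 hw h.choose_spec.2]
  have hq' : ∀ x, x ∉ names o → ((s x).emb n).subst q = (s x).emb m := by
    intro x hx
    rw [emb_subst, emb_eq_ev]
    refine ev_congr _ fun y hy => ?_
    simp only [q, Sum.elim_inl]
    rw [dif_neg]
    rintro ⟨w, hw, rfl⟩
    exact hfx x hx w hw hy
  refine ⟨∅, fun x => s (if x ∈ names o then c else x), q, adm_empty (by simp [Set.infinite_univ]) _, ?_⟩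
  rintro (x | i)
  · simp only [opnAvoid, Sum.elim_inl, var_fs, fs_inl]
    split
    · exact hq' c hc
    · rename_i hx; exact hq' x hx
  · simp only [opnAvoid, Sum.elim_inr, subst_var_apply, fs_inr]
    rw [← ho.cls_apply]
    cases h : o i with
    | inl w =>
      rw [fs_inl, (hf w ⟨i, h⟩).2]
      exact hq w ⟨i, h⟩
    | inr j => rfl

/-- Closing makes the private variables bound, and a substitution for the remaining variables has to
be extended to an admissible one. Parity separates them: free variables go to even positions and
private ones to odd positions. -/
theorem IsOpening.good_cls {m n : ℕ} {o : Fin m → ℕ ⊕ Fin n} (ho : IsOpening o) :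
    Good (names o) ∅ (cls o : Repl L n m) := by
  classical
  rintro X s -
  let q : Repl L m n := Sum.elim (fun y => Term.var (.inl (2 * y)))
    (fun i => Term.var (Sum.map (fun w => 2 * w + 1) id (o i)))
  let t : Subst L 0 := fun x => if x ∈ names o then Term.var (.inl (2 * x + 1)) else
    ev (s x) fun y => Term.var (.inl (2 * y))
  refine ⟨{x | ∃ k, x = 2 * k + 1}, t, q, ⟨?_, fun w => 2 * w + 1, ?_, ?_, ?_⟩, ?_⟩
  · refine (Set.infinite_range_of_injective (f := fun k : ℕ => 2 * k) ?_).mono ?_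
    · intro a b hab; simp only at hab; omega
    · rintro _ ⟨k, rfl⟩ ⟨l, hl⟩; simp only at hl; omega
  · intro w hw; exact ⟨⟨w, rfl⟩, by simp [t, hw]⟩
  · intro a _ b _ hab; simp only at hab; omega
  · intro x hx w _ hmem
    simp only [t, hx, if_false, mem_fv_ev, fv_var_inl, Finset.mem_singleton] at hmem
    obtain ⟨y, -, hy⟩ := hmem; omega
  · intro b
    by_cases h : ∃ i, o i = b
    · obtain ⟨i, rfl⟩ := h
      rw [ho.cls_apply]
      simp only [subst_var_apply, fs_inr, q, Sum.elim_inr]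
      cases h : o i with
      | inl w =>
        have hw : w ∈ names o := ⟨i, h⟩
        simp [t, hw]
      | inr j => simp
    · rcases b with x | j
      · have hx : x ∉ names o := h
        rw [cls_inl hx, var_fs, emb_subst, fs_inl]
        simp only [t, hx, if_false, q, Sum.elim_inl]
        rw [emb_eq_ev, ev_ev]; rfl
      · exact absurd (ho.surj j) h

/-! ## Extended processes in flat form -/

/-- An extended process in flat form: the scope below the restrictions with the embedding of the
outer scope, the active substitution and the process. -/
structure Flat (L : FirstOrder.Language.{u, v}) (n : ℕ) : Type u where
  scope : ℕ
  ren : Fin n → Fin scope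
  sub : Subst L scope
  proc : Proc L scope

/-- A change of the outer scope. -/
def Flat.under {n m : ℕ} (w : Fin m → Fin n) (F : Flat L n) : Flat L m :=
  ⟨F.scope, F.ren ∘ w, F.sub, F.proc⟩

/-- The flat form. -/
def Ext.flat : {n : ℕ} → Ext L n → Flat L n
  | n, .act θ P => ⟨n, id, θ, P⟩
  | _, .new A => A.flat.under Fin.castSucc

theorem flat_news {n : ℕ} (k : ℕ) (A : Ext L (n + k)) :
    (Ext.news k A).flat = A.flat.under (Fin.castAdd k) := by
  induction k with
  | zero => rfl
  | succ k ih =>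
    rw [Ext.news, ih]; rfl

theorem cast_new {a b : ℕ} (h : a = b) (h' : a + 1 = b + 1) (A : Ext L (a + 1)) :
    h ▸ Ext.new A = Ext.new (h' ▸ A) := by
  subst h; rfl

theorem new_news {n : ℕ} (k : ℕ) (h : n + 1 + k = n + (k + 1)) (A : Ext L (n + 1 + k)) :
    Ext.new (Ext.news k A) = Ext.news (k + 1) (h ▸ A) := by
  induction k with
  | zero => rfl
  | succ k ih =>
    rw [Ext.news, ih (by omega), cast_new _ h]; rfl

/-- The communication rules expect the residual of the output as a block of restrictions over an
active substitution. Every extended process has this shape, up to the cast between `n + 1 + k` and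
`n + (k + 1)`. -/
theorem exists_news {n : ℕ} (A : Ext L n) :
    ∃ (k : ℕ) (θ : Subst L (n + k)) (P : Proc L (n + k)), A = Ext.news k (.act θ P) := by
  induction A with
  | act θ P => exact ⟨0, θ, P, rfl⟩
  | @new n A ih =>
    obtain ⟨k, θ, P, rfl⟩ := ih
    have h : n + 1 + k = n + (k + 1) := by omega
    refine ⟨k + 1, h ▸ θ, h ▸ P, ?_⟩
    rw [new_news k h]
    congr 1
    clear * -
    generalize n + (k + 1) = b at h
    subst h; rfl

theorem flat_parR {n : ℕ} (A : Ext L n) (Q : Proc L n) : (A.parR Q).flat =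
    ⟨A.flat.scope, A.flat.ren, A.flat.sub, .par A.flat.proc (Q.repl (rn A.flat.ren))⟩ := by
  induction A with
  | act θ P => simp only [Ext.parR, Ext.flat, proc_rn_id]
  | new A ih =>
    rw [Ext.parR, Ext.flat, ih, proc_wk_one_eq, proc_rn_rn]; rfl

theorem flat_parL {n : ℕ} (A : Ext L n) (Q : Proc L n) : (Ext.parL Q A).flat =
    ⟨A.flat.scope, A.flat.ren, A.flat.sub, .par (Q.repl (rn A.flat.ren)) A.flat.proc⟩ := by
  induction A with
  | act θ P => simp only [Ext.parL, Ext.flat, proc_rn_id]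
  | new A ih =>
    rw [Ext.parL, Ext.flat, ih, proc_wk_one_eq, proc_rn_rn]; rfl

theorem flat_addSubst {n : ℕ} (ρ : Subst L n) (A : Ext L n) : (Ext.addSubst ρ A).flat =
    ⟨A.flat.scope, A.flat.ren, fun x => Msg.app ((ρ x).subst (rn A.flat.ren)) A.flat.sub,
      A.flat.proc⟩ := by
  induction A with
  | act θ P => simp only [Ext.addSubst, Ext.flat, msg_rn_id]; rfl
  | new A ih =>
    rw [Ext.addSubst, Ext.flat, ih]
    simp only [Subst.wk, wk_one_eq, msg_rn_rn]; rfl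

/-- The flat form of the result of a transition; `x` is bound to the message that is output. -/
def Agent.flat {n : ℕ} (x : ℕ) (R : Agent L n) : Flat L n :=
  ⟨R.scope, R.ren, R.msg.elim Subst.ident (Subst.single x), R.proc⟩

/-- Flattening loses nothing here: the scope of the agent must be `n + k`, with the standard
embedding, so the agent of an output can be replaced by an explicit one. -/
theorem flat_news_act {n k x : ℕ} {θ : Subst L (n + k)} {P : Proc L (n + k)} {R : Agent L n}
    (hN : ∃ N, R.msg = some N)
    (h : (Ext.news k (.act θ P)).flat = R.flat x) :
    ∃ N, θ = Subst.single x N ∧ R = ⟨n + k, Fin.castAdd k, some N, P⟩ := by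
  obtain ⟨s, w, _ | N, P'⟩ := R
  · simp at hN
  clear hN
  simp only [flat_news, Ext.flat, Flat.under, Agent.flat, Flat.mk.injEq, Option.elim] at h
  obtain ⟨rfl, h1, h2, h3⟩ := h
  obtain rfl := eq_of_heq h1
  obtain rfl := eq_of_heq h2
  obtain rfl := eq_of_heq h3
  exact ⟨N, rfl, rfl⟩

theorem single_injective {n x : ℕ} {M N : Msg L n} (h : Subst.single x M = Subst.single x N) :
    M = N := by
  have := congrFun h x
  simpa [Subst.single] using this

/-! ## Transitions of processes -/

/-- The kind of an action. -/
def Label.kindAt {n : ℕ} : Label L n → Kind L n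
  | .tau => .tau
  | .out _ _ => .out
  | .inp _ N => .inp N

/-- The channel of an action. -/
def Label.chanAt {n : ℕ} : Label L n → Msg L n
  | .tau => Term.var (.inl 0)
  | .out M _ => M
  | .inp M _ => M

theorem Label.kindAt_wk {n : ℕ} (π : Label L n) :
    (π.wk 1).kindAt = π.kindAt.repl (rn Fin.castSucc) := by
  cases π with
  | inp M N => simp only [Label.wk, Label.kindAt, Kind.repl, wk_one_eq]
  | _ => rfl

theorem Label.chanAt_wk {n : ℕ} (π : Label L n) : (π.wk 1).chanAt = π.chanAt.wk 1 := by
  cases π <;> rfl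

theorem Label.bn_wk {n : ℕ} (π : Label L n) : (π.wk 1).bn = π.bn := by cases π <;> rfl

theorem Label.bv_wk {n : ℕ} (π : Label L n) : (π.wk 1).bv = π.bv := by cases π <;> rfl

/-- With no private variables every substitution is admissible, and only its values on the two
messages matter, so it may be given a finite domain. -/
theorem distinct_iff {n : ℕ} {M N : Msg L n} : Distinct E M N ↔ Apart E ∅ M N := by
  classical
  constructor
  · rintro h W' s - he
    let σ : Subst L 0 := fun x => if x ∈ M.fv ∪ N.fv then s x else Term.var (.inl x)
    refine h ⟨σ, (Finset.finite_toSet (M.fv ∪ N.fv)).subset fun x hx => ?_, ?_⟩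
    · by_contra hn
      exact hx (if_neg fun h => hn (Finset.mem_coe.2 h))
    · change EqE E (M.subst (fs σ n)) (N.subst (fs σ n))
      rwa [msg_fs_congr M (s := σ) (t := s) fun x hx => if_pos (Finset.mem_union_left _ hx),
        msg_fs_congr N (s := σ) (t := s) fun x hx => if_pos (Finset.mem_union_right _ hx)]
  · rintro h ⟨σ, -, he⟩
    exact h ∅ σ (adm_empty (by simp [Set.infinite_univ]) σ) he

/-- The flat semantics records the message that is output instead of substituting it for a bound
variable. This removes bound variables from the derivations and with them all side conditions about
them. -/
theorem Step.cstep {n : ℕ} {P : Proc L n} {π : Label L n} {A : Ext L n} (h : Step E P π A) :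
    ∃ R, CStep E ∅ P π.kindAt π.chanAt R ∧ A.flat = R.flat π.bv := by
  induction h with
  | inp M M' N P he => exact ⟨_, .inp _ _ _ _ he, rfl⟩
  | out M M' N P x he => exact ⟨_, .out _ _ _ _ he, rfl⟩
  | sum_l P Q π A _ ih =>
    obtain ⟨R, h, hA⟩ := ih
    exact ⟨R, .sum_l _ _ _ _ _ h, hA⟩
  | sum_r P Q π A _ ih =>
    obtain ⟨R, h, hA⟩ := ih
    exact ⟨R, .sum_r _ _ _ _ _ h, hA⟩
  | mat M N P π A he _ ih =>
    obtain ⟨R, h, hA⟩ := ih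
    exact ⟨R, .mat _ _ _ _ _ _ he h, hA⟩
  | mismat M N P π A hd _ ih =>
    obtain ⟨R, h, hA⟩ := ih
    exact ⟨R, .mismat _ _ _ _ _ _ (distinct_iff.1 hd) h, hA⟩
  | res P π A _ ih =>
    obtain ⟨R, h, hA⟩ := ih
    rw [Label.kindAt_wk, Label.chanAt_wk] at h
    refine ⟨_, .res _ _ _ _ h, ?_⟩
    rw [Ext.flat, hA, Label.bv_wk]; rfl
  | par_l P Q π A _ _ ih =>
    obtain ⟨R, h, hA⟩ := ih
    refine ⟨_, .par_l _ _ _ _ _ h, ?_⟩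
    rw [flat_parR, hA]; rfl
  | par_r P Q π A _ _ ih =>
    obtain ⟨R, h, hA⟩ := ih
    refine ⟨_, .par_r _ _ _ _ _ h, ?_⟩
    rw [flat_parL, hA]; rfl
  | rep_act P π A _ _ ih =>
    obtain ⟨R, h, hA⟩ := ih
    refine ⟨_, .rep_act _ _ _ _ h, ?_⟩
    rw [flat_parR, hA]; rfl
  | @close_l n k P Q M M' x N P' B _ _ he _ ih ih' =>
    obtain ⟨R, h, hA⟩ := ih
    obtain ⟨S, h', hB⟩ := ih'
    obtain ⟨N', h1, rfl⟩ := flat_news_act (h.msg_isSome.1 rfl) hA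
    obtain rfl := single_injective h1
    have hS := h'.msg_isSome
    have : S.msg = none := by
      cases hS' : S.msg with
      | none => rfl
      | some N => exact absurd (hS.2 ⟨N, hS'⟩) (by simp [Label.kindAt])
    have he' : EqE E (M'.wk k) (M.subst (rn (Fin.castAdd k))) := by
      rw [wk_eq_subst]; exact he.symm.subst _
    refine ⟨_, .close_l P Q (Term.var (.inl 0)) M ⟨n + k, Fin.castAdd k, some N, P'⟩ N S h rfl
      (h'.chan fun _ => he'), ?_⟩
    · rw [flat_news, flat_parL, hB]
      simp only [Agent.closeL, Agent.flat, this]; rfl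
  | @close_r n k P Q M M' x N P' B _ _ he _ ih ih' =>
    obtain ⟨R, h, hA⟩ := ih
    obtain ⟨S, h', hB⟩ := ih'
    obtain ⟨N', h1, rfl⟩ := flat_news_act (h.msg_isSome.1 rfl) hA
    obtain rfl := single_injective h1
    have hS := h'.msg_isSome
    have : S.msg = none := by
      cases hS' : S.msg with
      | none => rfl
      | some N => exact absurd (hS.2 ⟨N, hS'⟩) (by simp [Label.kindAt])
    have he' : EqE E (M'.wk k) (M.subst (rn (Fin.castAdd k))) := by
      rw [wk_eq_subst]; exact he.symm.subst _
    refine ⟨_, .close_r P Q (Term.var (.inl 0)) M ⟨n + k, Fin.castAdd k, some N, P'⟩ N S h rfl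
      (h'.chan fun _ => he'), ?_⟩
    · rw [flat_news, flat_parR, hB]
      simp only [Agent.closeR, Agent.flat, this]; rfl
  | @rep_close n k P M M' x N P' B _ _ he ih ih' =>
    obtain ⟨R, h, hA⟩ := ih
    obtain ⟨S, h', hB⟩ := ih'
    obtain ⟨N', h1, rfl⟩ := flat_news_act (h.msg_isSome.1 rfl) hA
    obtain rfl := single_injective h1
    have hS := h'.msg_isSome
    have : S.msg = none := by
      cases hS' : S.msg with
      | none => rfl
      | some N => exact absurd (hS.2 ⟨N, hS'⟩) (by simp [Label.kindAt])
    have he' : EqE E (M'.wk k) (M.subst (rn (Fin.castAdd k))) := by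
      rw [wk_eq_subst]; exact he.symm.subst _
    refine ⟨_, .rep_close P (Term.var (.inl 0)) M ⟨n + k, Fin.castAdd k, some N, P'⟩ N S h rfl
      (h'.chan fun _ => he'), ?_⟩
    · rw [flat_news, flat_parR, flat_parL, hB]
      have hp := proc_rn_rn (.bang P) (Fin.castAdd k) S.ren
      simp only [Agent.closeL, Agent.parR, Agent.flat, this, proc_wk_eq, Flat.under]
      simp only [Proc.repl] at hp ⊢
      rw [← hp]; rfl

theorem exists_fresh (F : Finset ℕ) : ∃ x, x ∉ F := Infinite.exists_notMem_finset F

/-- Conversely, any bound variable that is fresh for the process and the channel restores the side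
conditions of the rules. -/
theorem CStep.step {n : ℕ} {P : Proc L n} {K : Kind L n} {C : Msg L n} {R : Agent L n}
    (h : CStep E ∅ P K C R) {π : Label L n} (hK : π.kindAt = K) (hC : π ≠ .tau → π.chanAt = C)
    (hx : ∀ x ∈ π.bn, x ∉ P.fv ∧ x ∉ π.chanAt.fv) :
    ∃ A, Step E P π A ∧ A.flat = R.flat π.bv := by
  induction h with
  | inp M C N P he =>
    cases π with
    | inp M' N' =>
      obtain rfl : N' = N := by simpa [Label.kindAt] using hK
      obtain rfl : M' = C := hC (by simp)
      exact ⟨_, .inp _ _ _ _ he, rfl⟩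
    | _ => simp [Label.kindAt] at hK
  | out M C N P he =>
    cases π with
    | out M' x =>
      obtain rfl : M' = C := hC (by simp)
      obtain ⟨h1, h2⟩ := hx x rfl
      simp only [Proc.fv, Finset.mem_union, not_or] at h1
      exact ⟨_, .out _ _ _ _ x he h1.1.1 h2 h1.1.2 h1.2, rfl⟩
    | _ => simp [Label.kindAt] at hK
  | sum_l P Q K C R _ ih =>
    simp only [Proc.fv, Finset.mem_union, not_or] at hx
    obtain ⟨A, h, hA⟩ := ih hK hC (fun x h => ⟨(hx x h).1.1, (hx x h).2⟩)
    exact ⟨A, .sum_l _ _ _ _ h, hA⟩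
  | sum_r P Q K C R _ ih =>
    simp only [Proc.fv, Finset.mem_union, not_or] at hx
    obtain ⟨A, h, hA⟩ := ih hK hC (fun x h => ⟨(hx x h).1.2, (hx x h).2⟩)
    exact ⟨A, .sum_r _ _ _ _ h, hA⟩
  | mat M N P K C R he _ ih =>
    simp only [Proc.fv, Finset.mem_union, not_or] at hx
    obtain ⟨A, h, hA⟩ := ih hK hC (fun x h => ⟨(hx x h).1.2, (hx x h).2⟩)
    exact ⟨A, .mat _ _ _ _ _ he h, hA⟩
  | mismat M N P K C R he _ ih =>
    simp only [Proc.fv, Finset.mem_union, not_or] at hx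
    obtain ⟨A, h, hA⟩ := ih hK hC (fun x h => ⟨(hx x h).1.2, (hx x h).2⟩)
    exact ⟨A, .mismat _ _ _ _ _ (distinct_iff.2 he) h, hA⟩
  | res P K C R _ ih =>
    obtain ⟨A, h, hA⟩ := ih (π := π.wk 1) (by rw [Label.kindAt_wk, hK])
      (fun hτ => by rw [Label.chanAt_wk, hC (by rintro rfl; exact hτ rfl)])
      (fun x h => by
        rw [Label.bn_wk] at h
        rw [Label.chanAt_wk, wk_one_eq, fv_rn]
        exact hx x h)
    refine ⟨.new A, .res _ _ _ h, ?_⟩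
    rw [Ext.flat, hA, Label.bv_wk]; rfl
  | par_l P Q K C R _ ih =>
    simp only [Proc.fv, Finset.mem_union, not_or] at hx
    obtain ⟨A, h, hA⟩ := ih hK hC (fun x h => ⟨(hx x h).1.1, (hx x h).2⟩)
    refine ⟨_, .par_l _ _ _ _ h (Set.disjoint_left.2 fun x h h' => (hx x h).1.2 h'), ?_⟩
    rw [flat_parR, hA]; rfl
  | par_r P Q K C R _ ih =>
    simp only [Proc.fv, Finset.mem_union, not_or] at hx
    obtain ⟨A, h, hA⟩ := ih hK hC (fun x h => ⟨(hx x h).1.2, (hx x h).2⟩)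
    refine ⟨_, .par_r _ _ _ _ h (Set.disjoint_left.2 fun x h h' => (hx x h).1.1 h'), ?_⟩
    rw [flat_parL, hA]; rfl
  | rep_act P K C R _ ih =>
    simp only [Proc.fv] at hx
    obtain ⟨A, h, hA⟩ := ih hK hC hx
    refine ⟨_, .rep_act _ _ _ h (Set.disjoint_left.2 fun x h h' => (hx x h).1 h'), ?_⟩
    rw [flat_parR, hA]; rfl
  | close_l P Q C C' R N S h hN h' ih ih' =>
    have hτ : π = .tau := by cases π <;> first | rfl | cases hK
    subst hτ
    -- The output inside a communication has no prescribed bound variable, so a fresh one is chosen.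
    obtain ⟨x, hxf⟩ := exists_fresh (P.fv ∪ Q.fv ∪ Msg.fv C')
    simp only [Finset.mem_union, not_or] at hxf
    obtain ⟨A, hA, hAf⟩ := ih (π := .out C' x) rfl (fun _ => rfl) (by
      rintro y rfl; exact ⟨hxf.1.1, hxf.2⟩)
    obtain ⟨k, θ, P', rfl⟩ := exists_news A
    obtain ⟨N', rfl, rfl⟩ := flat_news_act ⟨N, hN⟩ hAf
    obtain rfl : N' = N := Option.some.inj hN
    obtain ⟨B, hB, hBf⟩ := ih' (π := .inp (C'.wk k) N') rfl (fun _ => wk_eq_subst C')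
      (by simp [Label.bn])
    have hS : S.msg = none := by
      cases hS' : S.msg with
      | none => rfl
      | some N => exact absurd (h'.msg_isSome.2 ⟨N, hS'⟩) (by simp)
    refine ⟨_, .close_l P Q C' C' x N' P' B hA hB (.refl _) hxf.1.2, ?_⟩
    rw [flat_news, flat_parL, hBf]
    simp only [Agent.closeL, Agent.flat, hS]; rfl
  | close_r P Q C C' R N S h hN h' ih ih' =>
    have hτ : π = .tau := by cases π <;> first | rfl | cases hK
    subst hτ
    obtain ⟨x, hxf⟩ := exists_fresh (P.fv ∪ Q.fv ∪ Msg.fv C')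
    simp only [Finset.mem_union, not_or] at hxf
    obtain ⟨A, hA, hAf⟩ := ih (π := .out C' x) rfl (fun _ => rfl) (by
      rintro y rfl; exact ⟨hxf.1.2, hxf.2⟩)
    obtain ⟨k, θ, P', rfl⟩ := exists_news A
    obtain ⟨N', rfl, rfl⟩ := flat_news_act ⟨N, hN⟩ hAf
    obtain rfl : N' = N := Option.some.inj hN
    obtain ⟨B, hB, hBf⟩ := ih' (π := .inp (C'.wk k) N') rfl (fun _ => wk_eq_subst C')
      (by simp [Label.bn])
    have hS : S.msg = none := by
      cases hS' : S.msg with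
      | none => rfl
      | some N => exact absurd (h'.msg_isSome.2 ⟨N, hS'⟩) (by simp)
    refine ⟨_, .close_r P Q C' C' x N' P' B hA hB (.refl _) hxf.1.1, ?_⟩
    rw [flat_news, flat_parR, hBf]
    simp only [Agent.closeR, Agent.flat, hS]; rfl
  | rep_close P C C' R N S h hN h' ih ih' =>
    have hτ : π = .tau := by cases π <;> first | rfl | cases hK
    subst hτ
    obtain ⟨x, hxf⟩ := exists_fresh (P.fv ∪ Msg.fv C')
    simp only [Finset.mem_union, not_or] at hxf
    obtain ⟨A, hA, hAf⟩ := ih (π := .out C' x) rfl (fun _ => rfl) (by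
      rintro y rfl; exact ⟨hxf.1, hxf.2⟩)
    obtain ⟨k, θ, P', rfl⟩ := exists_news A
    obtain ⟨N', rfl, rfl⟩ := flat_news_act ⟨N, hN⟩ hAf
    obtain rfl : N' = N := Option.some.inj hN
    obtain ⟨B, hB, hBf⟩ := ih' (π := .inp (C'.wk k) N') rfl (fun _ => wk_eq_subst C')
      (by simp [Label.bn])
    have hS : S.msg = none := by
      cases hS' : S.msg with
      | none => rfl
      | some N => exact absurd (h'.msg_isSome.2 ⟨N, hS'⟩) (by simp)
    refine ⟨_, .rep_close P C' C' x N' P' B hA hB (.refl _), ?_⟩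
    rw [flat_news, flat_parR, flat_parL, hBf]
    have hp := proc_rn_rn (.bang P) (Fin.castAdd k) S.ren
    simp only [Agent.closeL, Agent.parR, Agent.flat, hS, proc_wk_eq, Flat.under]
    simp only [Proc.repl] at hp ⊢
    rw [← hp]; rfl

/-! ## Transitions of extended processes -/

/-- Renaming of the bound names in an action. -/
def Label.rn {m n : ℕ} (w : Fin m → Fin n) : Label L m → Label L n
  | .tau => .tau
  | .out M x => .out (M.subst (AppliedPi.rn w)) x
  | .inp M N => .inp (M.subst (AppliedPi.rn w)) (N.subst (AppliedPi.rn w))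

theorem Label.wk_one {n : ℕ} (π : Label L n) : π.wk 1 = π.rn Fin.castSucc := by
  cases π <;> simp only [Label.wk, Label.rn, wk_one_eq]

theorem Label.rn_rn {k m n : ℕ} (π : Label L k) (w : Fin k → Fin m) (w' : Fin m → Fin n) :
    (π.rn w).rn w' = π.rn (w' ∘ w) := by
  cases π <;> simp only [Label.rn, msg_rn_rn]

theorem Label.rn_id {n : ℕ} (π : Label L n) : π.rn id = π := by
  cases π <;> simp only [Label.rn, msg_rn_id]

theorem ExtStep.flat {n : ℕ} {A B : Ext L n} {π : Label L n} (h : ExtStep E A π B) :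
    ∃ A', Step E A.flat.proc ((π.rn A.flat.ren).app A.flat.sub) A' ∧ A.flat.sub.FreshFor π.bn ∧
      B.flat = (Ext.addSubst A.flat.sub A').flat.under A.flat.ren := by
  induction h with
  | aliasing θ P π A h hθ =>
    refine ⟨A, ?_, hθ, rfl⟩
    simp only [Ext.flat, Label.rn_id]; exact h
  | res A π B _ ih =>
    obtain ⟨A', h1, h2, h3⟩ := ih
    rw [Label.wk_one, Label.rn_rn] at h1
    rw [Label.bn_wk] at h2
    refine ⟨A', h1, h2, ?_⟩
    rw [Ext.flat, h3]; rfl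

theorem exists_extStep {n : ℕ} (A : Ext L n) {π : Label L n}
    {A' : Ext L A.flat.scope} (h : Step E A.flat.proc ((π.rn A.flat.ren).app A.flat.sub) A')
    (hθ : A.flat.sub.FreshFor π.bn) : ∃ B, ExtStep E A π B ∧
      B.flat = (Ext.addSubst A.flat.sub A').flat.under A.flat.ren := by
  induction A with
  | act θ P =>
    simp only [Ext.flat, Label.rn_id] at h
    exact ⟨_, .aliasing _ _ _ _ h hθ, rfl⟩
  | new A ih =>
    obtain ⟨B, h1, h2⟩ := ih (π := π.wk 1) (A' := A') (by
      rw [Label.wk_one, Label.rn_rn]; exact h) (by rw [Label.bn_wk]; exact hθ)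
    refine ⟨.new B, .res _ _ _ h1, ?_⟩
    rw [Ext.flat, h2]; rfl

/-- The state of an extended process. -/
def Ext.st (A : Ext L 0) : State L := ⟨A.flat.scope, A.flat.sub, A.flat.proc⟩

theorem app_eq_ev {n : ℕ} (M : Msg L 0) (w : Fin 0 → Fin n) (θ : Subst L n) :
    Msg.app (M.subst (rn w)) θ = ev M θ := by
  rw [Msg.app, subst_subst, ev]
  exact subst_congr M (fun _ _ => rfl) (fun i => i.elim0)

theorem Label.kindAt_rn_app {n : ℕ} (π : Label L 0) (w : Fin 0 → Fin n) (θ : Subst L n) :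
    ((π.rn w).app θ).kindAt = π.kind θ := by
  cases π with
  | inp M N => simp only [Label.rn, Label.app, Label.kindAt, Label.kind, app_eq_ev]
  | _ => rfl

theorem Label.chanAt_rn_app {n : ℕ} (π : Label L 0) (w : Fin 0 → Fin n) (θ : Subst L n) :
    ((π.rn w).app θ).chanAt = π.chan θ := by
  cases π with
  | tau => rfl
  | _ => simp only [Label.rn, Label.app, Label.chanAt, Label.chan, app_eq_ev]

theorem Label.bv_rn_app {n : ℕ} (π : Label L 0) (w : Fin 0 → Fin n) (θ : Subst L n) :
    ((π.rn w).app θ).bv = π.bv := by cases π <;> rfl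

theorem Label.bn_rn_app {n : ℕ} (π : Label L 0) (w : Fin 0 → Fin n) (θ : Subst L n) :
    ((π.rn w).app θ).bn = π.bn := by cases π <;> rfl

theorem app_ident {n : ℕ} (M : Msg L n) : M.app Subst.ident = M := by
  exact (subst_congr M (s := Sum.elim Subst.ident fun i => Term.var (.inr i))
    (t := fun a => Term.var a) (fun _ _ => rfl) (fun _ => rfl)).trans (subst_var M)

theorem app_congr {n : ℕ} (M : Msg L n) {σ τ : Subst L n} (h : ∀ x ∈ M.fv, σ x = τ x) :
    M.app σ = M.app τ := subst_congr M h fun _ => rfl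

theorem app_self {n : ℕ} (M : Msg L n) {σ : Subst L n} (h : ∀ x ∈ M.fv, σ x = Term.var (.inl x)) :
    M.app σ = M := by rw [app_congr M h]; exact app_ident M

/-- Composing the active substitution with `{N/x}` only adds the value `N` at `x`: by freshness, `x`
is unassigned and occurs in no other value. -/
theorem flat_addSubst_next {W : Set ℕ} {A : State L} {π : Label L 0} {R : Agent L A.scope}
    (hR : A.Steps E W π R) (hθ : Subst.FreshFor A.asg π.bn) {A' : Ext L A.scope}
    (hA' : A'.flat = R.flat π.bv) : (Ext.addSubst A.asg A').flat =
      ⟨R.scope, R.ren, (A.next π.bv R).asg, (A.next π.bv R).proc⟩ := by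
  rw [flat_addSubst, hA']
  simp only [Agent.flat, State.next, Flat.mk.injEq, heq_eq_eq, and_true, true_and]
  have hm := CStep.msg_isSome hR
  funext y
  unfold nextA
  cases hN : R.msg with
  | none => simp only [Option.elim]; exact app_ident _
  | some N =>
    simp only [Option.elim]
    have hπ := hm.2 ⟨N, hN⟩
    cases π with
    | out M x =>
      simp only [Label.bv]
      have hx : A.asg x = Term.var (.inl x) := by
        by_contra hx; exact Set.disjoint_left.1 hθ.1 hx rfl
      by_cases hy : y = x
      · subst hy
        rw [Function.update_self, hx]
        exact Function.update_self (β := fun _ => Msg L R.scope) y N Subst.ident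
      · rw [Function.update_of_ne hy]
        refine app_self _ fun z hz => ?_
        have : z ≠ x := by
          rintro rfl
          rw [fv_rn] at hz
          exact Set.disjoint_left.1 (hθ.2 y hy) hz rfl
        rw [Subst.single, Function.update_of_ne this]; rfl
    | _ => simp [Label.kind] at hπ

theorem ExtStep.steps {A B : Ext L 0} {π : Label L 0} (h : ExtStep E A π B) :
    ∃ R, A.st.Steps E ∅ π R ∧ B.st = A.st.next π.bv R := by
  obtain ⟨A', h1, h2, h3⟩ := h.flat
  obtain ⟨R, h4, h5⟩ := h1.cstep
  rw [Label.kindAt_rn_app, Label.chanAt_rn_app] at h4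
  rw [Label.bv_rn_app] at h5
  refine ⟨R, h4, ?_⟩
  have := flat_addSubst_next (A := A.st) h4 h2 h5
  rw [Ext.st, h3]
  change State.mk ((Ext.addSubst A.st.asg A').flat).scope ((Ext.addSubst A.st.asg A').flat).sub
    ((Ext.addSubst A.st.asg A').flat).proc = _
  rw [this]; rfl

theorem Ext.exists_step (A : Ext L 0) {π : Label L 0} {R : Agent L A.st.scope}
    (h : A.st.Steps E ∅ π R) (hθ : Subst.FreshFor A.st.asg π.bn)
    (hx : ∀ x ∈ π.bn, x ∉ A.st.proc.fv ∧ x ∉ (π.chan A.st.asg).fv) :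
    ∃ B, ExtStep E A π B ∧ B.st = A.st.next π.bv R := by
  obtain ⟨A', h1, h2⟩ := CStep.step (n := A.flat.scope) (P := A.flat.proc)
    (K := π.kind A.flat.sub) (C := π.chan A.flat.sub) (R := R)
    (π := (π.rn A.flat.ren).app A.flat.sub) h
    (Label.kindAt_rn_app _ _ _) (fun _ => Label.chanAt_rn_app _ _ _)
    (by rw [Label.chanAt_rn_app, Label.bn_rn_app]; exact hx)
  rw [Label.bv_rn_app] at h2
  obtain ⟨B, h3, h4⟩ := exists_extStep A h1 hθ
  refine ⟨B, h3, ?_⟩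
  have := flat_addSubst_next (A := A.st) h hθ h2
  rw [Ext.st, h4]
  change State.mk ((Ext.addSubst A.st.asg A').flat).scope ((Ext.addSubst A.st.asg A').flat).sub
    ((Ext.addSubst A.st.asg A').flat).proc = _
  rw [this]; rfl

/-- The bound variable of an output is required to avoid the channel. This is needed later to
transfer the side condition to a bisimilar process, where it does not follow from freshness for that
process. -/
theorem Step.notMem_chan {n : ℕ} {P : Proc L n} {π : Label L n} {A : Ext L n}
    (h : Step E P π A) {x : ℕ} (hx : x ∈ π.bn) : x ∉ π.chanAt.fv := by
  induction h with
  | out M M' N P y _ _ h => obtain rfl : x = y := hx; exact h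
  | res P π A _ ih =>
    rw [Label.bn_wk, Label.chanAt_wk, wk_one_eq, fv_rn] at ih
    exact ih hx
  | sum_l _ _ _ _ _ ih => exact ih hx
  | sum_r _ _ _ _ _ ih => exact ih hx
  | mat _ _ _ _ _ _ _ ih => exact ih hx
  | mismat _ _ _ _ _ _ _ ih => exact ih hx
  | par_l _ _ _ _ _ _ ih => exact ih hx
  | par_r _ _ _ _ _ _ ih => exact ih hx
  | rep_act _ _ _ _ _ ih => exact ih hx
  | _ => exact absurd hx (by simp [Label.bn])

theorem ExtStep.notMem_chan {A B : Ext L 0} {π : Label L 0} (h : ExtStep E A π B) {x : ℕ}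
    (hx : x ∈ π.bn) : x ∉ (π.chan A.st.asg).fv := by
  obtain ⟨A', h1, -, -⟩ := h.flat
  have := h1.notMem_chan (x := x) (by rwa [Label.bn_rn_app])
  rwa [Label.chanAt_rn_app] at this

/-! ## Normal forms, static equivalence and reachability of states -/

/-- The domain of the active substitution. -/
def State.dom (A : State L) : Set ℕ := Subst.dom A.asg

/-- The free variables of a state. -/
def State.fv (A : State L) : Set ℕ :=
  (A.proc.fv : Set ℕ) ∪ A.dom ∪ {y | ∃ x ∈ A.dom, y ∈ (A.asg x).fv}

/-- Normal forms. -/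
def State.NF (A : State L) : Prop :=
  A.dom.Finite ∧ ∀ x ∈ A.dom, x ∉ A.proc.fv ∧ ∀ y, x ∉ (A.asg y).fv

theorem Ext.dom_flat {n : ℕ} (A : Ext L n) : A.dom = Subst.dom A.flat.sub := by
  induction A with
  | act θ P => rfl
  | new A ih => exact ih

theorem Ext.dom_st (A : Ext L 0) : A.dom = A.st.dom := A.dom_flat

theorem Ext.fv_flat {n : ℕ} (A : Ext L n) : A.fv = (A.flat.proc.fv : Set ℕ) ∪
    Subst.dom A.flat.sub ∪ {y | ∃ x ∈ Subst.dom A.flat.sub, y ∈ (A.flat.sub x).fv} := by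
  induction A with
  | act θ P => rfl
  | new A ih => exact ih

theorem Ext.fv_st (A : Ext L 0) : A.fv = A.st.fv := A.fv_flat

theorem Ext.nf_flat {n : ℕ} (A : Ext L n) : A.NF ↔ (Subst.dom A.flat.sub).Finite ∧
    ∀ x ∈ Subst.dom A.flat.sub, x ∉ A.flat.proc.fv ∧ ∀ y, x ∉ (A.flat.sub y).fv := by
  induction A with
  | act θ P => rfl
  | new A ih => exact ih

theorem Ext.nf_st (A : Ext L 0) : A.NF ↔ A.st.NF := A.nf_flat

theorem Ext.equates_flat {n : ℕ} (A : Ext L n) (M N : Msg L n) : A.Equates E M N ↔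
    EqE E (Msg.app (M.subst (rn A.flat.ren)) A.flat.sub)
      (Msg.app (N.subst (rn A.flat.ren)) A.flat.sub) := by
  induction A with
  | act θ P => simp only [Ext.flat, msg_rn_id]; rfl
  | new A ih =>
    rw [Ext.Equates, ih, wk_one_eq, wk_one_eq, msg_rn_rn, msg_rn_rn]; rfl

theorem Ext.equates_st (A : Ext L 0) (M N : Msg L 0) : A.Equates E M N ↔
    EqE E (ev M A.st.asg) (ev N A.st.asg) := by
  rw [A.equates_flat, app_eq_ev, app_eq_ev]; rfl

theorem State.NF.finite_fv {A : State L} (h : A.NF) : A.fv.Finite := by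
  refine ((Finset.finite_toSet _).union h.1).union ?_
  have : {y | ∃ x ∈ A.dom, y ∈ (A.asg x).fv} = ⋃ x ∈ A.dom, ((A.asg x).fv : Set ℕ) := by
    ext y; simp
  rw [this]
  exact h.1.biUnion fun x _ => Finset.finite_toSet _

theorem State.plain (A : State L) : A.Plain A.dom := fun x hx => by
  by_contra h; exact hx h

theorem State.mem_fv_asg {A : State L} {x y : ℕ} (h : y ∈ (A.asg x).fv) : y ∈ A.fv ∨ y = x := by
  by_cases hx : x ∈ A.dom
  · exact .inl (.inr ⟨x, hx, h⟩)
  · rw [A.plain x hx] at h; exact .inr (by simpa using h)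

/-- Opening of a state. -/
def State.open {m : ℕ} (A : State L) (o : Fin A.scope → ℕ ⊕ Fin m) : State L :=
  ⟨m, fun x => (A.asg x).subst (opn o), A.proc.repl (opn o)⟩

theorem nextA_opn {A : State L} {π : Label L 0} {R : Agent L A.scope}
    {m m' : ℕ} {o : Fin A.scope → ℕ ⊕ Fin m}
    {o' : Fin R.scope → ℕ ⊕ Fin m'} {w : Fin m → Fin m'} (h : ∀ i, o' (R.ren i) = Sum.map id w (o i))
    {N' : Option (Msg L m')} (hN : N' = R.msg.map fun N => N.subst (opn o')) (P : Proc L m') :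
    nextA (A.open o).asg π.bv ⟨m', w, N', P⟩ = fun x => (nextA A.asg π.bv R x).subst (opn o') := by
  subst hN
  have key : ∀ M : Msg L A.scope,
      (M.subst (rn R.ren)).subst (opn o') = (M.subst (opn o)).subst (rn w) := by
    intro M
    refine subst_comm M fun a => ?_
    rcases a with x | i
    · rfl
    · simp only [rn_inr, subst_var_apply, opn_inr, h]
      rcases o i with x | j <;> rfl
  funext x
  cases hR' : R.msg with
  | none => simp only [nextA, hR', Option.map_none, key]; rfl
  | some N =>
    simp only [nextA, hR', Option.map_some, Function.update_apply]
    split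
    · rfl
    · rw [key]; rfl

/-- The free variables of an action, evaluated at a state. -/
theorem State.steps_open {A : State L} {π : Label L 0} {R : Agent L A.scope} {W : Set ℕ} {m : ℕ}
    {o : Fin A.scope → ℕ ⊕ Fin m} (ho : IsOpening o) (hoW : names o ⊆ W) (hW : Wᶜ.Infinite)
    (hP : ∀ x ∈ A.proc.fv, x ∉ W) (hK : ∀ x ∈ (π.kind A.asg).fv, x ∉ W)
    (hC : ∀ x ∈ (π.chan A.asg).fv, π ≠ .tau → x ∉ W) (hR : A.Steps E ∅ π R) :
    ∃ (R' : Agent L m) (o' : Fin R.scope → ℕ ⊕ Fin R'.scope), (A.open o).Steps E W π R' ∧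
      IsOpening o' ∧ names o' = names o ∧
      (A.open o).next π.bv R' = (A.next π.bv R).open o' := by
  obtain ⟨c, hc⟩ := hW.nonempty
  -- Transport goes along `opnAvoid`, which is good; it agrees with `opn` on this state because the
  -- private variables do not occur in it.
  obtain ⟨R', u', h, hu⟩ := CStep.transport hR (ho.good_opnAvoid fun hn => hc (hoW hn))
  obtain ⟨o', rfl, ho'⟩ := hu.lifts.opnAvoid ho
  rw [proc_opnAvoid o fun x hx hn => hP x hx (hoW hn)] at h
  have h1 := h.adm (adm_ident hW hoW)
  simp only [fs_ident, repl_var, Kind.repl_var, subst_var, Agent.fs_self] at h1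
  have hRn : ∀ x ∈ W, x ∉ R.proc.fv ∧ ∀ N, R.msg = some N → x ∉ N.fv := fun x hx =>
    CStep.notMem_fv hR (fun h => hP x h hx) (fun h => hK x h hx)
  have hkind : (π.kind A.asg).repl (opnAvoid c o) = π.kind (A.open o).asg := by
    cases π with
    | inp M N =>
      simp only [Label.kind, Kind.repl]
      rw [msg_opnAvoid o fun x hx hn => hK x hx (hoW hn), ev_subst]; rfl
    | _ => rfl
  rw [hkind] at h1
  refine ⟨R', o', ?_, ho'.isOpening, ho'.names_eq, ?_⟩
  · refine h1.chan fun hτ' => ?_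
    have hτ : π ≠ .tau := fun e => hτ' (Label.kind_tau_iff.2 e)
    rw [msg_opnAvoid o fun x hx hn => hC x hx hτ (hoW hn)]
    refine .of_eq _ ?_
    cases π with
    | tau => exact absurd rfl hτ
    | _ => simp only [Label.chan, ev_subst]; rfl
  · have hmsg : R'.msg = R.msg.map fun N => N.subst (opn o') := by
      rw [hu.msg]
      cases hN : R.msg with
      | none => rfl
      | some N =>
        simp only [Option.map_some]
        rw [msg_opnAvoid o' fun x hx hn => (hRn x (hoW (ho'.names_eq ▸ hn))).2 N hN hx]
    have hproc : R'.proc = R.proc.repl (opn o') := by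
      rw [hu.proc, proc_opnAvoid o' fun x hx hn => (hRn x (hoW (ho'.names_eq ▸ hn))).1 hx]
    simp only [State.next, State.open, State.mk.injEq, heq_eq_eq, true_and]
    exact ⟨nextA_opn ho'.comm hmsg R'.proc, hproc⟩

/-- Private variables outside the opening do not occur and are forgotten, and the others are closed
again by a good replacement. -/
theorem State.steps_of_open {A : State L} {π : Label L 0} {W : Set ℕ} {m : ℕ}
    {o : Fin A.scope → ℕ ⊕ Fin m} {R' : Agent L m} (ho : IsOpening o) (hoW : names o ⊆ W)
    (hW : Wᶜ.Infinite) (hP : ∀ x ∈ A.proc.fv, x ∉ W) (hK : ∀ x ∈ (π.kind A.asg).fv, x ∉ W)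
    (hC : ∀ x ∈ (π.chan A.asg).fv, π ≠ .tau → x ∉ W) (hR : (A.open o).Steps E W π R') :
    ∃ (R : Agent L A.scope) (o' : Fin R.scope → ℕ ⊕ Fin R'.scope), A.Steps E ∅ π R ∧
      IsOpening o' ∧ names o' = names o ∧
      (A.open o).next π.bv R' = (A.next π.bv R).open o' := by
  have hopn : ∀ {M : Msg L A.scope}, (∀ x ∈ M.fv, x ∉ W) → ∀ x ∈ Msg.fv (M.subst (opn o)), x ∈ W →
      x ∈ names o := by
    intro M hM x hx hxW
    rcases mem_fv_subst M _ x hx with ⟨y, hy, hxy⟩ | ⟨i, hi⟩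
    · simp only [opn_inl, fv_var_inl, Finset.mem_singleton] at hxy
      subst hxy; exact absurd hxW (hM _ hy)
    · refine ⟨i, ?_⟩
      simp only [opn_inr] at hi
      cases h : o i with
      | inl y => rw [h] at hi; simp at hi; rw [hi]
      | inr j => rw [h] at hi; simp at hi
  have hkind : (π.kind A.asg).repl (opn o) = π.kind (A.open o).asg := by
    cases π with
    | inp M N => simp only [Label.kind, Kind.repl, ev_subst]; rfl
    | _ => rfl
  have hP' : ∀ x ∈ (A.open o).proc.fv, x ∈ W → x ∈ names o := by
    intro x hx hxW
    by_contra hxo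
    refine notMem_fv_repl A.proc (s := opn o) (y := x) (fun y hy h => ?_) (fun i h => ?_) hx
    · simp only [opn_inl, fv_var_inl, Finset.mem_singleton] at h
      subst h; exact hP _ hy hxW
    · refine hxo ⟨i, ?_⟩
      simp only [opn_inr] at h
      cases h' : o i with
      | inl y => rw [h'] at h; simp at h; rw [h]
      | inr j => rw [h'] at h; simp at h
  have hK' : ∀ x ∈ (π.kind (A.open o).asg).fv, x ∈ W → x ∈ names o := by
    rw [← hkind]
    cases π with
    | inp M N => exact hopn hK
    | _ => intro x hx; exact absurd hx (by simp [Label.kind, Kind.repl, Kind.fv])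
  have h1 : CStep E (names o) (A.proc.repl (opn o)) ((π.kind A.asg).repl (opn o))
      (π.chan (A.open o).asg) R' := by
    rw [hkind]; exact CStep.of_unused hR hoW (names_finite o) hW hP' hK'
  obtain ⟨R, u', h, hu⟩ := h1.transport ho.good_cls
  obtain ⟨o', rfl, ho'⟩ := hu.lifts.cls ho
  have hAK : ((π.kind A.asg).repl (opn o)).repl (cls o) = π.kind A.asg := by
    cases π with
    | inp M N =>
      exact congrArg Kind.inp (ho.msg_opn_cls fun x hx hn => hK x hx (hoW hn))
    | _ => rfl
  rw [ho.proc_opn_cls fun x hx hn => hP x hx (hoW hn), hAK] at h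
  have hstep : A.Steps E ∅ π R := by
    refine h.chan fun hτ' => ?_
    have hτ : π ≠ .tau := fun e => hτ' (Label.kind_tau_iff.2 e)
    refine .of_eq _ ?_
    have hCo := fun x hx => hC x hx hτ
    cases π with
    | tau => exact absurd rfl hτ
    | out M x =>
      have := ho.msg_opn_cls (M := ev M A.asg) fun x hx hn => hCo x hx (hoW hn)
      rw [ev_subst] at this; exact this
    | inp M N =>
      have := ho.msg_opn_cls (M := ev M A.asg) fun x hx hn => hCo x hx (hoW hn)
      rw [ev_subst] at this; exact this
  refine ⟨R, o', hstep, ho'.isOpening, ho'.names_eq, ?_⟩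
  simp only [State.next, State.open, State.mk.injEq, heq_eq_eq, true_and]
  refine ⟨nextA_opn ho'.comm ?_ R'.proc, ?_⟩
  · rw [hu.msg]
    cases R'.msg with
    | none => rfl
    | some N => simp only [Option.map_some, ho'.isOpening.msg_cls_opn]
  · rw [hu.proc, ho'.isOpening.proc_cls_opn]

/-! ## Reachability of states -/

/-- The bound names that are not in the old scopes correspond to each other. -/
theorem Lifts.fresh {m n m' n' : ℕ} {u : Repl L m n} {u' : Repl L m' n'} {w : Fin m → Fin m'}
    {w' : Fin n → Fin n'} (h : Lifts u' u w w') : Function.Injective w ∧ Function.Injective w' ∧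
      (∀ i, i ∉ Set.range w → ∃ j, j ∉ Set.range w' ∧ u' (.inr i) = Term.var (.inr j)) ∧
      (∀ j, j ∉ Set.range w' → ∃ i, i ∉ Set.range w ∧ u' (.inr i) = Term.var (.inr j)) ∧
      ∀ i i', i ∉ Set.range w → i' ∉ Set.range w → u' (.inr i) = u' (.inr i') → i = i' := by
  induction h with
  | refl =>
    exact ⟨Function.injective_id, Function.injective_id, fun i h => absurd ⟨i, rfl⟩ h,
      fun i h => absurd ⟨i, rfl⟩ h, fun i _ h => absurd ⟨i, rfl⟩ h⟩
  | @step m n u w w' hl ih =>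
    obtain ⟨h1, h2, h3, h4, h5⟩ := ih
    have hlast : u' (.inr (w (Fin.last m))) = Term.var (.inr (w' (Fin.last n))) := by
      have := hl.square (.inr (Fin.last m))
      simpa using this
    have key : ∀ {a b : ℕ} (w : Fin (a + 1) → Fin b) (i : Fin b),
        i ∉ Set.range (w ∘ Fin.castSucc) → i = w (Fin.last a) ∨ i ∉ Set.range w := by
      intro a b w i hi
      by_contra hn
      push Not at hn
      obtain ⟨hn, j, rfl⟩ := hn
      induction j using Fin.lastCases with
      | last => exact hn rfl
      | cast j => exact hi ⟨j, rfl⟩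
    have key' : ∀ {a b : ℕ} {w : Fin (a + 1) → Fin b}, Function.Injective w →
        w (Fin.last a) ∉ Set.range (w ∘ Fin.castSucc) := by
      rintro a b w hw ⟨j, hj⟩
      exact Fin.castSucc_ne_last j (hw hj)
    have sub : ∀ {a b : ℕ} (w : Fin (a + 1) → Fin b) (i : Fin b), i ∉ Set.range w →
        i ∉ Set.range (w ∘ Fin.castSucc) := by
      rintro a b w i hi ⟨j, hj⟩; exact hi ⟨_, hj⟩
    refine ⟨h1.comp (Fin.castSucc_injective _), h2.comp (Fin.castSucc_injective _), ?_, ?_, ?_⟩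
    · intro i hi
      rcases key w i hi with rfl | hi
      · exact ⟨_, key' h2, hlast⟩
      · obtain ⟨j, hj, h⟩ := h3 i hi
        exact ⟨j, sub w' j hj, h⟩
    · intro j hj
      rcases key w' j hj with rfl | hj
      · exact ⟨_, key' h1, hlast⟩
      · obtain ⟨i, hi, h⟩ := h4 j hj
        exact ⟨i, sub w i hi, h⟩
    · intro i i' hi hi' he
      rcases key w i hi with rfl | hi <;> rcases key w i' hi' with rfl | hi'
      · rfl
      · obtain ⟨j, hj, h⟩ := h3 i' hi'
        rw [hlast, h] at he
        exact absurd ⟨_, by simpa using he⟩ hj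
      · obtain ⟨j, hj, h⟩ := h3 i hi
        rw [hlast, h] at he
        exact absurd ⟨_, by simpa using he.symm⟩ hj
      · exact h5 i i' hi hi' he

open Classical in
theorem flat_repl {n m : ℕ} (A : Ext L n) (s : Repl L n m) :
    ∃ s' : Repl L A.flat.scope (A.repl s).flat.scope,
      Lifts s' s A.flat.ren (A.repl s).flat.ren ∧ (A.repl s).flat.proc = A.flat.proc.repl s' ∧
      (A.repl s).flat.sub = fun x => if x ∈ Subst.dom A.flat.sub then (A.flat.sub x).subst s'
        else Term.var (.inl x) := by
  induction A generalizing m with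
  | act θ P => exact ⟨s, .refl, rfl, rfl⟩
  | new A ih =>
    obtain ⟨s', h1, h2, h3⟩ := ih s.lift
    exact ⟨s', .step _ _ _ h1, h2, h3⟩

/-- The replacement of an extension of the environment: `w` embeds the new names of the environment,
and `g` embeds the bound names of the process. -/
def envRepl {k n m : ℕ} (σ : Subst L 0) (ρ : Subst L (0 + k)) (w : Fin (0 + k) → Fin m)
    (g : Fin n → Fin m) : Repl L n m :=
  Sum.elim (fun x => Term.subst (Msg.app ((σ x).wk k) ρ) (rn w)) (fun i => Term.var (.inr (g i)))

/-- The conditions for reachability by `σ` and `ρ` for the domain `D`. -/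
structure Ready (σ : Subst L 0) {k : ℕ} (ρ : Subst L (0 + k)) (D : Set ℕ) : Prop where
  finite_left : σ.dom.Finite
  idem_left : σ.Idempotent
  fresh_left : σ.FreshFor D
  finite_right : ρ.dom.Finite
  idem_right : ρ.Idempotent
  fresh_right : ρ.FreshFor D

/-- Reachability of states, where `w` and `g` embed the names of the environment and of the
process. -/
structure ReachSt (σ : Subst L 0) {k : ℕ} (ρ : Subst L (0 + k)) (A A' : State L)
    (w : Fin (0 + k) → Fin A'.scope) (g : Fin A.scope → Fin A'.scope) : Prop where
  inj_w : Function.Injective w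
  inj_g : Function.Injective g
  ne : ∀ i l, g i ≠ w l
  surj : ∀ j, (∃ i, g i = j) ∨ ∃ l, w l = j
  proc : A'.proc = A.proc.repl (envRepl σ ρ w g)
  asg : ∀ x ∈ A.dom, A'.asg x = (A.asg x).subst (envRepl σ ρ w g)
  asg_new : ∀ x, x ∉ A.dom → A'.asg x = (ρ x).subst (rn w)

theorem reach_iff {A B : Ext L 0} {σ : Subst L 0} {k : ℕ} {ρ : Subst L (0 + k)} :
    Reach A σ k ρ B ↔ Ready σ ρ A.dom ∧ B = Ext.news k (Ext.addSubst ρ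
      (A.repl (Sum.elim (fun x => ((σ x).wk k).app ρ) Fin.elim0))) :=
  ⟨fun ⟨h1, h2, h3, h4, h5, h6, h7⟩ => ⟨⟨h1, h2, h3, h4, h5, h6⟩, h7⟩,
    fun ⟨⟨h1, h2, h3, h4, h5, h6⟩, h7⟩ => ⟨h1, h2, h3, h4, h5, h6, h7⟩⟩

-- The outer scope is empty, so all bound names of `A` count as new and correspond to names of `B`
-- outside the image of the environment. This yields the embedding `g`, complementary to that of the
-- environment.
open Classical in
theorem Lifts.reachSt {A : Ext L 0} {σ : Subst L 0} {k : ℕ} {ρ : Subst L (0 + k)}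
    (hr : Ready σ ρ A.dom) {B : Ext L (0 + k)} {s' : Repl L A.flat.scope B.flat.scope}
    (h1 : Lifts s' (Sum.elim (fun x => ((σ x).wk k).app ρ) Fin.elim0) A.flat.ren B.flat.ren)
    (h2 : B.flat.proc = A.flat.proc.repl s')
    (h3 : B.flat.sub = fun x => if x ∈ Subst.dom A.flat.sub then (A.flat.sub x).subst s'
        else Term.var (.inl x)) :
    ∃ g, ReachSt σ ρ A.st ⟨B.flat.scope,
      fun x => Msg.app ((ρ x).subst (rn B.flat.ren)) B.flat.sub, B.flat.proc⟩ B.flat.ren g := by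
  obtain ⟨-, h5, h6, h7, h8⟩ := h1.fresh
  have hrange : ∀ i, i ∉ Set.range A.flat.ren := by rintro i ⟨j, -⟩; exact j.elim0
  choose g hg1 hg2 using fun i => h6 i (hrange i)
  have hs' : s' = envRepl σ ρ B.flat.ren g := by
    funext a
    rcases a with x | i
    · exact h1.square (.inl x)
    · exact hg2 i
  have hdom : A.dom = Subst.dom A.flat.sub := A.dom_flat
  refine ⟨g, h5, ?_, fun i l hil => hg1 i ⟨l, hil.symm⟩, ?_, ?_, ?_, ?_⟩
  · intro (i : Fin A.flat.scope) (i' : Fin A.flat.scope) hii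
    exact h8 i i' (hrange i) (hrange i') ((hg2 i).trans (hii ▸ (hg2 i').symm))
  · intro (j : Fin B.flat.scope)
    by_cases hj : j ∈ Set.range B.flat.ren
    · exact .inr hj
    · obtain ⟨i, -, hi⟩ := h7 j hj
      refine .inl ⟨i, ?_⟩
      rw [hg2] at hi
      simpa using hi
  · exact hs' ▸ h2
  · intro x hx
    have hxd : x ∈ Subst.dom A.flat.sub := hx
    have hρ : ρ x = Term.var (.inl x) := by
      by_contra hn
      exact Set.disjoint_left.1 hr.fresh_right.1 hn (hdom ▸ hxd)
    refine Eq.trans ?_ (congrArg (fun t => (A.flat.sub x).subst t) hs')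
    change Msg.app ((ρ x).subst (rn B.flat.ren)) B.flat.sub = _
    rw [hρ]
    change B.flat.sub x = _
    rw [h3]
    exact if_pos hxd
  · intro x hx
    refine app_self _ fun y hy => ?_
    rw [fv_rn] at hy
    rw [h3]
    refine if_neg fun hyd => ?_
    have hx' : x ∉ A.dom := fun hx' => hx (show x ∈ Subst.dom A.flat.sub from hdom ▸ hx')
    exact Set.disjoint_left.1 (hr.fresh_right.2 x hx') hy (hdom ▸ hyd)

theorem Reach.st {A B : Ext L 0} {σ : Subst L 0} {k : ℕ} {ρ : Subst L (0 + k)}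
    (h : Reach A σ k ρ B) : ∃ w g, ReachSt σ ρ A.st B.st w g := by
  obtain ⟨hr, rfl⟩ := reach_iff.1 h
  obtain ⟨s', h1, h2, h3⟩ := flat_repl A (Sum.elim (fun x => ((σ x).wk k).app ρ) Fin.elim0)
  have key := Lifts.reachSt hr h1 h2 h3
  generalize A.repl (Sum.elim (fun x => ((σ x).wk k).app ρ) Fin.elim0) = B at key
  have hst : (Ext.news k (Ext.addSubst ρ B)).st = ⟨B.flat.scope,
      fun x => Msg.app ((ρ x).subst (rn B.flat.ren)) B.flat.sub, B.flat.proc⟩ := by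
    rw [Ext.st, flat_news, flat_addSubst]; rfl
  rw [hst]
  exact ⟨_, key⟩

theorem eq_of_app_eq_self {n : ℕ} {M : Msg L n} {σ : Subst L n} (h : M.app σ = M) {x : ℕ}
    (hx : x ∈ M.fv) : σ x = Term.var (.inl x) := by
  induction M with
  | var a =>
    rcases a with y | i
    · obtain rfl : x = y := by simpa using hx
      exact h
    · simp at hx
  | func f ts ih =>
    obtain ⟨i, hi⟩ := (mem_fv_func f ts x).1 hx
    simp only [Msg.app, Term.subst, Term.func.injEq, heq_eq_eq, true_and] at h
    exact ih i (congrFun h i) hi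

/-- An idempotent substitution fixes its own values, hence fixes each variable in them. -/
theorem Subst.Idempotent.notMem_fv {n : ℕ} {σ : Subst L n} (h : σ.Idempotent) {x : ℕ}
    (hx : x ∈ σ.dom) (y : ℕ) : x ∉ (σ y).fv := fun hxy =>
  hx (eq_of_app_eq_self (congrFun h y) hxy)

theorem mem_fv_app {n : ℕ} {M : Msg L n} {σ : Subst L n} {y : ℕ} (h : y ∈ (M.app σ).fv) :
    ∃ x ∈ M.fv, y ∈ (σ x).fv := by
  rcases mem_fv_subst M _ y h with h | ⟨i, hi⟩
  · exact h
  · simp at hi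

theorem mem_fv_env {σ : Subst L 0} {k : ℕ} {ρ : Subst L (0 + k)} {x y : ℕ}
    (h : y ∈ (Msg.app ((σ x).wk k) ρ).fv) : ∃ z ∈ (σ x).fv, y ∈ (ρ z).fv := by
  obtain ⟨z, hz, h⟩ := mem_fv_app h
  rw [wk_eq_subst, fv_rn] at hz
  exact ⟨z, hz, h⟩

theorem Ready.notMem_fv_env {σ : Subst L 0} {k : ℕ} {ρ : Subst L (0 + k)} {D : Set ℕ}
    (h : Ready σ ρ D) {x y : ℕ} (hx : x ∈ D ∨ x ∈ ρ.dom) (hy : y ∉ D) :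
    x ∉ (Msg.app ((σ y).wk k) ρ).fv := by
  intro hxy
  obtain ⟨z, hz, hxz⟩ := mem_fv_env hxy
  have hzD : z ∉ D := Set.disjoint_left.1 (h.fresh_left.2 y hy) hz
  rcases hx with hx | hx
  · exact Set.disjoint_left.1 (h.fresh_right.2 z hzD) hxz hx
  · exact h.idem_right.notMem_fv hx z hxz

theorem mem_fv_envRepl {σ : Subst L 0} {k : ℕ} {ρ : Subst L (0 + k)} {n m : ℕ}
    {w : Fin (0 + k) → Fin m} {g : Fin n → Fin m} {M : Msg L n} {y : ℕ}
    (h : y ∈ Msg.fv (M.subst (envRepl σ ρ w g))) :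
    ∃ x ∈ M.fv, y ∈ (Msg.app ((σ x).wk k) ρ).fv := by
  rcases mem_fv_subst M _ y h with ⟨x, hx, h⟩ | ⟨i, hi⟩
  · exact ⟨x, hx, by simpa [envRepl] using h⟩
  · simp [envRepl] at hi

section ReachSt

variable {σ : Subst L 0} {k : ℕ} {ρ : Subst L (0 + k)} {A A' : State L}
  {w : Fin (0 + k) → Fin A'.scope} {g : Fin A.scope → Fin A'.scope}

theorem ReachSt.mem_fv_proc (h : ReachSt σ ρ A A' w g) {y : ℕ} (hy : y ∈ A'.proc.fv) :
    ∃ x ∈ A.proc.fv, y ∈ (Msg.app ((σ x).wk k) ρ).fv := by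
  by_contra hn
  push Not at hn
  rw [h.proc] at hy
  refine notMem_fv_repl A.proc (fun x hx => ?_) (fun i => ?_) hy
  · simpa [envRepl] using hn x hx
  · simp [envRepl]

/-- Freshness keeps the old aliases out of all new messages, and idempotence keeps out the aliases
introduced by `ρ`. -/
theorem ReachSt.nf (h : ReachSt σ ρ A A' w g) (hr : Ready σ ρ A.dom) (hA : A.NF) :
    A'.NF ∧ A'.dom = A.dom ∪ ρ.dom := by
  have h1 : ∀ x, x ∈ A.dom ∨ x ∈ ρ.dom → ∀ y, x ∉ (A'.asg y).fv := by
    intro x hx y hxy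
    by_cases hy : y ∈ A.dom
    · rw [h.asg y hy] at hxy
      obtain ⟨z, hz, hxz⟩ := mem_fv_envRepl hxy
      exact hr.notMem_fv_env hx (fun hzD => (hA.2 z hzD).2 y hz) hxz
    · rw [h.asg_new y hy, fv_rn] at hxy
      rcases hx with hx | hx
      · exact Set.disjoint_left.1 (hr.fresh_right.2 y hy) hxy hx
      · exact hr.idem_right.notMem_fv hx y hxy
  have hdom : A'.dom = A.dom ∪ ρ.dom := by
    ext x
    constructor
    · intro hx
      by_contra hn
      simp only [Set.mem_union, not_or] at hn
      refine hx ?_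
      rw [h.asg_new x hn.1, show ρ x = Term.var (.inl x) from by by_contra h'; exact hn.2 h']
      rfl
    · intro hx he
      exact h1 x hx x (by rw [he]; simp)
  refine ⟨⟨hdom ▸ hA.1.union hr.finite_right, fun x hx => ?_⟩, hdom⟩
  rw [hdom] at hx
  refine ⟨fun hxp => ?_, h1 x hx⟩
  obtain ⟨z, hz, hxz⟩ := h.mem_fv_proc hxp
  exact hr.notMem_fv_env hx (fun hzD => (hA.2 z hzD).1 hz) hxz

theorem ReachSt.mem_fv (h : ReachSt σ ρ A A' w g) (hr : Ready σ ρ A.dom) (hA : A.NF) {y : ℕ}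
    (hy : y ∈ A'.fv) : y ∈ A.dom ∨ y ∈ ρ.dom ∨
      (∃ x ∈ A.fv, x ∉ A.dom ∧ y ∈ (Msg.app ((σ x).wk k) ρ).fv) ∨ ∃ x ∈ ρ.dom, y ∈ (ρ x).fv := by
  rcases hy with (hy | hy) | ⟨x, hx, hy⟩
  · obtain ⟨x, hx, hy⟩ := h.mem_fv_proc hy
    exact .inr (.inr (.inl ⟨x, .inl (.inl hx), fun hxD => (hA.2 x hxD).1 hx, hy⟩))
  · rw [(h.nf hr hA).2] at hy
    exact hy.imp id .inl
  · by_cases hxD : x ∈ A.dom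
    · rw [h.asg x hxD] at hy
      obtain ⟨z, hz, hy⟩ := mem_fv_envRepl hy
      exact .inr (.inr (.inl ⟨z, .inr ⟨x, hxD, hz⟩, fun hzD => (hA.2 z hzD).2 x hz, hy⟩))
    · rw [(h.nf hr hA).2] at hx
      rw [h.asg_new x hxD, fv_rn] at hy
      exact .inr (.inr (.inr ⟨x, hx.resolve_left hxD, hy⟩))

/-- `s` is the substitution that belongs to `σ` and `ρ`, for openings of the two states. -/
structure Realizes (σ : Subst L 0) {k : ℕ} (ρ : Subst L (0 + k)) {A A' : State L}
    (w : Fin (0 + k) → Fin A'.scope) (g : Fin A.scope → Fin A'.scope) {m : ℕ}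
    (o : Fin A.scope → ℕ ⊕ Fin m) (o' : Fin A'.scope → ℕ ⊕ Fin m) (X : Set ℕ) (s : Subst L 0) :
    Prop where
  free : ∀ x ∈ X, x ∉ A.dom →
    (Term.subst (Msg.app ((σ x).wk k) ρ) (rn w)).subst (opn o') = (s x).emb m
  bound : ∀ i, (Term.var (o' (g i)) : Msg L m) = (Term.var (o i) : Msg L m).subst (fs s m)

variable {m : ℕ} {o : Fin A.scope → ℕ ⊕ Fin m} {o' : Fin A'.scope → ℕ ⊕ Fin m} {X : Set ℕ}
  {s : Subst L 0}

theorem Realizes.msg (h : Realizes σ ρ w g o o' X s) {M : Msg L A.scope}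
    (hM : ∀ x ∈ M.fv, x ∈ X ∧ x ∉ A.dom) :
    (M.subst (envRepl σ ρ w g)).subst (opn o') = (M.subst (opn o)).subst (fs s m) := by
  rw [subst_subst, subst_subst]
  exact subst_congr M (fun x hx => h.free x (hM x hx).1 (hM x hx).2) h.bound

theorem Realizes.proc (h : Realizes σ ρ w g o o' X s) {P : Proc L A.scope}
    (hP : ∀ x ∈ P.fv, x ∈ X ∧ x ∉ A.dom) :
    (P.repl (envRepl σ ρ w g)).repl (opn o') = (P.repl (opn o)).repl (fs s m) := by
  rw [repl_repl, repl_repl]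
  exact repl_congr P (fun x hx => h.free x (hP x hx).1 (hP x hx).2) h.bound

theorem ReachSt.open_proc (h : ReachSt σ ρ A A' w g) (hA : A.NF) (hX : A.fv ⊆ X)
    (hs : Realizes σ ρ w g o o' X s) :
    A'.proc.repl (opn o') = (A.proc.repl (opn o)).repl (fs s m) := by
  rw [h.proc]
  exact hs.proc fun x hx => ⟨hX (.inl (.inl hx)), fun hxD => (hA.2 x hxD).1 hx⟩

theorem ReachSt.open_asg (h : ReachSt σ ρ A A' w g) (hA : A.NF) (hX : A.fv ⊆ X)
    (hs : Realizes σ ρ w g o o' X s) {x : ℕ} (hx : x ∈ A.dom) :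
    (A'.asg x).subst (opn o') = ((A.asg x).subst (opn o)).subst (fs s m) := by
  rw [h.asg x hx]
  exact hs.msg fun y hy => ⟨hX (.inr ⟨x, hx, hy⟩), fun hyD => (hA.2 y hyD).2 x hy⟩

/-- The key to instantiating formulae: evaluating `xσ` after the extension amounts to evaluating `x`
before it and then applying the substitution `s` of the opened states. -/
theorem ReachSt.open_ev (h : ReachSt σ ρ A A' w g) (hr : Ready σ ρ A.dom) (hA : A.NF)
    (hX : A.fv ⊆ X) (hs : Realizes σ ρ w g o o' X s) {x : ℕ} (hx : x ∈ X) :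
    (ev (σ x) A'.asg).subst (opn o') = ((A.asg x).subst (opn o)).subst (fs s m) := by
  by_cases hxD : x ∈ A.dom
  · have : σ x = Term.var (.inl x) := by
      by_contra hn; exact Set.disjoint_left.1 hr.fresh_left.1 hn hxD
    rw [this, ev_var, h.open_asg hA hX hs hxD]
  · rw [A.plain x hxD]
    change _ = (s x).emb m
    rw [← hs.free x hx hxD]
    congr 1
    rw [ev_congr (σ x) (Δ' := fun y => (ρ y).subst (rn w)) fun y hy =>
      h.asg_new y (Set.disjoint_left.1 (hr.fresh_left.2 x hxD) hy)]
    rw [← ev_subst]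
    congr 1
    rw [Msg.app, wk_eq_subst, subst_subst, ev]
    exact subst_congr _ (fun _ _ => rfl) (fun i => i.elim0)

end ReachSt

/-! ## Transitions of opened extended processes -/

theorem State.mem_fv_kind {A : State L} {π : Label L 0} {y : ℕ} (h : y ∈ (π.kind A.asg).fv) :
    ∃ x ∈ π.fv, y ∈ (A.asg x).fv := by
  cases π with
  | inp M N =>
    obtain ⟨x, hx, h⟩ := (mem_fv_ev N A.asg y).1 h
    exact ⟨x, Finset.mem_union_right _ hx, h⟩
  | _ => simp [Label.kind, Kind.fv] at h

theorem State.mem_fv_chan {A : State L} {π : Label L 0} {y : ℕ} (h : y ∈ (π.chan A.asg).fv)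
    (hπ : π ≠ .tau) : ∃ x ∈ π.fv, y ∈ (A.asg x).fv := by
  cases π with
  | tau => exact absurd rfl hπ
  | out M z => exact (mem_fv_ev M A.asg y).1 h
  | inp M N =>
    obtain ⟨x, hx, h⟩ := (mem_fv_ev M A.asg y).1 h
    exact ⟨x, Finset.mem_union_left _ hx, h⟩

theorem Label.ne_tau_of_mem_bn {π : Label L 0} {x : ℕ} (h : x ∈ π.bn) : π ≠ .tau := by
  rintro rfl; exact h

theorem Label.kind_eq_out {π : Label L 0} {x : ℕ} (h : x ∈ π.bn) {m : ℕ} (Δ : ℕ → Msg L m) :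
    π.kind Δ = .out := by
  cases π with
  | out M y => rfl
  | _ => exact absurd h (by simp [Label.bn])

theorem Label.finite_bn (π : Label L 0) : π.bn.Finite := by
  cases π <;> simp [Label.bn]

/-- Normal forms are preserved by transitions. -/
theorem State.NF.next {W : Set ℕ} {A : State L} (hA : A.NF) {π : Label L 0}
    {R : Agent L A.scope} (hx : ∀ x ∈ π.bn, x ∉ A.fv) (hR : A.Steps E W π R) :
    (A.next π.bv R).NF ∧ (A.next π.bv R).dom = A.dom ∪ π.bn ∧
      ∀ y ∈ (A.next π.bv R).fv, y ∈ A.fv ∨ y ∈ π.fv ∨ y ∈ π.bn := by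
  have hfresh : ∀ x, x ∈ A.dom ∪ π.bn →
      x ∉ R.proc.fv ∧ ∀ N, R.msg = some N → x ∉ N.fv := by
    intro x hxD
    refine CStep.notMem_fv hR (fun h => ?_) (fun h => ?_)
    · rcases hxD with hxD | hxb
      · exact (hA.2 x hxD).1 h
      · exact hx x hxb (.inl (.inl h))
    · rcases hxD with hxD | hxb
      · obtain ⟨z, -, hz⟩ := State.mem_fv_kind h
        exact (hA.2 x hxD).2 z hz
      · rw [Label.kind_eq_out hxb] at h; simp [Kind.fv] at h
  have hnot : ∀ x, x ∉ π.bn → (A.next π.bv R).asg x = (A.asg x).subst (rn R.ren) := fun x hxb =>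
    nextA_of_notMem hR hxb
  have hnotfv : ∀ x, x ∉ π.bn → Msg.fv ((A.next π.bv R).asg x) = (A.asg x).fv := fun x hxb =>
    (congrArg (Msg.fv (n := R.scope)) (hnot x hxb)).trans (fv_rn _ _)
  have hmem : ∀ x, x ∈ π.bn → R.msg = some ((A.next π.bv R).asg x) := fun x hxb =>
    nextA_of_mem hR hxb
  have hfv : ∀ x, x ∈ A.dom ∪ π.bn → ∀ y, x ∉ ((A.next π.bv R).asg y).fv := by
    intro x hxD y
    by_cases hy : y ∈ π.bn
    · exact (hfresh x hxD).2 _ (hmem y hy)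
    · rw [hnotfv y hy]
      intro h
      rcases hxD with hxD | hxb
      · exact (hA.2 x hxD).2 y h
      · rcases State.mem_fv_asg h with h | rfl
        · exact hx x hxb h
        · exact hy hxb
  have hdom : (A.next π.bv R).dom = A.dom ∪ π.bn := by
    ext x
    constructor
    · intro h
      by_contra hn
      simp only [Set.mem_union, not_or] at hn
      refine h ?_
      rw [hnot x hn.2, A.plain x hn.1]; rfl
    · intro h he
      exact hfv x h x (by rw [he]; simp)
  refine ⟨⟨hdom ▸ hA.1.union π.finite_bn, fun x hxD => ⟨(hfresh x (hdom ▸ hxD)).1,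
    hfv x (hdom ▸ hxD)⟩⟩, hdom, fun y hy => ?_⟩
  have hRy : (y ∉ A.proc.fv → y ∉ (π.kind A.asg).fv → False) →
      y ∈ A.fv ∨ y ∈ π.fv ∨ y ∈ π.bn := by
    intro h
    by_contra hn
    push Not at hn
    refine h (fun h => hn.1 (.inl (.inl h))) fun h => ?_
    obtain ⟨z, hz, h⟩ := State.mem_fv_kind h
    rcases State.mem_fv_asg h with h | rfl
    · exact hn.1 h
    · exact hn.2.1 hz
  rcases hy with (hy | hy) | ⟨x, hxD, hy⟩
  · exact hRy fun h1 h2 => (CStep.notMem_fv hR h1 h2).1 hy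
  · rw [hdom] at hy
    exact hy.elim (fun h => .inl (.inl (.inr h))) (fun h => .inr (.inr h))
  · by_cases hxb : x ∈ π.bn
    · exact hRy fun h1 h2 => (CStep.notMem_fv hR h1 h2).2 _ (hmem x hxb) hy
    · rw [hnotfv x hxb] at hy
      rw [hdom] at hxD
      exact .inl (.inr ⟨x, hxD.resolve_right hxb, hy⟩)

/-- `o` is an opening of `A` by private variables in `W`, which do not occur in `A`. -/
structure State.Opens (W : Set ℕ) (A : State L) {m : ℕ} (o : Fin A.scope → ℕ ⊕ Fin m) : Prop where
  isOpening : IsOpening o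
  names : names o ⊆ W
  fresh : ∀ x ∈ A.fv, x ∉ W
  infinite : Wᶜ.Infinite

theorem State.Opens.notMem_asg {W : Set ℕ} {A : State L} {m : ℕ} {o : Fin A.scope → ℕ ⊕ Fin m}
    (ho : A.Opens W o) {x y : ℕ} (hx : x ∉ W) (h : y ∈ (A.asg x).fv) : y ∉ W := by
  rcases State.mem_fv_asg h with h | rfl
  · exact ho.fresh y h
  · exact hx

theorem State.Opens.next {W : Set ℕ} {A : State L} (hA : A.NF) {m : ℕ}
    {o : Fin A.scope → ℕ ⊕ Fin m} (ho : A.Opens W o) {π : Label L 0} {R : Agent L A.scope}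
    (hπ : ∀ x ∈ π.fv, x ∉ W) (hbW : ∀ x ∈ π.bn, x ∉ W) (hx : ∀ x ∈ π.bn, x ∉ A.fv)
    (hR : A.Steps E ∅ π R) {m' : ℕ} {o' : Fin R.scope → ℕ ⊕ Fin m'} (ho' : IsOpening o')
    (hn : AppliedPi.names o' = AppliedPi.names o) : (A.next π.bv R).Opens W o' := by
  refine ⟨ho', hn.trans_subset ho.names, fun y hy => ?_, ho.infinite⟩
  rcases (hA.next hx hR).2.2 y hy with h | h | h
  · exact ho.fresh y h
  · exact hπ y h
  · exact hbW y h

/-- Transitions of extended processes are transitions of the opened states. -/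
theorem ExtStep.opens {W : Set ℕ} {A B : Ext L 0} (hA : A.st.NF) {m : ℕ}
    {o : Fin A.st.scope → ℕ ⊕ Fin m} (ho : A.st.Opens W o) {π : Label L 0}
    (hπ : ∀ x ∈ π.fv, x ∉ W) (hbW : ∀ x ∈ π.bn, x ∉ W) (hx : ∀ x ∈ π.bn, x ∉ A.st.fv)
    (h : ExtStep E A π B) : B.st.NF ∧ B.st.dom = A.st.dom ∪ π.bn ∧
      ∃ (R' : Agent L m) (o' : Fin B.st.scope → ℕ ⊕ Fin R'.scope), (A.st.open o).Steps E W π R' ∧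
        B.st.Opens W o' ∧ (A.st.open o).next π.bv R' = B.st.open o' := by
  obtain ⟨R, hR, hB⟩ := h.steps
  obtain ⟨R', o', h1, h2, h3, h4⟩ := State.steps_open ho.isOpening ho.names ho.infinite
    (fun x hx => ho.fresh x (.inl (.inl hx)))
    (fun x hx => by
      obtain ⟨z, hz, hx⟩ := State.mem_fv_kind hx
      exact ho.notMem_asg (hπ z hz) hx)
    (fun x hx hτ => by
      obtain ⟨z, hz, hx⟩ := State.mem_fv_chan hx hτ
      exact ho.notMem_asg (hπ z hz) hx) hR
  have h5 := ho.next hA hπ hbW hx hR h2 h3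
  have h6 := hA.next hx hR
  rw [hB]
  exact ⟨h6.1, h6.2.1, R', o', h1, h5, h4⟩

/-- Transitions of opened states are transitions of extended processes. -/
theorem State.Opens.extStep {W : Set ℕ} {A : Ext L 0} (hA : A.st.NF) {m : ℕ}
    {o : Fin A.st.scope → ℕ ⊕ Fin m} (ho : A.st.Opens W o) {π : Label L 0}
    (hπ : ∀ x ∈ π.fv, x ∉ W) (hbW : ∀ x ∈ π.bn, x ∉ W) (hx : ∀ x ∈ π.bn, x ∉ A.st.fv)
    (hxc : ∀ x ∈ π.bn, x ∉ (π.chan A.st.asg).fv) {R' : Agent L m}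
    (h : (A.st.open o).Steps E W π R') : ∃ B, ExtStep E A π B ∧ B.st.NF ∧
      B.st.dom = A.st.dom ∪ π.bn ∧ ∃ o' : Fin B.st.scope → ℕ ⊕ Fin R'.scope,
        B.st.Opens W o' ∧ (A.st.open o).next π.bv R' = B.st.open o' := by
  obtain ⟨R, o', hR, h2, h3, h4⟩ := State.steps_of_open ho.isOpening ho.names ho.infinite
    (fun x hx => ho.fresh x (.inl (.inl hx)))
    (fun x hx => by
      obtain ⟨z, hz, hx⟩ := State.mem_fv_kind hx
      exact ho.notMem_asg (hπ z hz) hx)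
    (fun x hx hτ => by
      obtain ⟨z, hz, hx⟩ := State.mem_fv_chan hx hτ
      exact ho.notMem_asg (hπ z hz) hx) h
  obtain ⟨B, hAB, hB⟩ := A.exists_step hR
    ⟨Set.disjoint_left.2 fun x hxD hxb => hx x hxb (.inl (.inr hxD)), fun y hy =>
      Set.disjoint_left.2 fun x hxf hxb => by
        rcases State.mem_fv_asg hxf with h | rfl
        · exact hx x hxb h
        · exact hy hxb⟩
    (fun x hxb => ⟨fun h => hx x hxb (.inl (.inl h)), hxc x hxb⟩)
  refine ⟨B, hAB, ?_⟩
  have h5 := ho.next hA hπ hbW hx hR h2 h3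
  have h6 := hA.next hx hR
  rw [hB]
  exact ⟨h6.1, h6.2.1, o', h5, h4⟩

/-! ## Openings of extensions of the environment -/

section ReachSt

variable {σ : Subst L 0} {k : ℕ} {ρ : Subst L (0 + k)} {A A' : State L}
  {w : Fin (0 + k) → Fin A'.scope} {g : Fin A.scope → Fin A'.scope}

/-- The new scope is the disjoint union of the process names and the environment names. The former
are opened as before, up to the renaming `f`; the latter are all opened, since both compared
processes share them. -/
theorem ReachSt.exists_joint (h : ReachSt σ ρ A A' w g) {m : ℕ} {o : Fin A.scope → ℕ ⊕ Fin m}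
    (ho : IsOpening o) (f : ℕ → ℕ) (hf : Set.InjOn f (names o)) (h' : Fin (0 + k) → ℕ)
    (hh : Function.Injective h') (hfh : ∀ u ∈ names o, ∀ l, f u ≠ h' l) :
    ∃ o' : Fin A'.scope → ℕ ⊕ Fin m, (∀ i, o' (g i) = Sum.map f id (o i)) ∧
      (∀ l, o' (w l) = .inl (h' l)) ∧ IsOpening o' ∧
      ∀ y ∈ names o', (∃ u ∈ names o, y = f u) ∨ ∃ l, y = h' l := by
  classical
  let o' : Fin A'.scope → ℕ ⊕ Fin m := fun j =>
    if hj : ∃ i, g i = j then Sum.map f id (o hj.choose) else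
      if hj : ∃ l, w l = j then .inl (h' hj.choose) else .inl 0
  have hg : ∀ i, o' (g i) = Sum.map f id (o i) := by
    intro i
    have hj : ∃ i', g i' = g i := ⟨i, rfl⟩
    simp only [o', dif_pos hj, h.inj_g hj.choose_spec]
  have hw : ∀ l, o' (w l) = .inl (h' l) := by
    intro l
    have hj : ∃ l', w l' = w l := ⟨l, rfl⟩
    have hn : ¬ ∃ i, g i = w l := fun ⟨i, hi⟩ => h.ne i l hi
    simp only [o', dif_neg hn, dif_pos hj, h.inj_w hj.choose_spec]
  have hgw : ∀ i l, Sum.map f id (o i) ≠ (.inl (h' l) : ℕ ⊕ Fin m) := by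
    intro i l he
    cases hoi : o i with
    | inl u => rw [hoi] at he; exact hfh u ⟨i, hoi⟩ l (Sum.inl.inj he)
    | inr j => rw [hoi] at he; exact absurd he (by simp)
  refine ⟨o', hg, hw, ⟨?_, ?_⟩, ?_⟩
  · intro j j' he
    rcases h.surj j with ⟨i, rfl⟩ | ⟨l, rfl⟩ <;> rcases h.surj j' with ⟨i', rfl⟩ | ⟨l', rfl⟩
    · rw [hg, hg] at he
      congr 1
      refine ho.inj ?_
      cases hoi : o i with
      | inl u =>
        cases hoi' : o i' with
        | inl u' =>
          rw [hoi, hoi'] at he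
          rw [hf ⟨i, hoi⟩ ⟨i', hoi'⟩ (Sum.inl.inj he)]
        | inr j => rw [hoi, hoi'] at he; exact absurd he (by simp)
      | inr j =>
        cases hoi' : o i' with
        | inl u' => rw [hoi, hoi'] at he; exact absurd he (by simp)
        | inr j => rw [hoi, hoi'] at he; simpa using he
    · rw [hg, hw] at he; exact absurd he (hgw i l')
    · rw [hg, hw] at he; exact absurd he.symm (hgw i' l)
    · rw [hw, hw] at he
      rw [hh (Sum.inl.inj he)]
  · intro j
    obtain ⟨i, hi⟩ := ho.surj j
    exact ⟨g i, by rw [hg, hi]; rfl⟩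
  · rintro y ⟨j, hj⟩
    rcases h.surj j with ⟨i, rfl⟩ | ⟨l, rfl⟩
    · rw [hg] at hj
      cases hoi : o i with
      | inl u =>
        rw [hoi] at hj
        exact .inl ⟨u, ⟨i, hoi⟩, (Sum.inl.inj hj).symm⟩
      | inr j => rw [hoi] at hj; exact absurd hj (by simp)
    · rw [hw] at hj
      exact .inr ⟨l, (Sum.inl.inj hj).symm⟩

variable {m : ℕ} {o : Fin A.scope → ℕ ⊕ Fin m} {o' : Fin A'.scope → ℕ ⊕ Fin m} {X : Set ℕ}
  {s : Subst L 0}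

theorem ReachSt.ev_open (h : ReachSt σ ρ A A' w g) (hr : Ready σ ρ A.dom) (hA : A.NF)
    (hX : A.fv ⊆ X) (hs : Realizes σ ρ w g o o' X s) {M : Msg L 0} (hM : ∀ x ∈ M.fv, x ∈ X) :
    ev (M.app σ) (A'.open o').asg = (ev M (A.open o).asg).subst (fs s m) := by
  have : M.app σ = ev M σ := subst_eq_ev M _
  rw [this, ev_ev]
  refine (ev_congr M fun x hx => ?_).trans
    (ev_subst M (fun x => (A.asg x).subst (opn o)) (fs s m)).symm
  rw [← h.open_ev hr hA hX hs (hM x hx), ev_subst]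
  rfl

end ReachSt

/-! ### From extensions of the environment to substitutions of the private variables -/

/-- The private variables after an extension of the environment by `k` names. -/
def envW (W : Set ℕ) (N k : ℕ) : Set ℕ :=
  {y | (∃ w ∈ W, y = 2 * w + N) ∨ ∃ l : Fin (0 + k), y = 2 * (l : ℕ) + N + 3}

/-- The names of the environment, replaced by private variables. -/
def envOpen (N k : ℕ) : Repl L (0 + k) 0 :=
  Sum.elim (fun x => Term.var (.inl x)) (fun l => Term.var (.inl (2 * (l : ℕ) + N + 3)))

open Classical in
/-- The substitution of an extension of the environment. -/
def envS (W : Set ℕ) (N : ℕ) (σ : Subst L 0) {k : ℕ} (ρ : Subst L (0 + k)) : Subst L 0 := fun x =>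
  if x ∈ W then Term.var (.inl (2 * x + N)) else
    if x < N then Term.subst (Msg.app ((σ x).wk k) ρ) (envOpen N k) else Term.var (.inl (N + 1))

/-- `N` bounds the variables of `σ` and `ρ`. -/
structure EnvBound (σ : Subst L 0) {k : ℕ} (ρ : Subst L (0 + k)) (N : ℕ) : Prop where
  left : ∀ x < N, ∀ y ∈ (σ x).fv, y < N
  right : ∀ x < N, ∀ y ∈ (ρ x).fv, y < N
  dom : ∀ x ∈ ρ.dom, x < N

theorem EnvBound.env {σ : Subst L 0} {k : ℕ} {ρ : Subst L (0 + k)} {N : ℕ} (h : EnvBound σ ρ N)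
    {x y : ℕ} (hx : x < N) (hy : y ∈ (Msg.app ((σ x).wk k) ρ).fv) : y < N := by
  obtain ⟨z, hz, hy⟩ := mem_fv_env hy
  exact h.right z (h.left x hx z hz) y hy

theorem exists_envBound {σ : Subst L 0} {k : ℕ} {ρ : Subst L (0 + k)} (hσ : σ.dom.Finite)
    (hρ : ρ.dom.Finite) {F : Set ℕ} (hF : F.Finite) : ∃ N, EnvBound σ ρ N ∧ ∀ x ∈ F, x < N := by
  obtain ⟨N, hN⟩ := exists_bound (F ∪ ρ.dom ∪ (⋃ x ∈ σ.dom, ((σ x).fv : Set ℕ)) ∪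
    ⋃ x ∈ ρ.dom, ((ρ x).fv : Set ℕ)) (((hF.union hρ).union
      (hσ.biUnion fun x _ => Finset.finite_toSet _)).union
      (hρ.biUnion fun x _ => Finset.finite_toSet _))
  refine ⟨N, ⟨fun x hx y hy => ?_, fun x hx y hy => ?_, fun x hx => ?_⟩, fun x hx => ?_⟩
  · by_cases hxd : x ∈ σ.dom
    · exact hN y (.inl (.inr (Set.mem_biUnion hxd hy)))
    · have : σ x = Term.var (.inl x) := by by_contra h; exact hxd h
      rw [this] at hy
      obtain rfl : y = x := by simpa using hy
      exact hx
  · by_cases hxd : x ∈ ρ.dom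
    · exact hN y (.inr (Set.mem_biUnion hxd hy))
    · have : ρ x = Term.var (.inl x) := by by_contra h; exact hxd h
      rw [this] at hy
      obtain rfl : y = x := by simpa using hy
      exact hx
  · exact hN x (.inl (.inl (.inr hx)))
  · exact hN x (.inl (.inl (.inl hx)))

theorem le_of_mem_envW {W : Set ℕ} {N k y : ℕ} (h : y ∈ envW W N k) : N ≤ y := by
  rcases h with ⟨w, -, rfl⟩ | ⟨l, rfl⟩ <;> omega

theorem infinite_compl_envW (W : Set ℕ) (N k : ℕ) : (envW W N k)ᶜ.Infinite := by
  refine infinite_compl_of (F := Set.range fun l : Fin (0 + k) => 2 * (l : ℕ) + N + 3)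
    (Set.finite_range _) N ?_
  rintro y (⟨w, -, rfl⟩ | ⟨l, rfl⟩)
  · exact .inr ⟨w, rfl⟩
  · exact .inl ⟨l, rfl⟩

theorem mem_fv_envOpen {k N : ℕ} {M : Msg L (0 + k)} {y : ℕ}
    (h : y ∈ Msg.fv (M.subst (envOpen N k))) :
    y ∈ M.fv ∨ ∃ l : Fin (0 + k), y = 2 * (l : ℕ) + N + 3 := by
  rcases mem_fv_subst M _ y h with ⟨x, hx, h⟩ | ⟨l, h⟩
  · obtain rfl : y = x := by simpa [envOpen] using h
    exact .inl hx
  · exact .inr ⟨l, by simpa [envOpen] using h⟩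

/-- All old variables that matter lie below `N`. Private variables go to `2 * w + N` and environment
names to `2 * l + N + 3`, of different parity relative to `N`; `N + 1` belongs to neither and
receives the irrelevant variables. -/
theorem EnvBound.adm {σ : Subst L 0} {k : ℕ} {ρ : Subst L (0 + k)} {N : ℕ} (h : EnvBound σ ρ N)
    (W : Set ℕ) : Adm W (envW W N k) (envS W N σ ρ) := by
  refine ⟨infinite_compl_envW W N k, fun w => 2 * w + N, fun w hw => ⟨.inl ⟨w, hw, rfl⟩, ?_⟩,
    ?_, ?_⟩
  · simp [envS, hw]
  · intro a _ b _ hab; simp only at hab; omega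
  · intro x hx w _ hmem
    simp only [envS, hx, if_false] at hmem
    by_cases hxN : x < N
    · rw [if_pos hxN] at hmem
      rcases mem_fv_envOpen hmem with hmem | ⟨l, hl⟩
      · have := h.env hxN hmem; omega
      · omega
    · rw [if_neg hxN] at hmem
      simp only [fv_var_inl, Finset.mem_singleton] at hmem; omega

section ReachSt

variable {σ : Subst L 0} {k : ℕ} {ρ : Subst L (0 + k)} {A A' : State L}
  {w : Fin (0 + k) → Fin A'.scope} {g : Fin A.scope → Fin A'.scope}

/-- On opened states an extension of the environment is precisely a move of the game: an admissible
substitution together with aliases for the domain of `ρ`. -/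
theorem ReachSt.exists_opening (h : ReachSt σ ρ A A' w g) (hr : Ready σ ρ A.dom) (hA : A.NF)
    {N : ℕ} (hb : EnvBound σ ρ N) (hAN : ∀ x ∈ A.fv, x < N) {W : Set ℕ} {m : ℕ}
    {o : Fin A.scope → ℕ ⊕ Fin m} (ho : A.Opens W o) :
    ∃ o' : Fin A'.scope → ℕ ⊕ Fin m, A'.Opens (envW W N k) o' ∧
      Realizes σ ρ w g o o' {x | x ∉ W ∧ x < N} (envS W N σ ρ) ∧
      A'.open o' = (A.open o).fut A.dom (A.dom ∪ ρ.dom) (envS W N σ ρ)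
        (fun x => (ρ x).subst (envOpen N k)) := by
  obtain ⟨o', h1, h2, h3, h4⟩ := h.exists_joint ho.isOpening (fun u => 2 * u + N)
    (fun a _ b _ hab => by simp only at hab; omega)
    (fun l => 2 * (l : ℕ) + N + 3)
    (fun a b (hab : 2 * (a : ℕ) + N + 3 = 2 * (b : ℕ) + N + 3) => Fin.ext (by omega))
    (fun u _ l (he : 2 * u + N = 2 * (l : ℕ) + N + 3) => by omega)
  have key : ∀ M : Msg L (0 + k),
      (M.subst (rn w)).subst (opn o') = Msg.emb m (M.subst (envOpen N k)) := by
    intro M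
    rw [Msg.emb, relabel_eq_subst]
    refine subst_comm M fun a => ?_
    rcases a with x | l
    · rfl
    · simp [h2, envOpen]
  have hs : Realizes σ ρ w g o o' {x | x ∉ W ∧ x < N} (envS W N σ ρ) := by
    refine ⟨fun x hx hxD => ?_, fun i => ?_⟩
    · simp only [envS, hx.1, hx.2, if_false, if_true]
      exact key _
    · rw [h1]
      cases hoi : o i with
      | inl u =>
        have hu : u ∈ W := ho.names ⟨i, hoi⟩
        simp [envS, hu]
      | inr j => simp
  have hX : A.fv ⊆ {x | x ∉ W ∧ x < N} := fun x hx => ⟨ho.fresh x hx, hAN x hx⟩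
  refine ⟨o', ⟨h3, ?_, ?_, infinite_compl_envW W N k⟩, hs, ?_⟩
  · intro y hy
    rcases h4 y hy with ⟨u, hu, rfl⟩ | ⟨l, rfl⟩
    · exact .inl ⟨u, ho.names hu, rfl⟩
    · exact .inr ⟨l, rfl⟩
  · intro y hy hyW
    have := le_of_mem_envW hyW
    refine absurd this (not_le.2 ?_)
    rcases h.mem_fv hr hA hy with hy | hy | ⟨x, hx, -, hy⟩ | ⟨x, hx, hy⟩
    · exact hAN y (.inl (.inr hy))
    · exact hb.dom y hy
    · exact hb.env (hAN x hx) hy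
    · exact hb.right x (hb.dom x hx) y hy
  · have hp := h.open_proc hA hX hs
    simp only [State.open, State.fut, State.mk.injEq, heq_eq_eq, true_and]
    refine ⟨?_, hp⟩
    funext x
    unfold futA
    by_cases hxD : x ∈ A.dom
    · rw [if_pos hxD]; exact h.open_asg hA hX hs hxD
    · rw [if_neg hxD, h.asg_new x hxD, key]
      by_cases hxρ : x ∈ ρ.dom
      · rw [if_pos (.inr hxρ)]
      · rw [if_neg (by rintro (h | h); exacts [hxD h, hxρ h])]
        rw [show ρ x = Term.var (.inl x) from by by_contra h'; exact hxρ h']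
        rfl

end ReachSt

/-! ### Renaming of the private variables -/

theorem Subst.dom_ident {n : ℕ} : (Subst.ident : Subst L n).dom = ∅ := by
  ext x; simp [Subst.dom, Subst.ident]

theorem ready_ident (D : Set ℕ) {k : ℕ} :
    Ready (Subst.ident : Subst L 0) (Subst.ident : Subst L (0 + k)) D := by
  have hf : ∀ {n : ℕ}, (Subst.ident : Subst L n).FreshFor D := by
    intro n
    refine ⟨by rw [Subst.dom_ident]; exact Set.empty_disjoint _, fun y hy => ?_⟩
    simp only [Subst.ident, fv_var_inl, Finset.coe_singleton, Set.disjoint_singleton_left]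
    exact hy
  have hi : ∀ {n : ℕ}, (Subst.ident : Subst L n).Idempotent := fun {n} =>
    funext fun x => app_ident _
  have hd : ∀ {n : ℕ}, (Subst.ident : Subst L n).dom.Finite := by
    intro n; rw [Subst.dom_ident]; exact Set.finite_empty
  exact ⟨hd, hi, hf, hd, hi, hf⟩

theorem envRepl_ident {n : ℕ} : (envRepl (Subst.ident : Subst L 0) (k := 0) Subst.ident
    Fin.elim0 id : Repl L n n) = fun a => Term.var a := by
  funext a
  rcases a with x | i <;> rfl

theorem reachSt_ident (A : State L) : ReachSt (Subst.ident : Subst L 0) (k := 0) Subst.ident A A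
    Fin.elim0 id where
  inj_w := fun a => a.elim0
  inj_g := Function.injective_id
  ne := fun _ l => l.elim0
  surj := fun j => .inl ⟨j, rfl⟩
  proc := by rw [envRepl_ident, repl_var]
  asg := fun x _ => by rw [envRepl_ident, subst_var]
  asg_new := fun x hx => A.plain x hx

/-- Satisfaction is reflected by renamings of the private variables. -/
theorem Forces.of_rename {φ : Formula L} {W : Set ℕ} (hW : Wᶜ.Infinite) {N m : ℕ}
    {Δ : ℕ → Msg L m} {P : Proc L m} (hP : ∀ x ∈ P.fv, x ∈ W ∨ x < N)
    (hΔ : ∀ x ∈ φ.fv, ∀ y ∈ (Δ x).fv, y ∈ W ∨ y < N)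
    (h : Forces E φ (envW W N 0) (fun x => (Δ x).subst (fs (envS W N Subst.ident
      (k := 0) Subst.ident) m)) (P.repl (fs (envS W N Subst.ident (k := 0) Subst.ident) m))) :
    Forces E φ W Δ P := by
  classical
  obtain ⟨c, hc⟩ := hW.nonempty
  -- The inverse renaming. Variables outside its intended domain go to the public variable `c`, so
  -- that no private variable is produced.
  let r : Subst L 0 := fun y => if ∃ w ∈ W, y = 2 * w + N then Term.var (.inl ((y - N) / 2)) else
    if y < N ∧ y ∉ W then Term.var (.inl y) else Term.var (.inl c)
  have hr : ∀ w ∈ W, r (2 * w + N) = Term.var (.inl w) := by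
    intro w hw
    simp only [r]
    rw [if_pos ⟨w, hw, rfl⟩]
    congr 2
    omega
  have hadm : Adm (envW W N 0) W r := by
    refine ⟨hW, fun y => (y - N) / 2, ?_, ?_, ?_⟩
    · rintro y (⟨w, hw, rfl⟩ | ⟨l, -⟩)
      · have h2 : (2 * w + N - N) / 2 = w := by omega
        exact ⟨by simpa only [h2] using hw, by simp only [hr w hw, h2]⟩
      · exact l.elim0
    · rintro y (⟨w, hw, rfl⟩ | ⟨l, -⟩) y' (⟨w', hw', rfl⟩ | ⟨l', -⟩) he
      · simp only at he; omega
      · exact l'.elim0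
      · exact l.elim0
      · exact l.elim0
    · rintro x hx y (⟨w, hw, rfl⟩ | ⟨l, -⟩)
      · have h2 : (2 * w + N - N) / 2 = w := by omega
        simp only [h2]
        have h3 : ¬ ∃ w ∈ W, x = 2 * w + N := fun h => hx (.inl h)
        simp only [r, h3, if_false]
        split
        · rename_i h4
          simp only [fv_var_inl, Finset.mem_singleton]
          rintro rfl; exact h4.2 hw
        · simp only [fv_var_inl, Finset.mem_singleton]
          rintro rfl; exact hc hw
      · exact l.elim0
  have key : ∀ y, y ∈ W ∨ y < N → sc (envS W N Subst.ident (k := 0) Subst.ident) r y =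
      (Term.var (.inl y) : Msg L 0) := by
    intro y hy
    by_cases hyW : y ∈ W
    · simp only [sc, envS, hyW, if_true, ev_var, hr y hyW]
    · have hyN := hy.resolve_left hyW
      have h3 : ¬ ∃ w ∈ W, y = 2 * w + N := by rintro ⟨w, -, rfl⟩; omega
      simp only [sc, envS, hyW, hyN, if_true, if_false]
      change ev (Term.var (.inl y) : Msg L 0) r = _
      simp only [ev_var, r, h3, hyN, hyW, if_false, if_true, not_false_eq_true, and_self]
  have := h.adm hadm
  simp only [msg_fs_fs, proc_fs_fs] at this
  rw [proc_fs_self P fun y hy => key y (hP y hy)] at this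
  exact Forces.local (fun x hx => msg_fs_self _ fun y hy => key y (hΔ x hx y hy)) this

/-! ### From substitutions of the private variables to extensions of the environment -/

/-- Evaluation of a message, where the variables of `Z` become names of the environment. -/
def hide (N k : ℕ) (z : Fin k → ℕ) : ℕ → Msg L (0 + k) := by
  classical
  exact fun y => if h : ∃ l, z l = y then Term.var (.inr (Fin.natAdd 0 h.choose)) else
    Term.var (.inl (2 * y + N))

theorem hide_apply {N k : ℕ} {z : Fin k → ℕ} (hz : Function.Injective z) (l : Fin k) :
    (hide N k z (z l) : Msg L (0 + k)) = Term.var (.inr (Fin.natAdd 0 l)) := by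
  have h : ∃ l', z l' = z l := ⟨l, rfl⟩
  simp only [hide, dif_pos h, hz h.choose_spec]

theorem hide_of_notMem {N k : ℕ} {z : Fin k → ℕ} {y : ℕ} (hy : y ∉ Set.range z) :
    (hide N k z y : Msg L (0 + k)) = Term.var (.inl (2 * y + N)) := by
  have h : ¬ ∃ l, z l = y := hy
  simp only [hide, dif_neg h]

theorem mem_fv_hide {N k : ℕ} {z : Fin k → ℕ} {M : Msg L 0} {y : ℕ}
    (h : y ∈ (ev M (hide N k z)).fv) : ∃ v ∈ M.fv, v ∉ Set.range z ∧ y = 2 * v + N := by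
  obtain ⟨v, hv, h⟩ := (mem_fv_ev M _ y).1 h
  refine ⟨v, hv, ?_⟩
  by_cases hvz : v ∈ Set.range z
  · obtain ⟨l, hl⟩ := hvz
    have h' : ∃ l, z l = v := ⟨l, hl⟩
    simp [hide, dif_pos h'] at h
  · rw [hide_of_notMem hvz] at h
    exact ⟨hvz, by simpa using h⟩

open Classical in
/-- The substitution of an extension of the environment that introduces aliases for the variables
of `X`. -/
def aliasS (X : Set ℕ) (s : Subst L 0) (N k : ℕ) (z : Fin k → ℕ) : Subst L (0 + k) := fun x =>
  if x ∈ X then ev (s x) (hide N k z) else Term.var (.inl x)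

theorem mem_fv_aliasS {X : Set ℕ} {s : Subst L 0} {N k : ℕ} {z : Fin k → ℕ} {x y : ℕ}
    (h : y ∈ (aliasS X s N k z x).fv) :
    (x ∈ X ∧ ∃ v ∈ (s x).fv, v ∉ Set.range z ∧ y = 2 * v + N) ∨ x ∉ X ∧ y = x := by
  unfold aliasS at h
  by_cases hx : x ∈ X
  · rw [if_pos hx] at h; exact .inl ⟨hx, mem_fv_hide h⟩
  · rw [if_neg hx] at h; exact .inr ⟨hx, by simpa using h⟩

/-- The variables in the range of the new aliases are shifted to positions from `N` on, away from
the domain; this makes the substitution idempotent and fresh. -/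
theorem ready_aliasS {X D : Set ℕ} (hX : X.Finite) (hXD : Disjoint X D) {s : Subst L 0} {N k : ℕ}
    {z : Fin k → ℕ} (hXN : ∀ x ∈ X, x < N) (hDN : ∀ x ∈ D, x < N) :
    Ready Subst.ident (aliasS X s N k z) D := by
  have hdom : (aliasS X s N k z).dom ⊆ X := by
    intro x hx
    by_contra hn
    exact hx (if_neg hn)
  obtain ⟨h1, h2, h3, -⟩ := ready_ident (L := L) D (k := k)
  refine ⟨h1, h2, h3, hX.subset hdom, ?_, ?_, ?_⟩
  · funext x
    refine app_self _ fun y hy => ?_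
    rcases mem_fv_aliasS hy with ⟨-, v, -, -, rfl⟩ | ⟨hx, rfl⟩
    · exact if_neg fun h => by have := hXN _ h; omega
    · exact if_neg hx
  · exact hXD.mono_left hdom
  · intro x hx
    rw [Set.disjoint_left]
    intro y hy hyD
    rcases mem_fv_aliasS hy with ⟨-, v, -, -, rfl⟩ | ⟨-, rfl⟩
    · have := hDN _ hyD; omega
    · exact hx hyD

/-- A substitution of the private variables of an opened extended process is an extension of the
environment, up to a renaming `r` with inverse `r'`. -/
theorem State.Opens.exists_reach {A : Ext L 0} (hA : A.st.NF) {W : Set ℕ} {m : ℕ}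
    {o : Fin A.st.scope → ℕ ⊕ Fin m} (ho : A.st.Opens W o) {W₁ : Set ℕ} {s : Subst L 0}
    (hs : Adm W W₁ s) {X : Set ℕ} (hX : X.Finite) (hAX : A.st.fv ⊆ X) (hXW : ∀ x ∈ X, x ∉ W) :
    ∃ (k : ℕ) (ρ : Subst L (0 + k)) (A' : Ext L 0) (w : Fin (0 + k) → Fin A'.st.scope)
      (g : Fin A.st.scope → Fin A'.st.scope) (o' : Fin A'.st.scope → ℕ ⊕ Fin m) (W₂ : Set ℕ)
      (r r' : Subst L 0), Reach A Subst.ident k ρ A' ∧ ReachSt Subst.ident ρ A.st A'.st w g ∧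
      Ready Subst.ident ρ A.st.dom ∧ A'.st.Opens W₂ o' ∧
      Realizes Subst.ident ρ w g o o' X (sc s r) ∧ Adm W₁ W₂ r ∧ Adm W₂ W₁ r' ∧ sc r r' = idS ∧
      ∀ x ∈ X, x ∉ W₂ := by
  classical
  obtain ⟨N, hN⟩ := exists_bound X hX
  have hs' := hs
  obtain ⟨hW₁, f, hf, hfi, hfx⟩ := hs'
  obtain ⟨c, hc⟩ := hW₁.nonempty
  -- The private variables of the later world that the substitution makes visible; they become the
  -- restricted names of the environment.
  let Z : Finset ℕ := (hX.toFinset.biUnion fun x => (s x).fv).filter (· ∈ W₁)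
  have hZ : ∀ x ∈ X, ∀ v ∈ (s x).fv, v ∈ W₁ → v ∈ Z := fun x hx v hv hvW =>
    Finset.mem_filter.2 ⟨Finset.mem_biUnion.2 ⟨x, by simpa using hx, hv⟩, hvW⟩
  let z : Fin Z.card → ℕ := fun l => Z.orderEmbOfFin rfl l
  have hzi : Function.Injective z := (Z.orderEmbOfFin rfl).injective
  have hzr : Set.range z = Z := Finset.range_orderEmbOfFin Z rfl
  have hzW : ∀ l, z l ∈ W₁ := fun l =>
    (Finset.mem_filter.1 (Finset.orderEmbOfFin_mem Z rfl l)).2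
  have hzX : ∀ l, ∃ x ∈ X, z l ∈ (s x).fv := fun l => by
    obtain ⟨x, hx, h⟩ := Finset.mem_biUnion.1
      (Finset.mem_filter.1 (Finset.orderEmbOfFin_mem Z rfl l)).1
    exact ⟨x, by simpa using hx, h⟩
  let D := A.st.dom
  have hDX : D ⊆ X := fun x hx => hAX (.inl (.inr hx))
  -- The whole substitution is realised by aliases: each relevant variable that is not yet an alias
  -- becomes one for its value. The first component can then be the identity.
  let ρ : Subst L (0 + Z.card) := aliasS (X \ D) s N Z.card z
  have hr : Ready Subst.ident ρ D := ready_aliasS (hX.subset Set.sdiff_subset)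
    Set.disjoint_sdiff_left (fun x hx => hN x hx.1) fun x hx => hN x (hDX hx)
  obtain ⟨A', hA'⟩ : ∃ A', A' = Ext.news Z.card (Ext.addSubst ρ (A.repl (Sum.elim
      (fun x => ((Subst.ident x).wk Z.card).app ρ) Fin.elim0))) := ⟨_, rfl⟩
  have hreach : Reach A Subst.ident Z.card ρ A' := reach_iff.2 ⟨by rw [A.dom_st]; exact hr, hA'⟩
  obtain ⟨w, g, hst⟩ := hreach.st
  let z' : Fin (0 + Z.card) → ℕ := fun l => 2 * z (Fin.cast (zero_add _) l) + N
  obtain ⟨o', h1, h2, h3, h4⟩ := hst.exists_joint ho.isOpening (fun u => 2 * f u + N)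
    (fun a ha b hb (hab : 2 * f a + N = 2 * f b + N) =>
      hfi (ho.names ha) (ho.names hb) (by omega)) z'
    (fun a b (hab : 2 * z _ + N = 2 * z _ + N) => by
      have : z (Fin.cast (zero_add _) a) = z (Fin.cast (zero_add _) b) := by omega
      exact Fin.cast_injective _ (hzi this))
    (fun u hu l (he : 2 * f u + N = 2 * z _ + N) => by
      obtain ⟨x, hx, hzx⟩ := hzX (Fin.cast (zero_add _) l)
      refine hfx x (hXW x hx) u (ho.names hu) ?_
      rwa [show f u = z (Fin.cast (zero_add _) l) by omega])
  -- The shift by which `ρ` becomes idempotent also renames the later world. The renaming `r` has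
  -- the admissible left inverse `r'`, so nothing is lost.
  let W₂ : Set ℕ := {y | ∃ v ∈ W₁, y = 2 * v + N}
  have hW₂ : W₂ᶜ.Infinite := infinite_compl_of Set.finite_empty N (by
    rintro y ⟨v, -, rfl⟩; exact .inr ⟨v, rfl⟩)
  have hXW₂ : ∀ x ∈ X, x ∉ W₂ := by
    rintro x hx ⟨v, -, rfl⟩
    have := hN _ hx; omega
  let r : Subst L 0 := fun y => Term.var (.inl (2 * y + N))
  let r' : Subst L 0 := fun y => if ∃ v, y = 2 * v + N then Term.var (.inl ((y - N) / 2)) else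
    Term.var (.inl c)
  have hr' : ∀ v, r' (2 * v + N) = Term.var (.inl v) := by
    intro v
    simp only [r']
    rw [if_pos ⟨v, rfl⟩]
    congr 2; omega
  have hkey : ∀ M : Msg L 0, ((ev M (hide N Z.card z)).subst (rn w)).subst (opn o') =
      (ev M r).emb m := by
    intro M
    rw [ev_subst, ev_subst, emb_eq_ev, ev_ev]
    refine ev_congr M fun y _ => ?_
    by_cases hy : y ∈ Set.range z
    · obtain ⟨l, rfl⟩ := hy
      rw [hide_apply hzi]
      have hl : Fin.cast (zero_add _) (Fin.natAdd 0 l) = l := Fin.ext (by simp)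
      simp only [subst_var_apply, rn_inr, opn_inr, h2, z', r, ev_var, hl]
    · rw [hide_of_notMem hy]; rfl
  refine ⟨Z.card, ρ, A', w, g, o', W₂, r, r', hreach, hst, hr, ⟨h3, ?_, ?_, hW₂⟩, ⟨?_, ?_⟩,
    ⟨hW₂, fun y => 2 * y + N, fun y hy => ⟨⟨y, hy, rfl⟩, rfl⟩, ?_, ?_⟩,
    ⟨hW₁, fun y => (y - N) / 2, ?_, ?_, ?_⟩, funext hr', hXW₂⟩
  · intro y hy
    rcases h4 y hy with ⟨u, hu, rfl⟩ | ⟨l, rfl⟩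
    · exact ⟨f u, (hf u (ho.names hu)).1, rfl⟩
    · exact ⟨_, hzW _, rfl⟩
  · have hval : ∀ x y, y ∈ (ρ x).fv → (x ∉ X \ D → x ∈ X) → y ∉ W₂ := by
      intro x y hy hxX
      rcases mem_fv_aliasS hy with ⟨hx, v, hv, hvz, rfl⟩ | ⟨hx, rfl⟩
      · rintro ⟨v', hv', he⟩
        obtain rfl : v = v' := by omega
        exact hvz (hzr ▸ hZ x hx.1 v hv hv')
      · exact hXW₂ _ (hxX hx)
    have henv : ∀ x y, y ∈ (Msg.app ((Subst.ident x).wk Z.card) ρ).fv → y ∈ (ρ x).fv := by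
      intro x y h
      obtain ⟨v, hv, h⟩ := mem_fv_env h
      obtain rfl : v = x := by simpa [Subst.ident] using hv
      exact h
    have hρd : ∀ x ∈ ρ.dom, x ∈ X \ D := by
      intro x hx
      by_contra hn
      exact hx (if_neg hn)
    intro y hy
    rcases hst.mem_fv hr hA hy with hy | hy | ⟨x, hx, -, hy⟩ | ⟨x, hx, hy⟩
    · exact hXW₂ y (hDX hy)
    · exact hXW₂ y (hρd y hy).1
    · exact hval x y (henv x y hy) fun _ => hAX hx
    · exact hval x y hy fun h => absurd (hρd x hx) h
  · intro x hx hxD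
    have : Msg.app ((Subst.ident x).wk Z.card) ρ = ev (s x) (hide N Z.card z) :=
      if_pos (show x ∈ X \ D from ⟨hx, hxD⟩)
    rw [this, hkey]; rfl
  · intro i
    rw [h1]
    cases hoi : o i with
    | inl u =>
      have hu : u ∈ W := ho.names ⟨i, hoi⟩
      simp only [subst_var_apply, fs_inl, sc, (hf u hu).2, ev_var, r, emb_var, Sum.map_inl]
    | inr j => simp
  · intro a _ b _ hab; simp only at hab; omega
  · intro x hx y hy
    simp only [r, fv_var_inl, Finset.mem_singleton]
    intro he
    obtain rfl : y = x := by omega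
    exact hx hy
  · rintro y ⟨v, hv, rfl⟩
    have h2 : (2 * v + N - N) / 2 = v := by omega
    exact ⟨by simpa only [h2] using hv, by simp only [hr', h2]⟩
  · rintro y ⟨v, hv, rfl⟩ y' ⟨v', hv', rfl⟩ he
    simp only at he; omega
  · rintro x hx y ⟨v, hv, rfl⟩
    have h2 : (2 * v + N - N) / 2 = v := by omega
    simp only [h2]
    by_cases hxv : ∃ v, x = 2 * v + N
    · obtain ⟨v', rfl⟩ := hxv
      rw [hr']
      simp only [fv_var_inl, Finset.mem_singleton]
      rintro rfl; exact hx ⟨v, hv, rfl⟩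
    · simp only [r', hxv, if_false, fv_var_inl, Finset.mem_singleton]
      rintro rfl; exact hc hv

/-! ## Satisfaction by extended processes and by opened states -/

open Classical in
/-- The instance after a transition whose bound variable is named `y`. -/
def Subst.bind (δ : Subst L 0) (π : Label L 0) (y : ℕ) : Subst L 0 := fun x =>
  if x ∈ π.bn then Term.var (.inl y) else δ x

theorem app_eq_ev_self (M : Msg L 0) (δ : Subst L 0) : M.app δ = ev M δ := subst_eq_ev M _

theorem Subst.bind_eq_self {δ : Subst L 0} {π : Label L 0} {y : ℕ} (h : π.bn = ∅) :
    δ.bind π y = δ := by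
  funext x; simp [Subst.bind, h]

theorem Subst.bind_tau {δ : Subst L 0} {y : ℕ} : δ.bind .tau y = δ := Subst.bind_eq_self rfl

theorem Subst.bind_inp {δ : Subst L 0} {M N : Msg L 0} {y : ℕ} : δ.bind (.inp M N) y = δ :=
  Subst.bind_eq_self rfl

theorem Subst.bind_out {δ : Subst L 0} {M : Msg L 0} {x y : ℕ} :
    δ.bind (.out M x) y = Function.update δ x (Term.var (.inl y)) := by
  funext z
  by_cases hz : z = x <;> simp [Subst.bind, Label.bn, hz]

/-- A uniform clause for the three actions: for actions that bind nothing, the name `y` is arbitrary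
and has no effect. -/
theorem satInst_dia {π : Label L 0} {φ : Formula L} {δ : Subst L 0} {A : Ext L 0} :
    SatInst E (.dia π φ) δ A ↔ ∃ y B, (∀ x ∈ π.bn, FreshName A φ x δ y) ∧
      ExtStep E A (π.inst δ y) B ∧ SatInst E φ (δ.bind π y) B := by
  cases π with
  | tau => simp [SatInst, Label.bn, Label.inst, Subst.bind_tau]
  | out M x =>
    simp [SatInst, Label.bn, Label.inst, Subst.bind_out, app_eq_ev_self]
  | inp M N => simp [SatInst, Label.bn, Label.inst, Subst.bind_inp, app_eq_ev_self]

theorem satInst_box {π : Label L 0} {φ : Formula L} {δ : Subst L 0} {A : Ext L 0} :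
    SatInst E (.box π φ) δ A ↔ ∀ (σ : Subst L 0) (k : ℕ) (ρ : Subst L (0 + k)) (A' B : Ext L 0)
      (y : ℕ), Reach A σ k ρ A' → (∀ x ∈ π.bn, FreshName A' φ x (δ.comp σ) y) →
      ExtStep E A' (π.inst (δ.comp σ) y) B → SatInst E φ ((δ.comp σ).bind π y) B := by
  cases π with
  | tau =>
    simp only [SatInst, Label.bn, Label.inst, Subst.bind_tau]
    exact ⟨fun h σ k ρ A' B _ h1 _ h2 => h σ k ρ A' B h1 h2,
      fun h σ k ρ A' B h1 h2 => h σ k ρ A' B 0 h1 (by simp) h2⟩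
  | out M x =>
    simp [SatInst, Label.bn, Label.inst, Subst.bind_out, app_eq_ev_self]
  | inp M N =>
    simp only [SatInst, Label.bn, Label.inst, Subst.bind_inp, app_eq_ev_self]
    exact ⟨fun h σ k ρ A' B _ h1 _ h2 => h σ k ρ A' B h1 h2,
      fun h σ k ρ A' B h1 h2 => h σ k ρ A' B 0 h1 (by simp) h2⟩

/-- Renaming the variable bound by an output commutes with recording its message, provided that the
new name does not occur in the other instantiated variables. -/
theorem nextA_bind {W : Set ℕ} {y m : ℕ} {P : Proc L m} {Δ : ℕ → Msg L m} {π : Label L 0}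
    {δ : Subst L 0} {C : Msg L m} {R : Agent L m} {x : ℕ}
    (hy : π.bn.Nonempty → x ∉ π.bn → y ∉ (δ x).fv)
    (hR : CStep E W P ((π.inst δ y).kind Δ) C R) :
    nextA (fun x => ev (δ x) Δ) π.bv R x = ev (δ.bind π y x) (nextA Δ (π.inst δ y).bv R) := by
  have hR' : CStep E W P (π.kind fun x => ev (δ x) Δ) C R := by
    rwa [← Label.kind_inst (Δ := fun x => ev (δ x) Δ) (fun _ => rfl) π y]
  by_cases hx : x ∈ π.bn
  · have h1 := nextA_of_mem (Δ := fun x => ev (δ x) Δ) hR' hx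
    have h2 := nextA_of_mem (Δ := Δ) hR (Label.mem_bn_inst hx)
    simp only [Subst.bind, if_pos hx, ev_var]
    exact Option.some.inj (h1.symm.trans h2)
  · rw [nextA_of_notMem hR' hx, ev_subst]
    simp only [Subst.bind, if_neg hx]
    refine ev_congr _ fun v hv => ?_
    rw [nextA_of_notMem hR]
    intro hvb
    obtain rfl := Label.eq_of_mem_bn_inst hvb
    refine hy ?_ hx hv
    cases π with
    | out M z => exact ⟨z, rfl⟩
    | _ => exact absurd hvb (by simp [Label.inst, Label.bn])

theorem mem_fv_opn_inr {n k : ℕ} {o : Fin n → ℕ ⊕ Fin k} {i : Fin n} {y : ℕ}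
    (h : y ∈ ((opn o : Repl L n k) (.inr i)).fv) : y ∈ names o := by
  refine ⟨i, ?_⟩
  rw [opn_inr] at h
  cases hoi : o i with
  | inl u => rw [hoi] at h; simp at h; rw [h]
  | inr j => rw [hoi] at h; simp at h

theorem State.mem_fv_open_proc {A : State L} {m : ℕ} {o : Fin A.scope → ℕ ⊕ Fin m} {y : ℕ}
    (h : y ∈ (A.open o).proc.fv) : y ∈ A.proc.fv ∨ y ∈ names o := by
  by_contra hn
  push Not at hn
  refine notMem_fv_repl A.proc (fun x hx hy => ?_) (fun i hy => hn.2 (mem_fv_opn_inr hy)) h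
  obtain rfl := Finset.mem_singleton.1 hy
  exact hn.1 hx

theorem State.mem_fv_open_asg {A : State L} {m : ℕ} {o : Fin A.scope → ℕ ⊕ Fin m} {x y : ℕ}
    (h : y ∈ ((A.open o).asg x).fv) : y ∈ (A.asg x).fv ∨ y ∈ names o := by
  rcases mem_fv_subst (A.asg x) (opn o) y h with ⟨z, hz, hy⟩ | ⟨i, hy⟩
  · obtain rfl := Finset.mem_singleton.1 hy
    exact .inl hz
  · exact .inr (mem_fv_opn_inr hy)

section

variable {A : Ext L 0} {W : Set ℕ} {m : ℕ} {o : Fin A.st.scope → ℕ ⊕ Fin m} {π : Label L 0}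
  {φ : Formula L} {δ : Subst L 0}

theorem FreshName.notMem {x y v : ℕ} (h : FreshName A φ x δ y) (hx : x ∈ π.bn) (hv : v ∈ φ.fv)
    (hvb : v ∉ π.bn) : y ∉ (δ v).fv :=
  h.2 v (Finset.mem_erase.2 ⟨by rintro rfl; exact hvb hx, hv⟩)

theorem notMem_fv_bind {y : ℕ} (hφ : ∀ x ∈ φ.fv, x ∉ π.bn → ∀ v ∈ (δ x).fv, v ∉ W)
    (hy : π.bn.Nonempty → y ∉ W) : ∀ x ∈ φ.fv, ∀ v ∈ (δ.bind π y x).fv, v ∉ W := by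
  intro x hx v hv
  by_cases hxb : x ∈ π.bn
  · simp only [Subst.bind, if_pos hxb, fv_var_inl, Finset.mem_singleton] at hv
    subst hv; exact hy ⟨x, hxb⟩
  · simp only [Subst.bind, if_neg hxb] at hv
    exact hφ x hx hxb v hv

theorem Label.nonempty_bn_of_inst {x y : ℕ} (h : x ∈ (π.inst δ y).bn) : π.bn.Nonempty := by
  cases π with
  | out M z => exact ⟨z, rfl⟩
  | _ => exact absurd h (by simp [Label.inst, Label.bn])

/-- An instance of an action of an extended process, as an action of the opened state. -/
theorem ExtStep.opens_inst (hA : A.st.NF) (ho : A.st.Opens W o)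
    (hπ : ∀ x ∈ π.fv, ∀ v ∈ (δ x).fv, v ∉ W)
    (hφ : ∀ x ∈ φ.fv, x ∉ π.bn → ∀ v ∈ (δ x).fv, v ∉ W) {y : ℕ} (hyW : π.bn.Nonempty → y ∉ W)
    (hy : ∀ x ∈ π.bn, FreshName A φ x δ y) {B : Ext L 0} (h : ExtStep E A (π.inst δ y) B) :
    ∃ (R : Agent L m) (o' : Fin B.st.scope → ℕ ⊕ Fin R.scope),
      CStep E W (A.st.open o).proc (π.kind fun x => ev (δ x) (A.st.open o).asg)
        (π.chan fun x => ev (δ x) (A.st.open o).asg) R ∧ B.st.NF ∧ B.st.Opens W o' ∧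
      (∀ x ∈ φ.fv, ∀ v ∈ (δ.bind π y x).fv, v ∉ W) ∧
      (Forces E φ W (fun x => ev (δ.bind π y x) (B.st.open o').asg) (B.st.open o').proc ↔
        Forces E φ W (nextA (fun x => ev (δ x) (A.st.open o).asg) π.bv R) R.proc) := by
  obtain ⟨h1, -, R, o', h2, h3, h4⟩ := h.opens hA ho
    (fun v hv => by obtain ⟨x, hx, hv⟩ := Label.fv_inst hv; exact hπ x hx v hv)
    (fun x hx => by
      obtain rfl := Label.eq_of_mem_bn_inst hx
      exact hyW (Label.nonempty_bn_of_inst hx))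
    (fun x hx => by
      obtain rfl := Label.eq_of_mem_bn_inst hx
      obtain ⟨z, hz⟩ := Label.nonempty_bn_of_inst hx
      rw [← A.fv_st]; exact (hy z hz).1)
  refine ⟨R, o', ?_, h1, h3, notMem_fv_bind hφ hyW, ?_⟩
  · rw [← Label.kind_inst (fun _ => rfl) π y, ← Label.chan_inst (fun _ => rfl) π y]
    exact h2
  · rw [← h4]
    have key : ∀ x ∈ φ.fv, nextA (fun x => ev (δ x) (A.st.open o).asg) π.bv R x =
        ev (δ.bind π y x) ((A.st.open o).next (π.inst δ y).bv R).asg := fun x hx =>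
      nextA_bind (fun ⟨z, hz⟩ hxb => (hy z hz).notMem hz hx hxb) h2
    exact ⟨Forces.local fun x hx => (key x hx).symm, Forces.local key⟩

/-- Conversely, an action of the opened state is an instance of an action of the extended
process. -/
theorem State.Opens.exists_extStep_inst (hA : A.st.NF) (ho : A.st.Opens W o)
    (hπ : ∀ x ∈ π.fv, ∀ v ∈ (δ x).fv, v ∉ W)
    (hφ : ∀ x ∈ φ.fv, x ∉ π.bn → ∀ v ∈ (δ x).fv, v ∉ W) {R : Agent L m}
    (h : CStep E W (A.st.open o).proc (π.kind fun x => ev (δ x) (A.st.open o).asg)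
        (π.chan fun x => ev (δ x) (A.st.open o).asg) R) :
    ∃ (y : ℕ) (B : Ext L 0) (o' : Fin B.st.scope → ℕ ⊕ Fin R.scope),
      (∀ x ∈ π.bn, FreshName A φ x δ y) ∧ ExtStep E A (π.inst δ y) B ∧ B.st.NF ∧ B.st.Opens W o' ∧
      (∀ x ∈ φ.fv, ∀ v ∈ (δ.bind π y x).fv, v ∉ W) ∧
      (Forces E φ W (nextA (fun x => ev (δ x) (A.st.open o).asg) π.bv R) R.proc ↔
        Forces E φ W (fun x => ev (δ.bind π y x) (B.st.open o').asg) (B.st.open o').proc) := by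
  obtain ⟨y, hyW, hyF⟩ := ho.infinite.exists_notMem_finite
    (hA.finite_fv.union ((Finset.finite_toSet (π.fv ∪ φ.fv)).biUnion fun x _ =>
      Finset.finite_toSet (δ x).fv))
  simp only [Set.mem_union, not_or, Set.mem_iUnion, not_exists, Finset.coe_union,
    Finset.mem_coe] at hyF
  obtain ⟨hyA, hyδ⟩ := hyF
  have h' : (A.st.open o).Steps E W (π.inst δ y) R := by
    unfold State.Steps
    rw [Label.kind_inst (fun _ => rfl) π y, Label.chan_inst (fun _ => rfl) π y]
    exact h
  have hy : ∀ x ∈ π.bn, FreshName A φ x δ y := fun x _ =>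
    ⟨by rwa [A.fv_st], fun w hw => hyδ w (.inr (Finset.mem_of_mem_erase hw))⟩
  obtain ⟨B, h1, h2, -, o', h3, h4⟩ := ho.extStep hA
    (fun v hv => by obtain ⟨x, hx, hv⟩ := Label.fv_inst hv; exact hπ x hx v hv)
    (fun x hx => by
      obtain rfl := Label.eq_of_mem_bn_inst hx
      exact hyW)
    (fun x hx => by
      obtain rfl := Label.eq_of_mem_bn_inst hx
      exact hyA)
    (fun x hx hxc => by
      obtain rfl := Label.eq_of_mem_bn_inst hx
      obtain ⟨v, hv, hxv⟩ := State.mem_fv_chan hxc (Label.ne_tau_of_mem_bn hx)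
      rcases State.mem_fv_asg hxv with hxv | rfl
      · exact hyA hxv
      · obtain ⟨u, hu, hv⟩ := Label.fv_inst hv
        exact hyδ u (.inl hu) hv) h'
  refine ⟨y, B, o', hy, h1, h2, h3, notMem_fv_bind hφ fun _ => hyW, ?_⟩
  rw [← h4]
  have key : ∀ x ∈ φ.fv, nextA (fun x => ev (δ x) (A.st.open o).asg) π.bv R x =
      ev (δ.bind π y x) ((A.st.open o).next (π.inst δ y).bv R).asg := fun x hx =>
    nextA_bind (fun ⟨z, hz⟩ hxb => (hy z hz).notMem hz hx hxb) h'
  exact ⟨Forces.local key, Forces.local fun x hx => (key x hx).symm⟩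

end

/-! ### Composition of substitutions of the private variables -/

section

variable {φ : Formula L} {π : Label L 0} {W W₁ W₂ : Set ℕ} {m : ℕ} {Δ Δ' : ℕ → Msg L m}
  {P P' : Proc L m} {R : Agent L m} {s r r' : Subst L 0}

theorem sc_sc_of_retract (h : sc r r' = idS) : sc (sc s r) r' = s := by
  have : sc (sc s r) r' = sc s (sc r r') := funext fun x => ev_ev _ _ _
  rw [this, h, sc_idS_right]

theorem Forces.comp (h : Forces E φ W₁ (fun x => (Δ x).subst (fs s m)) (P.repl (fs s m)))
    (hr : Adm W₁ W₂ r) :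
    Forces E φ W₂ (fun x => (Δ x).subst (fs (sc s r) m)) (P.repl (fs (sc s r) m)) := by
  have := h.adm hr
  simpa only [msg_fs_fs, proc_fs_fs] using this

theorem Forces.of_comp
    (h : Forces E φ W₂ (fun x => (Δ x).subst (fs (sc s r) m)) (P.repl (fs (sc s r) m)))
    (hr' : Adm W₂ W₁ r') (hrr : sc r r' = idS) :
    Forces E φ W₁ (fun x => (Δ x).subst (fs s m)) (P.repl (fs s m)) := by
  have := h.comp hr'
  rwa [sc_sc_of_retract hrr] at this

theorem CStep.comp (h : CStep E W₁ (P.repl (fs s m)) (π.kind fun x => (Δ x).subst (fs s m))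
    (π.chan fun x => (Δ x).subst (fs s m)) R) (hr : Adm W₁ W₂ r)
    (hP : P' = P.repl (fs (sc s r) m))
    (hΔ : ∀ x ∈ π.fv, Δ' x = (Δ x).subst (fs (sc s r) m)) :
    CStep E W₂ P' (π.kind Δ') (π.chan Δ') (R.fs r) := by
  have h := h.adm hr
  rw [Label.kind_congr π hΔ, Label.chan_congr π hΔ, hP]
  rw [proc_fs_fs, ← Label.kind_fs] at h
  simp only [msg_fs_fs] at h
  refine h.chan fun hτ => ?_
  rw [← Label.chan_fs π _ _ fun e => hτ (Label.kind_tau_iff.2 e)]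
  simp only [msg_fs_fs]
  exact .refl _

theorem CStep.of_eq (h : CStep E W P' (π.kind Δ') (π.chan Δ') R) (hP : P' = P.repl (fs s m))
    (hΔ : ∀ x ∈ π.fv, Δ' x = (Δ x).subst (fs s m)) : CStep E W (P.repl (fs s m))
      (π.kind fun x => (Δ x).subst (fs s m)) (π.chan fun x => (Δ x).subst (fs s m)) R := by
  rwa [← Label.kind_congr π hΔ, ← Label.chan_congr π hΔ, ← hP]

theorem Forces.next_of_comp {C : Msg L m} (h : Forces E φ W₂ (nextA Δ' π.bv (R.fs r)) (R.fs r).proc)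
    (hR : CStep E W₂ P' (π.kind Δ') C (R.fs r))
    (hΔ : ∀ x ∈ φ.fv, x ∉ π.bn → Δ' x = (Δ x).subst (fs (sc s r) m))
    (hr' : Adm W₂ W₁ r') (hrr : sc r r' = idS) :
    Forces E φ W₁ (nextA (fun x => (Δ x).subst (fs s m)) π.bv R) R.proc := by
  have h1 : Forces E φ W₂ (fun x => (nextA (fun x => (Δ x).subst (fs s m)) π.bv R x).subst
      (fs r R.scope)) (R.proc.repl (fs r R.scope)) := by
    rw [← nextA_fs]
    simp only [msg_fs_fs]
    exact Forces.local (fun x hx => nextA_congr hR fun hxb => hΔ x hx hxb) h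
  have := h1.adm hr'
  simpa only [msg_fs_fs, proc_fs_fs, hrr, fs_ident, subst_var, repl_var] using this

end

/-- The opening `o'` of `A'` is the instance by `s` of the opening `o` of `A`, where the messages over
`X` are instantiated by `σ`. -/
structure State.Future (σ : Subst L 0) (A A' : State L) {m : ℕ} (o : Fin A.scope → ℕ ⊕ Fin m)
    (o' : Fin A'.scope → ℕ ⊕ Fin m) (X W : Set ℕ) (s : Subst L 0) : Prop where
  nf : A'.NF
  opens : A'.Opens W o'
  proc : (A'.open o').proc = (A.open o).proc.repl (fs s m)
  asg : ∀ M : Msg L 0, (∀ x ∈ M.fv, x ∈ X) →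
    ev (M.app σ) (A'.open o').asg = (ev M (A.open o).asg).subst (fs s m)
  fresh : ∀ M : Msg L 0, (∀ x ∈ M.fv, x ∈ X) → ∀ y ∈ (M.app σ).fv, y ∉ W

theorem State.Future.forces_iff {σ : Subst L 0} {A A' : State L} {m : ℕ}
    {o : Fin A.scope → ℕ ⊕ Fin m} {o' : Fin A'.scope → ℕ ⊕ Fin m} {X W : Set ℕ} {s : Subst L 0}
    (h : State.Future σ A A' o o' X W s) {φ : Formula L} {δ : Subst L 0}
    (hδ : ∀ x ∈ φ.fv, ∀ y ∈ (δ x).fv, y ∈ X) :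
    Forces E φ W (fun x => ev (δ.comp σ x) (A'.open o').asg) (A'.open o').proc ↔
      Forces E φ W (fun x => (ev (δ x) (A.open o).asg).subst (fs s m))
        ((A.open o).proc.repl (fs s m)) := by
  rw [h.proc]
  exact ⟨Forces.local fun x hx => h.asg _ (hδ x hx), Forces.local fun x hx => (h.asg _ (hδ x hx)).symm⟩

/-- From extensions to admissible substitutions. The bound `N` may be taken above any finite set
`Y`, so the new private variables avoid names chosen elsewhere. -/
theorem ReachSt.exists_future {σ : Subst L 0} {k : ℕ} {ρ : Subst L (0 + k)} {A A' : State L}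
    {w : Fin (0 + k) → Fin A'.scope} {g : Fin A.scope → Fin A'.scope} (h : ReachSt σ ρ A A' w g)
    (hr : Ready σ ρ A.dom) (hA : A.NF) {W : Set ℕ} {m : ℕ} {o : Fin A.scope → ℕ ⊕ Fin m}
    (ho : A.Opens W o) {X Y : Set ℕ} (hAX : A.fv ⊆ X) (hX : X.Finite) (hXW : ∀ x ∈ X, x ∉ W)
    (hY : Y.Finite) : ∃ (N : ℕ) (o' : Fin A'.scope → ℕ ⊕ Fin m),
      State.Future σ A A' o o' X (envW W N k) (envS W N σ ρ) ∧
      Adm W (envW W N k) (envS W N σ ρ) ∧ (∀ x ∈ X, x < N) ∧ ∀ y ∈ Y, y ∉ envW W N k := by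
  obtain ⟨N, hb, hN⟩ := exists_envBound hr.finite_left hr.finite_right (hX.union hY)
  obtain ⟨o', h1, h2, -⟩ := h.exists_opening hr hA hb (fun x hx => hN x (.inl (hAX hx))) ho
  have hX' : X ⊆ {x | x ∉ W ∧ x < N} := fun x hx => ⟨hXW x hx, hN x (.inl hx)⟩
  refine ⟨N, o', ⟨(h.nf hr hA).1, h1, h.open_proc hA (hAX.trans hX') h2,
    fun M hM => h.ev_open hr hA (hAX.trans hX') h2 fun x hx => hX' (hM x hx), fun M hM y hy hyW => ?_⟩,
    hb.adm W, fun x hx => hN x (.inl hx), fun y hy hyW => ?_⟩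
  · obtain ⟨x, hx, hy⟩ := mem_fv_app hy
    exact absurd (le_of_mem_envW hyW) (not_le.2 (hb.left x (hN x (.inl (hM x hx))) y hy))
  · exact absurd (le_of_mem_envW hyW) (not_le.2 (hN y (.inr hy)))

theorem State.Opens.exists_future {A : Ext L 0} (hA : A.st.NF) {W : Set ℕ} {m : ℕ}
    {o : Fin A.st.scope → ℕ ⊕ Fin m} (ho : A.st.Opens W o) {W₁ : Set ℕ} {s : Subst L 0}
    (hs : Adm W W₁ s) {X : Set ℕ} (hX : X.Finite) (hAX : A.st.fv ⊆ X) (hXW : ∀ x ∈ X, x ∉ W) :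
    ∃ (k : ℕ) (ρ : Subst L (0 + k)) (A' : Ext L 0) (o' : Fin A'.st.scope → ℕ ⊕ Fin m)
      (W₂ : Set ℕ) (r r' : Subst L 0), Reach A Subst.ident k ρ A' ∧
      State.Future Subst.ident A.st A'.st o o' X W₂ (sc s r) ∧ Adm W₁ W₂ r ∧ Adm W₂ W₁ r' ∧
      sc r r' = idS := by
  obtain ⟨k, ρ, A', w, g, o', W₂, r, r', h1, h2, h3, h4, h5, h6, h7, h8, h9⟩ :=
    ho.exists_reach hA hs hX hAX hXW
  refine ⟨k, ρ, A', o', W₂, r, r', h1, ⟨(h2.nf h3 hA).1, h4, h2.open_proc hA hAX h5,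
    fun M hM => h2.ev_open h3 hA hAX h5 hM, fun M hM y hy => ?_⟩, h6, h7, h8⟩
  rw [app_ident] at hy
  exact h9 y (hM y hy)

/-- Satisfaction of formulae at an extended process, in terms of its openings. -/
theorem satInst_iff {φ : Formula L} {δ : Subst L 0} {A : Ext L 0} (hA : A.st.NF) {W : Set ℕ}
    {m : ℕ} {o : Fin A.st.scope → ℕ ⊕ Fin m} (ho : A.st.Opens W o)
    (hδ : ∀ x ∈ φ.fv, ∀ y ∈ (δ x).fv, y ∉ W) : SatInst E φ δ A ↔
      Forces E φ W (fun x => ev (δ x) (A.st.open o).asg) (A.st.open o).proc := by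
  induction φ generalizing δ A W m with
  | tt => exact Iff.rfl
  | ff => exact Iff.rfl
  | eq M N =>
    simp only [Formula.fv, Finset.mem_union] at hδ
    have key : ∀ M : Msg L 0, (∀ x ∈ M.fv, ∀ y ∈ (δ x).fv, y ∉ W) →
        ev M (fun x => ev (δ x) (A.st.open o).asg) = (ev (M.app δ) A.st.asg).subst (opn o) ∧
          ∀ y ∈ (ev (M.app δ) A.st.asg).fv, y ∉ AppliedPi.names o := by
      intro M hM
      refine ⟨?_, fun y hy hyn => ?_⟩
      · rw [app_eq_ev_self, ev_ev, ev_subst]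
        exact ev_congr M fun x _ => (ev_subst (δ x) A.st.asg (opn o)).symm
      · obtain ⟨x, hx, hy⟩ := (mem_fv_ev _ _ y).1 hy
        obtain ⟨z, hz, hx⟩ := mem_fv_app hx
        exact ho.notMem_asg (hM z hz x hx) hy (ho.names hyn)
    have hM := key M fun x hx => hδ x (.inl hx)
    have hN := key N fun x hx => hδ x (.inr hx)
    change A.Equates E _ _ ↔ EqE E (ev M fun x => ev (δ x) (A.st.open o).asg)
      (ev N fun x => ev (δ x) (A.st.open o).asg)
    rw [A.equates_st, hM.1, hN.1]
    exact (ho.isOpening.eqE_opn hM.2 hN.2).symm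
  | and φ ψ ih ih' =>
    simp only [Formula.fv, Finset.mem_union] at hδ
    exact and_congr (ih hA ho fun x hx => hδ x (.inl hx)) (ih' hA ho fun x hx => hδ x (.inr hx))
  | or φ ψ ih ih' =>
    simp only [Formula.fv, Finset.mem_union] at hδ
    exact or_congr (ih hA ho fun x hx => hδ x (.inl hx)) (ih' hA ho fun x hx => hδ x (.inr hx))
  | imp φ ψ ih ih' =>
    let X : Set ℕ := A.st.fv ∪ ⋃ x ∈ (Formula.imp φ ψ).fv, ((δ x).fv : Set ℕ)
    have hX : X.Finite := hA.finite_fv.union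
      ((Finset.finite_toSet _).biUnion fun x _ => Finset.finite_toSet _)
    have hXW : ∀ x ∈ X, x ∉ W := by
      rintro x (hx | hx)
      · exact ho.fresh x hx
      · obtain ⟨z, hz, hx⟩ := Set.mem_iUnion₂.1 hx
        exact hδ z hz x hx
    have hXl : ∀ x ∈ φ.fv, ∀ y ∈ (δ x).fv, y ∈ X := fun x hx y hy =>
      .inr (Set.mem_iUnion₂.2 ⟨x, Finset.mem_union_left _ hx, hy⟩)
    have hXr : ∀ x ∈ ψ.fv, ∀ y ∈ (δ x).fv, y ∈ X := fun x hx y hy =>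
      .inr (Set.mem_iUnion₂.2 ⟨x, Finset.mem_union_right _ hx, hy⟩)
    constructor
    -- An admissible substitution is realised as an extension after the renaming `r`: the premise
    -- moves along `r`, and the conclusion comes back along `r'`.
    · intro h W₁ s hs h1
      obtain ⟨k, ρ, A', o', W₂, r, r', hre, hf, hr, hr', hrr⟩ :=
        ho.exists_future hA hs hX Set.subset_union_left hXW
      have h2 := h _ _ _ _ hre ((ih hf.nf hf.opens fun x hx => hf.fresh _ (hXl x hx)).2
        ((hf.forces_iff hXl).2 (h1.comp hr)))
      exact ((hf.forces_iff hXr).1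
        ((ih' hf.nf hf.opens fun x hx => hf.fresh _ (hXr x hx)).1 h2)).of_comp hr' hrr
    · intro h σ k ρ A' hre h1
      obtain ⟨w, g, hst⟩ := hre.st
      have hready := (reach_iff.1 hre).1
      rw [A.dom_st] at hready
      obtain ⟨N, o', hf, hs, -⟩ := hst.exists_future hready hA ho Set.subset_union_left hX hXW
        Set.finite_empty
      exact (ih' hf.nf hf.opens fun x hx => hf.fresh _ (hXr x hx)).2 ((hf.forces_iff hXr).2
        (h _ _ hs ((hf.forces_iff hXl).1
          ((ih hf.nf hf.opens fun x hx => hf.fresh _ (hXl x hx)).1 h1))))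
  | dia π φ ih =>
    simp only [mem_fv_dia] at hδ
    rw [satInst_dia]
    constructor
    · rintro ⟨y, B, hy, hAB, hB⟩
      let X : Set ℕ := A.st.fv ∪ ⋃ x ∈ (Formula.dia π φ).fv, ((δ x).fv : Set ℕ)
      have hX : X.Finite := hA.finite_fv.union
        ((Finset.finite_toSet _).biUnion fun x _ => Finset.finite_toSet _)
      have hXW : ∀ x ∈ X, x ∉ W := by
        rintro x (hx | hx)
        · exact ho.fresh x hx
        · obtain ⟨z, hz, hx⟩ := Set.mem_iUnion₂.1 hx
          exact hδ z (mem_fv_dia.1 hz) x hx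
      have hXd : ∀ x ∈ (Formula.dia π φ).fv, ∀ y ∈ (δ x).fv, y ∈ X := fun x hx y hy =>
        .inr (Set.mem_iUnion₂.2 ⟨x, hx, hy⟩)
      -- The name `y` chosen for the output may be a private variable of this opening. The identity
      -- extension moves the private variables away from it, and `Forces.of_rename` moves them back.
      obtain ⟨N, o', hf, hs, hXN, hYW⟩ := (reachSt_ident A.st).exists_future (ready_ident _) hA ho
        Set.subset_union_left hX hXW (Set.finite_singleton y)
      have hcomp : δ.comp Subst.ident = δ := funext fun x => app_ident _
      have hfresh : ∀ x ∈ (Formula.dia π φ).fv, ∀ y ∈ (δ x).fv, y ∉ envW W N 0 := fun x hx y hy =>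
        hf.fresh (δ x) (hXd x hx) y (by rwa [app_ident])
      obtain ⟨R, o'', h1, h2, h3, h4, h5⟩ := hAB.opens_inst (φ := φ) hA hf.opens
        (fun x hx => hfresh x (mem_fv_dia.2 (.inl hx)))
        (fun x hx hxb => hfresh x (mem_fv_dia.2 (.inr ⟨hx, hxb⟩)))
        (fun _ => hYW y rfl) hy
      have h6 : Forces E (.dia π φ) (envW W N 0) (fun x => ev (δ.comp Subst.ident x)
          (A.st.open o').asg) (A.st.open o').proc := by
        rw [hcomp]
        exact ⟨R, h1, h5.1 ((ih h2 h3 h4).1 hB)⟩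
      refine Forces.of_rename ho.infinite (N := N) (fun x hx => ?_) (fun x hx y hy => ?_)
        ((hf.forces_iff hXd).1 h6)
      · rcases State.mem_fv_open_proc hx with hx | hx
        · exact .inr (hXN x (.inl (.inl (.inl hx))))
        · exact .inl (ho.names hx)
      · obtain ⟨z, hz, hy⟩ := (mem_fv_ev _ _ y).1 hy
        rcases State.mem_fv_open_asg hy with hy | hy
        · rcases State.mem_fv_asg hy with hy | rfl
          · exact .inr (hXN y (.inl hy))
          · exact .inr (hXN y (hXd x hx y hz))
        · exact .inl (ho.names hy)
    · rintro ⟨R, hR, hF⟩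
      obtain ⟨y, B, o', h1, h2, h3, h4, h5, h6⟩ := ho.exists_extStep_inst (φ := φ) hA
        (fun x hx => hδ x (.inl hx)) (fun x hx hxb => hδ x (.inr ⟨hx, hxb⟩)) hR
      exact ⟨y, B, h1, h2, (ih h3 h4 h5).2 (h6.1 hF)⟩
  | box π φ ih =>
    simp only [mem_fv_box] at hδ
    rw [satInst_box]
    let X : Set ℕ := A.st.fv ∪ ⋃ x ∈ (Formula.box π φ).fv, ((δ x).fv : Set ℕ)
    have hX : X.Finite := hA.finite_fv.union
      ((Finset.finite_toSet _).biUnion fun x _ => Finset.finite_toSet _)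
    have hXW : ∀ x ∈ X, x ∉ W := by
      rintro x (hx | hx)
      · exact ho.fresh x hx
      · obtain ⟨z, hz, hx⟩ := Set.mem_iUnion₂.1 hx
        exact hδ z (mem_fv_box.1 hz) x hx
    have hXπ : ∀ x ∈ π.fv, ∀ y ∈ (δ x).fv, y ∈ X := fun x hx y hy =>
      .inr (Set.mem_iUnion₂.2 ⟨x, mem_fv_box.2 (.inl hx), hy⟩)
    have hXφ : ∀ x ∈ φ.fv, x ∉ π.bn → ∀ y ∈ (δ x).fv, y ∈ X := fun x hx hxb y hy =>
      .inr (Set.mem_iUnion₂.2 ⟨x, mem_fv_box.2 (.inr ⟨hx, hxb⟩), hy⟩)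
    constructor
    · intro h W₁ s R hs hR
      obtain ⟨k, ρ, A', o', W₂, r, r', hre, hf, hr, hr', hrr⟩ :=
        ho.exists_future hA hs hX Set.subset_union_left hXW
      -- The transition of the future state is renamed along `r`, so that it becomes a transition of
      -- an opened extended process.
      have hR' := hR.comp hr hf.proc fun x hx => hf.asg (δ x) (hXπ x hx)
      obtain ⟨y, B, o'', h1, h2, h3, h4, h5, h6⟩ := hf.opens.exists_extStep_inst (φ := φ) hf.nf
        (fun x hx => hf.fresh (δ x) (hXπ x hx)) (fun x hx hxb => hf.fresh (δ x) (hXφ x hx hxb)) hR'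
      exact (h6.2 ((ih h3 h4 h5).1 (h _ _ _ _ _ y hre h1 h2))).next_of_comp hR'
        (fun x hx hxb => hf.asg (δ x) (hXφ x hx hxb)) hr' hrr
    · intro h σ k ρ A' B y hre hy hAB
      obtain ⟨w, g, hst⟩ := hre.st
      have hready := (reach_iff.1 hre).1
      rw [A.dom_st] at hready
      -- The output name is given here, and the private variables of the future are chosen to avoid
      -- it.
      obtain ⟨N, o', hf, hs, -, hYW⟩ := hst.exists_future hready hA ho Set.subset_union_left hX hXW
        (Set.finite_singleton y)
      obtain ⟨R, o'', h1, h2, h3, h4, h5⟩ := hAB.opens_inst (φ := φ) hf.nf hf.opens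
        (fun x hx => hf.fresh (δ x) (hXπ x hx)) (fun x hx hxb => hf.fresh (δ x) (hXφ x hx hxb))
        (fun _ => hYW y rfl) hy
      refine (ih h2 h3 h4).2 (h5.2 (Forces.local (fun x hx => ?_)
        (h _ _ R hs (h1.of_eq hf.proc fun x hx => hf.asg (δ x) (hXπ x hx)))))
      exact nextA_congr h1 fun hxb => (hf.asg (δ x) (hXφ x hx hxb)).symm

/-! ## Bisimilar states and quasi-open bisimilarity -/

variable (E) in
/-- Bisimilarity of openings of the states `A` and `B`, by private variables outside `Y`. -/
def State.OpenBis (A B : State L) (Y : Set ℕ) : Prop :=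
  ∃ (W : Set ℕ) (m m' : ℕ) (o : Fin A.scope → ℕ ⊕ Fin m) (o' : Fin B.scope → ℕ ⊕ Fin m'),
    A.Opens W o ∧ B.Opens W o' ∧ Bis E A.dom W (A.open o) (B.open o') ∧ ∀ y ∈ Y, y ∉ W

/-- Both processes are extended by the same `σ` and `ρ`, hence by the same move of the game, and
`Bis` is closed under moves by construction. -/
theorem State.OpenBis.reachSt {A A' B B' : State L} {σ : Subst L 0} {k : ℕ} {ρ : Subst L (0 + k)}
    {w : Fin (0 + k) → Fin A'.scope} {g : Fin A.scope → Fin A'.scope}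
    {w' : Fin (0 + k) → Fin B'.scope} {g' : Fin B.scope → Fin B'.scope} {X Y : Set ℕ}
    (h : State.OpenBis E A B X) (hA : A.NF) (hB : B.NF) (hD : A.dom = B.dom)
    (hr : Ready σ ρ A.dom) (hAA : ReachSt σ ρ A A' w g) (hBB : ReachSt σ ρ B B' w' g')
    (hY : Y.Finite) : State.OpenBis E A' B' Y := by
  obtain ⟨W, m, m', o, o', ho, ho', h, -⟩ := h
  obtain ⟨N, hb, hN⟩ := exists_envBound hr.finite_left hr.finite_right
    ((hA.finite_fv.union hB.finite_fv).union hY)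
  obtain ⟨q, h1, -, h2⟩ := hAA.exists_opening hr hA hb (fun x hx => hN x (.inl (.inl hx))) ho
  obtain ⟨q', h3, -, h4⟩ := hBB.exists_opening (hD ▸ hr) hB hb
    (fun x hx => hN x (.inl (.inr hx))) ho'
  refine ⟨_, m, m', q, q', h1, h3, ?_, fun y hy hyW =>
    absurd (le_of_mem_envW hyW) (not_le.2 (hN y (.inr hy)))⟩
  rw [h2, h4, (hAA.nf hr hA).2, ← hD]
  exact h.fut _ (hb.adm W) Set.subset_union_left

/-- The trivial extension by no names renames the private variables, so they can avoid any finite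
set. -/
theorem State.OpenBis.avoid {A B : State L} {X Y : Set ℕ} (h : State.OpenBis E A B X) (hA : A.NF)
    (hB : B.NF) (hD : A.dom = B.dom) (hY : Y.Finite) : State.OpenBis E A B Y :=
  h.reachSt hA hB hD (ready_ident _) (reachSt_ident A) (reachSt_ident B) hY

theorem State.plain_open {A : State L} {m : ℕ} (o : Fin A.scope → ℕ ⊕ Fin m) :
    (A.open o).Plain A.dom := fun x hx => by
  change (A.asg x).subst (opn o) = _
  rw [A.plain x hx]; rfl

theorem State.Opens.static {A : Ext L 0} {W : Set ℕ} {m : ℕ} {o : Fin A.st.scope → ℕ ⊕ Fin m}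
    (ho : A.st.Opens W o) {M N : Msg L 0} (hM : ∀ x ∈ M.fv, x ∉ W) (hN : ∀ x ∈ N.fv, x ∉ W) :
    A.Equates E M N ↔ EqE E (ev M (A.st.open o).asg) (ev N (A.st.open o).asg) := by
  have key : ∀ M : Msg L 0, (∀ x ∈ M.fv, x ∉ W) →
      ev M (A.st.open o).asg = (ev M A.st.asg).subst (opn o) ∧
        ∀ y ∈ (ev M A.st.asg).fv, y ∉ AppliedPi.names o := by
    intro M hM
    refine ⟨(ev_subst M A.st.asg (opn o)).symm, fun y hy hyn => ?_⟩
    obtain ⟨x, hx, hy⟩ := (mem_fv_ev _ _ y).1 hy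
    exact ho.notMem_asg (hM x hx) hy (ho.names hyn)
  rw [A.equates_st, (key M hM).1, (key N hN).1]
  exact (ho.isOpening.eqE_opn (key M hM).2 (key N hN).2).symm

variable (E) in
/-- Extended processes in normal form with bisimilar openings. -/
def ExtBis (A B : Ext L 0) : Prop :=
  A.st.NF ∧ B.st.NF ∧ A.st.dom = B.st.dom ∧ State.OpenBis E A.st B.st ∅

theorem ExtBis.of_openBis {A B : Ext L 0} {Y : Set ℕ} (hA : A.st.NF) (hB : B.st.NF)
    (hD : A.st.dom = B.st.dom) (h : State.OpenBis E A.st B.st Y) : ExtBis E A B :=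
  ⟨hA, hB, hD, h.avoid hA hB hD Set.finite_empty⟩

/-- Private variables are existentially quantified in `ExtBis`, so they can first be moved away from
the messages or the action under consideration. Each clause then reduces to the corresponding
property of `Bis`. -/
theorem isQuasiOpenBisimulation_extBis : IsQuasiOpenBisimulation E (ExtBis E : Ext L 0 → _) where
  nf := fun A B h => ⟨A.nf_st.2 h.1, B.nf_st.2 h.2.1⟩
  isOpen := by
    rintro A B ⟨hA, hB, hD, h⟩ σ k ρ A' B' hAA hBB
    obtain ⟨w, g, h1⟩ := hAA.st
    obtain ⟨w', g', h2⟩ := hBB.st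
    have hr := (reach_iff.1 hAA).1
    rw [A.dom_st] at hr
    have hr' : Ready σ ρ B.st.dom := hD ▸ hr
    refine ⟨(h1.nf hr hA).1, (h2.nf hr' hB).1, ?_, h.reachSt hA hB hD hr h1 h2 Set.finite_empty⟩
    rw [(h1.nf hr hA).2, (h2.nf hr' hB).2, hD]
  symm := by
    rintro A B ⟨hA, hB, hD, W, m, m', o, o', ho, ho', h, hY⟩
    exact ⟨hB, hA, hD.symm, W, m', m, o', o, ho', ho, hD ▸ h.symm, hY⟩
  static := by
    rintro A B ⟨hA, hB, hD, h⟩ M N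
    obtain ⟨W, m, m', o, o', ho, ho', h, hY⟩ := h.avoid hA hB hD
      ((Finset.finite_toSet M.fv).union (Finset.finite_toSet N.fv))
    rw [ho.static (fun x hx => hY x (.inl hx)) (fun x hx => hY x (.inr hx)),
      ho'.static (fun x hx => hY x (.inl hx)) (fun x hx => hY x (.inr hx))]
    exact h.static hA.1 ho.infinite (State.plain_open o) (hD ▸ State.plain_open o') M N
  step := by
    rintro A B ⟨hA, hB, hD, h⟩ π A' hπ hAA
    obtain ⟨W, m, m', o, o', ho, ho', h, hY⟩ := h.avoid hA hB hD
      ((Finset.finite_toSet π.fv).union π.finite_bn)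
    have hbA : ∀ x ∈ π.bn, x ∉ A.st.fv := fun x hx hxA =>
      Set.disjoint_left.1 hπ hx (.inl (A.fv_st ▸ hxA))
    have hbB : ∀ x ∈ π.bn, x ∉ B.st.fv := fun x hx hxB =>
      Set.disjoint_left.1 hπ hx (.inr (B.fv_st ▸ hxB))
    obtain ⟨hA', hD', R, q, hR, hq, hRq⟩ := hAA.opens hA ho (fun x hx => hY x (.inl hx))
      (fun x hx => hY x (.inr hx)) hbA
    obtain ⟨R', hR', h'⟩ := h.matched hA.1 ho.infinite (State.plain_open o)
      (hD ▸ State.plain_open o') π R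
      (Set.disjoint_left.2 fun x hx hxD => hbA x hx (.inl (.inr hxD))) hR
    obtain ⟨B', hBB, hB', hD'', q', hq', hRq'⟩ := ho'.extStep hB (fun x hx => hY x (.inl hx))
      (fun x hx => hY x (.inr hx)) hbB (fun x hx hxc => by
        obtain ⟨z, hz, hxz⟩ := State.mem_fv_chan hxc (Label.ne_tau_of_mem_bn hx)
        rcases State.mem_fv_asg hxz with hxz | rfl
        · exact hbB x hx hxz
        -- If the bound variable occurs in the channel on the right, it does so as an unassigned
        -- variable of the action itself. It would then also occur in the channel on the left, where
        -- the output rule forbids it.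
        · refine hAA.notMem_chan hx ?_
          have hasg : A.st.asg x = Term.var (.inl x) :=
            A.st.plain x fun hxD => hbA x hx (.inl (.inr hxD))
          cases π with
          | out M z => exact (mem_fv_ev M _ x).2 ⟨x, hz, by rw [hasg]; simp⟩
          | _ => exact absurd hx (by simp [Label.bn])) hR'
    refine ⟨B', hBB, .of_openBis hA' hB' (by rw [hD', hD'', hD]) (Y := π.fv ∪ π.bn)
      ⟨W, _, _, q, q', hq, hq', ?_, hY⟩⟩
    rw [← hRq, ← hRq', hD']
    exact h'

/-! ### Processes as extended processes, and the distinguishing formulae. -/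

theorem nf_toExt (P : Proc L 0) : P.toExt.st.NF :=
  P.toExt.nf_st.1 ⟨by rw [Subst.dom_ident]; exact Set.finite_empty, fun x hx => absurd rfl hx⟩

theorem dom_st_toExt (P : Proc L 0) : P.toExt.st.dom = ∅ := by
  rw [← P.toExt.dom_st]; exact Subst.dom_ident

theorem opens_toExt {P : Proc L 0} {W : Set ℕ} (hP : ∀ x ∈ P.fv, x ∉ W) (hW : Wᶜ.Infinite) :
    P.toExt.st.Opens W (fun i : Fin 0 => (i.elim0 : ℕ ⊕ Fin 0)) := by
  refine ⟨⟨fun i => i.elim0, fun j => j.elim0⟩, ?_, ?_, hW⟩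
  · rintro x ⟨i, -⟩; exact i.elim0
  · intro x hx
    rw [← P.toExt.fv_st] at hx
    rcases hx with (hx | hx) | ⟨y, hy, -⟩
    · exact hP x hx
    · exact absurd rfl hx
    · exact absurd rfl hy

theorem State.open_toExt (P : Proc L 0) (o : Fin 0 → ℕ ⊕ Fin 0) :
    State.open P.toExt.st o = ⟨0, Subst.ident, P⟩ := by
  have : (opn o : Repl L 0 0) = fun a => Term.var a := by
    funext a
    rcases a with x | i
    · rfl
    · exact i.elim0
  change (⟨0, fun x => Term.subst (Term.var (.inl x)) (opn o), P.repl (opn o)⟩ : State L) = _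
  rw [this, repl_var]
  rfl

/-- A formula that distinguishes processes whose states are not related by an approximant. -/
theorem exists_sat_of_not_apx {j : ℕ} {P Q : Proc L 0} {W : Set ℕ} (hW : W.Infinite)
    (hWc : Wᶜ.Infinite) (h : ¬ Apx E j ∅ W ⟨0, Subst.ident, P⟩ ⟨0, Subst.ident, Q⟩) :
    ∃ φ : Formula L, Sat E P.toExt φ ∧ ¬ Sat E Q.toExt φ := by
  obtain ⟨φ, -, h1, h2⟩ := exists_distinguishing Set.finite_empty hW hWc h
    Function.injective_id (α := Subst.ident) (Δ₁ := Subst.ident) (Δ₁' := Subst.ident)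
    (fun _ => rfl) (fun _ => rfl) (by simp) (by simp)
  have key : ∀ P : Proc L 0, Sat E P.toExt φ ↔ Forces E φ ∅ Subst.ident P := by
    intro P
    rw [Sat, satInst_iff (nf_toExt P) (opens_toExt (W := ∅) (by simp)
      (by simp [Set.infinite_univ])) (by simp), State.open_toExt]
    rfl
  refine ⟨φ, (key P).2 h1, fun h3 => h2 ?_⟩
  -- Satisfaction is forcing in the world `∅`, which would persist to `W`, where the formula is
  -- refuted.
  have h4 := ((key Q).1 h3).adm (adm_ident hWc (Set.empty_subset W))
  simpa only [fs_ident, subst_var, repl_var] using h4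

/-- Processes that are not quasi-open bisimilar are distinguished by an approximant. -/
theorem exists_not_apx {P Q : Proc L 0} (h : ¬ QuasiOpenBisimilar E P.toExt Q.toExt) {W : Set ℕ}
    (hWc : Wᶜ.Infinite) (hP : ∀ x ∈ P.fv, x ∉ W) (hQ : ∀ x ∈ Q.fv, x ∉ W) :
    ∃ j, ¬ Apx E j ∅ W (⟨0, Subst.ident, P⟩ : State L) ⟨0, Subst.ident, Q⟩ := by
  by_contra hn
  push Not at hn
  refine h ⟨ExtBis E, isQuasiOpenBisimulation_extBis, nf_toExt P, nf_toExt Q, ?_,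
    W, 0, 0, _, _, opens_toExt hP hWc, opens_toExt hQ hWc, ?_, by simp⟩
  · rw [dom_st_toExt, dom_st_toExt]
  · rw [dom_st_toExt, State.open_toExt, State.open_toExt]
    exact hn

theorem exists_private (F : Finset ℕ) :
    ∃ W : Set ℕ, W.Infinite ∧ Wᶜ.Infinite ∧ ∀ x ∈ F, x ∉ W := by
  obtain ⟨N, hN⟩ := exists_bound F F.finite_toSet
  refine ⟨Set.range fun k => 2 * k + N, Set.infinite_range_of_injective fun a b hab => ?_,
    infinite_compl_of Set.finite_empty N ?_, ?_⟩
  · have : 2 * a + N = 2 * b + N := hab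
    omega
  · rintro _ ⟨k, rfl⟩; exact .inr ⟨k, rfl⟩
  · rintro x hx ⟨k, rfl⟩
    have : 2 * k + N < N := hN _ hx
    omega

/-- Processes that are not quasi-open bisimilar are distinguished by a formula. -/
theorem exists_distinguishing_formulae {P Q : Proc L 0}
    (h : ¬ QuasiOpenBisimilar E P.toExt Q.toExt) :
    (∃ φ : Formula L, Sat E P.toExt φ ∧ ¬ Sat E Q.toExt φ) ∧
      ∃ φ : Formula L, Sat E Q.toExt φ ∧ ¬ Sat E P.toExt φ := by
  -- The private variables are unused by both processes; they are infinitely many and leave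
  -- infinitely many public variables.
  obtain ⟨W, hW, hWc, hF⟩ := exists_private (P.fv ∪ Q.fv)
  obtain ⟨j, hj⟩ := exists_not_apx h hWc (fun x hx => hF x (Finset.mem_union_left _ hx))
    fun x hx => hF x (Finset.mem_union_right _ hx)
  exact ⟨exists_sat_of_not_apx hW hWc hj, exists_sat_of_not_apx hW hWc fun h => hj h.symm⟩

end

end AppliedPi

theorem theorem4p3 {L : FirstOrder.Language.{u, v}} (E : Set (L.Term ℕ × L.Term ℕ))
    (hE : AppliedPi.Finitary E) (P Q : AppliedPi.Proc L 0)
    (hPQ : ¬ AppliedPi.QuasiOpenBisimilar E P.toExt Q.toExt) :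
    (∃ φL : AppliedPi.Formula L,
      AppliedPi.Sat E P.toExt φL ∧ ¬ AppliedPi.Sat E Q.toExt φL) ∧
    (∃ φR : AppliedPi.Formula L,
      AppliedPi.Sat E Q.toExt φR ∧ ¬ AppliedPi.Sat E P.toExt φR) := by
  exact AppliedPi.exists_distinguishing_formulae hPQ
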